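/- **Conventions.** A *singleton Grothendieck pretopology* on a category $\mathcal C$ is a class $\mathcal T$ of morphisms (the *covers*) that contains all isomorphisms, is closed under composition, and is such that the pullback of a cover along any morphism exists and is a cover. For a simplicial object $X$ in $\mathcal C$ and a simplicial set $S$ let $\operatorname{Hom}(S,X)$ be the presheaf on $\mathcal C$ with $\operatorname{Hom}(S,X)(Z)=\hom_{\mathsf{sSet}}(S,\hom_{\mathcal C}(Z,X_\bullet))$. For $R\to S$ and $\pi\colon X\to Y$ put $\operatorname{Hom}(R\to S,X\to Y)=\operatorname{Hom}(R,X)\times_{\operatorname{Hom}(R,Y)}\operatorname{Hom}(S,Y)$. Saying that a map of presheaves is a cover (an isomorphism in $\mathcal C$) includes that its source and target are representable. The object $X$ satisfies $\mathrm{Kan}(m,k)$ (resp. $\mathrm{Kan}!(m,k)$) if $\operatorname{Hom}(\Delta^m,X)\to\operatorname{Hom}(\Lambda^m_k,X)$ is a cover (resp. an isomorphism); $\pi\colon X\to Y$ satisfies it if $\operatorname{Hom}(\Delta^m,X)\to\operatorname{Hom}(\Lambda^m_k\to\Delta^m,X\to Y)$ is a cover (resp. an isomorphism). For $0\le n\le\infty$,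 an *$n$-groupoid* in $(\mathcal C,\mathcal T)$ is a simplicial object satisfying $\mathrm{Kan}(m,k)$ for all $m\ge1$, $0\le k\le m$, and $\mathrm{Kan}!(m,k)$ for all $m\ge 1$ with $m>n$, $0\le k\le m$. Let $\mathcal C$ have a terminal object $*$ and finite coproducts, and let $j(\Delta^1)$ be the simplicial object $[m]\mapsto\bigsqcup_{\Delta^1_m}*$. Let $\pi\colon Y\to j(\Delta^1)$ be a simplicial object over it. Its two *ends* are the preimages of the vertices $0$ and $1$ of $\Delta^1$. For $i,j\ge0$ with $i+j=m+1$ let $\chi_{i,j}\colon\Delta^m\to\Delta^1$ send the first $i$ vertices to $0$ and the last $j$ vertices to $1$. For $A=\Delta^m$ or $A=\Lambda^m_k$ let $\operatorname{Hom}(A[i,j],Y)\subseteq\operatorname{Hom}(A,Y)$ be the subpresheaf of those diagrams whose image under $\pi$ is the one given by $\chi_{i,j}|_A$. Then $\pi$ satisfies the *colored Kan condition* $\mathrm{Kan}(m,k)[i,j]$ (resp. $\mathrm{Kan}!(m,k)[i,j]$) if $\operatorname{Hom}(\Delta^m[i,j],Y)\to\operatorname{Hom}(\Lambda^m_k[i,j],Y)$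 is a cover (resp. an isomorphism). Call $\pi$ *admissible of level $n$* if its two ends are $n$-groupoids in $(\mathcal C,\mathcal T)$, and $\pi$ satisfies $\mathrm{Kan}(m,k)$ for all $m\ge2$, $0<k<m$, and $\mathrm{Kan}!(m,k)$ for all $m>n$, $0<k<m$. **Theorem.** 1. Let $\mathcal C$ be an extensive category with a terminal object and with a singleton Grothendieck pretopology $\mathcal T$ such that (a) $f_1\sqcup f_2$ is a cover if and only if $f_1$ and $f_2$ are covers, and (b) if $g_2\circ g_1$ is a cover, then so is $g_2$. Let $0\le n\le\infty$ and let $\pi\colon Y\to j(\Delta^1)$ be admissible of level $n$. Then, for all $i,j\ge 0$ with $i+j=m+1$, $\pi$ satisfies $\mathrm{Kan}(m,0)[i,j]$ if $i\ge2$, and $\mathrm{Kan}(m,m)[i,j]$ if $j\ge2$. The same conclusion holds, for all $0\le n\le\infty$, for the category of smooth manifolds (Hausdorff, second countable, finite-dimensional, where the dimension may vary between components) with surjective submersions as covers, although (b) fails there. 2. Let $(\mathcal C,\mathcal T)$ be either sets with surjections or smooth manifolds with surjective submersions, and let $\pi\colon Y\to j(\Delta^1)$ be admissible of level $2$. Then,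 for all $m>2$ and $i,j\ge 0$ with $i+j=m+1$, $\pi$ satisfies $\mathrm{Kan}!(m,0)[i,j]$ if $i\ge2$, and $\mathrm{Kan}!(m,m)[i,j]$ if $j\ge2$. -/

import Mathlib

open CategoryTheory CategoryTheory.Limits Opposite Simplicial
open scoped ContDiff

universe u v w

namespace HigherGpd

/-! ### Singleton Grothendieck pretopologies -/

/-- A singleton Grothendieck pretopology: a class of morphisms (the covers) that contains the
isomorphisms, is closed under composition, and along which pullbacks exist and are covers. -/
structure IsSingletonPretopology {C : Type u} [Category.{v} C] (J : MorphismProperty C) :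
    Prop where
  of_isIso : ∀ {X Y : C} (f : X ⟶ Y), IsIso f → J f
  comp : ∀ {X Y Z : C} (f : X ⟶ Y) (g : Y ⟶ Z), J f → J g → J (f ≫ g)
  hasPullback : ∀ {X Y Z : C} (f : Y ⟶ X) (g : Z ⟶ X), J f → HasPullback f g
  pullback : ∀ {P X Y Z : C} {p : P ⟶ Y} {q : P ⟶ Z} {f : Y ⟶ X} {g : Z ⟶ X},
    IsPullback p q f g → J f → J q

/-- A binary coproduct of two morphisms is a cover if and only if both morphisms are covers. -/
def CompatibleWithCoproducts {C : Type u} [Category.{v} C] [HasFiniteCoproducts C]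
    (J : MorphismProperty C) : Prop :=
  ∀ {X₁ X₂ Y₁ Y₂ : C} (f₁ : Y₁ ⟶ X₁) (f₂ : Y₂ ⟶ X₂), J (coprod.map f₁ f₂) ↔ J f₁ ∧ J f₂

/-- If a composite "first `g₁`, then `g₂`" is a cover, then so is `g₂`. -/
def RightCancellative {C : Type u} [Category.{v} C] (J : MorphismProperty C) : Prop :=
  ∀ {X Y Z : C} (g₁ : X ⟶ Y) (g₂ : Y ⟶ Z), J (g₁ ≫ g₂) → J g₂

/-! ### Presheaves of diagrams in a simplicial object -/

/-- The `Z`-points of a simplicial object `X`: the simplicial set `n ↦ hom(Z, Xₙ)`, functorially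
in `X` and (contravariantly) in `Z`. -/
def points (C : Type u) [Category.{v} C] : SimplicialObject C ⥤ Cᵒᵖ ⥤ SSet.{v} :=
  (Functor.whiskeringRight SimplexCategoryᵒᵖ C (Cᵒᵖ ⥤ Type v)).obj yoneda ⋙ flipFunctor _ _ _

/-- The presheaf `Hom(S, X)` of diagrams of shape `S` in `X`. Its value at `Z` is the set of
families of maps `Sₙ → hom(Z, Xₙ)` that are compatible with the simplicial structure. -/
def homDiagrams {C : Type u} [Category.{v} C] (S : SSet.{v}) (X : SimplicialObject C) :
    Cᵒᵖ ⥤ Type v :=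
  (points C).obj X ⋙ coyoneda.obj (op S)

/-- The restriction `Hom(S, X) ⟶ Hom(R, X)` along `R ⟶ S`. -/
def homDiagramsRestrict {C : Type u} [Category.{v} C] {R S : SSet.{v}} (i : R ⟶ S)
    (X : SimplicialObject C) : homDiagrams S X ⟶ homDiagrams R X :=
  Functor.whiskerLeft ((points C).obj X) (coyoneda.map i.op)

/-- The `Z`-points of a morphism of simplicial objects, as an object of the arrow category. -/
def arrowPoints {C : Type u} [Category.{v} C] {X Y : SimplicialObject C} (π : X ⟶ Y) :
    Cᵒᵖ ⥤ Arrow SSet.{v} where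
  obj Z := Arrow.mk (((points C).map π).app Z)
  map f := Arrow.homMk (((points C).obj X).map f) (((points C).obj Y).map f)
    (((points C).map π).naturality f)

/-- The presheaf `Hom(R → S, X → Y) = Hom(R, X) ×_{Hom(R, Y)} Hom(S, Y)`: its value at `Z` is the
set of commutative squares from `R → S` to the `Z`-points of `X → Y`. -/
def homSquares {C : Type u} [Category.{v} C] {R S : SSet.{v}} (i : R ⟶ S)
    {X Y : SimplicialObject C} (π : X ⟶ Y) : Cᵒᵖ ⥤ Type v :=
  arrowPoints π ⋙ coyoneda.obj (op (Arrow.mk i))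

/-- The canonical map `Hom(S, X) ⟶ Hom(R → S, X → Y)`. -/
def toHomSquares {C : Type u} [Category.{v} C] {R S : SSet.{v}} (i : R ⟶ S)
    {X Y : SimplicialObject C} (π : X ⟶ Y) : homDiagrams S X ⟶ homSquares i π where
  app Z := ↾ fun (σ : S ⟶ ((points C).obj X).obj Z) =>
    (Arrow.homMk (i ≫ σ) (σ ≫ ((points C).map π).app Z) (by simp) :
      Arrow.mk i ⟶ Arrow.mk (((points C).map π).app Z))
  naturality Z W f := by
    ext σ
    refine Arrow.hom_ext _ _ ?_ ?_
    · exact (Category.assoc _ _ _).symm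
    · change (σ ≫ ((points C).obj X).map f) ≫ ((points C).map π).app W =
        (σ ≫ ((points C).map π).app Z) ≫ ((points C).obj Y).map f
      exact (Category.assoc _ _ _).trans ((congrArg (σ ≫ ·)
        (((points C).map π).naturality f)).trans (Category.assoc _ _ _).symm)

/-- A map of presheaves whose source and target are representable and which corresponds under the
Yoneda embedding to a morphism with the property `P`. -/
def RepresentedBy {C : Type u} [Category.{v} C] (P : MorphismProperty C) {F G : Cᵒᵖ ⥤ Type v}
    (φ : F ⟶ G) : Prop :=
  ∃ (A B : C) (a : yoneda.obj A ≅ F) (b : yoneda.obj B ≅ G) (f : A ⟶ B),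
    P f ∧ a.hom ≫ φ = yoneda.map f ≫ b.hom

/-! ### Kan conditions and higher groupoids -/

/-- `Kan(m, k)` for a simplicial object when `P` is the class of covers, and `Kan!(m, k)` when `P`
is the class of isomorphisms. -/
def Kan {C : Type u} [Category.{v} C] (P : MorphismProperty C) (m : ℕ) (k : Fin (m + 1))
    (X : SimplicialObject C) : Prop :=
  RepresentedBy P (homDiagramsRestrict (SSet.horn.{v} m k).ι X)

/-- An `n`-groupoid object in `(C, J)`, for `0 ≤ n ≤ ∞`. -/
def IsNGroupoid {C : Type u} [Category.{v} C] (J : MorphismProperty C) (n : ℕ∞)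
    (X : SimplicialObject C) : Prop :=
  ∀ (m : ℕ) (k : Fin (m + 1)), 1 ≤ m →
    Kan J m k X ∧ (n < (m : ℕ∞) → Kan (MorphismProperty.isomorphisms C) m k X)

/-- `Kan(m, k)` (or `Kan!(m, k)`, if `P` is the class of isomorphisms) for a morphism of
simplicial objects. -/
def RelativeKan {C : Type u} [Category.{v} C] (P : MorphismProperty C) (m : ℕ) (k : Fin (m + 1))
    {X Y : SimplicialObject C} (π : X ⟶ Y) : Prop :=
  RepresentedBy P (toHomSquares (SSet.horn.{v} m k).ι π)

/-- The inner Kan conditions `Kan(m, k)` for `m ≥ 2`, `0 < k < m`, and `Kan!(m, k)` for `m > n`,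
`0 < k < m`. -/
def SatisfiesInnerKan {C : Type u} [Category.{v} C] (J : MorphismProperty C) (n : ℕ∞)
    {X Y : SimplicialObject C} (π : X ⟶ Y) : Prop :=
  ∀ (m : ℕ) (k : Fin (m + 1)), 0 < k → k < Fin.last m →
    RelativeKan J m k π ∧
      (n < (m : ℕ∞) → RelativeKan (MorphismProperty.isomorphisms C) m k π)

/-! ### Colored simplicial objects -/

/-- The simplicial object `j(Δ¹)`: in degree `n` it is the coproduct of copies of the terminal
object indexed by the `n`-simplices `[n] → [1]` of `Δ¹`. -/
noncomputable def jInterval (C : Type u) [Category.{v} C] [HasTerminal C]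
    [HasFiniteCoproducts C] : SimplicialObject C where
  obj n := ∐ fun _ : n.unop ⟶ ⦋1⦌ => ⊤_ C
  map {n p} θ := Sigma.desc fun f : n.unop ⟶ ⦋1⦌ =>
    Sigma.ι (fun _ : p.unop ⟶ ⦋1⦌ => ⊤_ C) (θ.unop ≫ f)
  map_id n := by
    refine Sigma.hom_ext _ _ fun f => ?_
    simp
  map_comp θ η := by
    refine Sigma.hom_ext _ _ fun f => ?_
    simp

/-- The map `χ : [m] → [1]` that sends the first `i` vertices to `0` and the remaining ones
(`j` many if `i + j = m + 1`) to `1`. -/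
def colorMap (m i : ℕ) : ⦋m⦌ ⟶ ⦋1⦌ :=
  SimplexCategory.Hom.mk
    { toFun := fun k => if k.val < i then 0 else 1
      monotone' := by
        intro a b hab
        have : a.val ≤ b.val := hab
        dsimp only
        split_ifs
        · exact le_rfl
        · exact Fin.zero_le _
        · omega
        · exact le_rfl }

/-- For `f : [n] → [1]`, the morphism `Z → * → j(Δ¹)ₙ` onto the copy of the terminal object with
index `f`. -/
noncomputable def colorPoint {C : Type u} [Category.{v} C] [HasTerminal C] [HasFiniteCoproducts C]
    {n : SimplexCategory} (f : n ⟶ ⦋1⦌) (Z : C) : Z ⟶ (jInterval C).obj (op n) :=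
  terminal.from Z ≫ Sigma.ι (fun _ : (op n).unop ⟶ ⦋1⦌ => ⊤_ C) f

/-- The map from `Δ[m]` to the `Z`-points of `j(Δ¹)` that is induced by `χ : [m] → [1]` and
`Z → *`. -/
noncomputable def colorPointMap {C : Type u} [Category.{v} C] [HasTerminal C]
    [HasFiniteCoproducts C] {m : ℕ} (f : ⦋m⦌ ⟶ ⦋1⦌) (Z : Cᵒᵖ) :
    (Δ[m] : SSet.{v}) ⟶ ((points C).obj (jInterval C)).obj Z :=
  SSet.yonedaEquiv.symm (colorPoint f Z.unop)

lemma colorPointMap_naturality {C : Type u} [Category.{v} C] [HasTerminal C]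
    [HasFiniteCoproducts C] {m : ℕ} (f : ⦋m⦌ ⟶ ⦋1⦌) {Z W : Cᵒᵖ} (g : Z ⟶ W) :
    colorPointMap f Z ≫ ((points C).obj (jInterval C)).map g = colorPointMap f W := by
  apply SSet.yonedaEquiv.injective
  rw [SSet.yonedaEquiv_comp]
  unfold colorPointMap
  erw [Equiv.apply_symm_apply, Equiv.apply_symm_apply]
  refine (Category.assoc g.unop (terminal.from Z.unop)
    (Sigma.ι (fun _ : (op ⦋m⦌).unop ⟶ ⦋1⦌ => ⊤_ C) f)).symm.trans ?_
  exact congrArg (· ≫ Sigma.ι (fun _ : (op ⦋m⦌).unop ⟶ ⦋1⦌ => ⊤_ C) f) (terminal.hom_ext _ _)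

/-- For `a : A → Δ[m]` (a horn inclusion or the identity of `Δ[m]`) and a coloring `χ` of `[m]`,
the presheaf of diagrams of shape `A` in the colored simplicial object `π : X → j(Δ¹)` whose
colors are given by `χ`. -/
noncomputable def coloredDiagrams {C : Type u} [Category.{v} C] [HasTerminal C]
    [HasFiniteCoproducts C] {X : SimplicialObject C} (π : X ⟶ jInterval C) {m : ℕ}
    (χ : ⦋m⦌ ⟶ ⦋1⦌) {A : SSet.{v}} (a : A ⟶ Δ[m]) : Cᵒᵖ ⥤ Type v where
  obj Z := { σ : A ⟶ ((points C).obj X).obj Z //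
    σ ≫ ((points C).map π).app Z = a ≫ colorPointMap χ Z }
  map {Z W} g := ↾ fun σ => ⟨σ.1 ≫ ((points C).obj X).map g, by
    rw [Category.assoc, ((points C).map π).naturality, ← Category.assoc, σ.2, Category.assoc,
      colorPointMap_naturality]⟩
  map_id Z := by
    refine ConcreteCategory.hom_ext _ _ fun σ => Subtype.ext ?_
    change σ.1 ≫ ((points C).obj X).map (𝟙 Z) = σ.1
    rw [CategoryTheory.Functor.map_id, Category.comp_id]
  map_comp g h := by
    refine ConcreteCategory.hom_ext _ _ fun σ => Subtype.ext ?_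
    change σ.1 ≫ ((points C).obj X).map (g ≫ h) =
      (σ.1 ≫ ((points C).obj X).map g) ≫ ((points C).obj X).map h
    rw [CategoryTheory.Functor.map_comp, Category.assoc]

/-- The restriction `Hom(Δ[m][χ], X) ⟶ Hom(A[χ], X)` along `a : A → Δ[m]`. -/
noncomputable def coloredRestrict {C : Type u} [Category.{v} C] [HasTerminal C]
    [HasFiniteCoproducts C] {X : SimplicialObject C} (π : X ⟶ jInterval C) {m : ℕ}
    (χ : ⦋m⦌ ⟶ ⦋1⦌) {A : SSet.{v}} (a : A ⟶ Δ[m]) :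
    coloredDiagrams π χ (𝟙 (Δ[m] : SSet.{v})) ⟶ coloredDiagrams π χ a where
  app Z := ↾ fun σ => ⟨a ≫ σ.1, by rw [Category.assoc, σ.2, Category.id_comp]⟩
  naturality Z W g := by
    ext σ
    exact Subtype.ext (Category.assoc _ _ _).symm

/-- The colored Kan condition `Kan(m, k)[i, j]`, where `j = m + 1 - i`; it is the unique one,
`Kan!(m, k)[i, j]`, if `P` is the class of isomorphisms. -/
def ColoredKan {C : Type u} [Category.{v} C] [HasTerminal C] [HasFiniteCoproducts C]
    (P : MorphismProperty C) {X : SimplicialObject C} (π : X ⟶ jInterval C) (m : ℕ)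
    (k : Fin (m + 1)) (i : ℕ) : Prop :=
  RepresentedBy P (coloredRestrict π (colorMap m i) (SSet.horn.{v} m k).ι)

/-- `e : E → X` exhibits `E` as the end of `π : X → j(Δ¹)` over the vertex `c` of `Δ¹`, that is,
as the preimage of `c`. -/
def IsEnd {C : Type u} [Category.{v} C] [HasTerminal C] [HasFiniteCoproducts C]
    {X : SimplicialObject C} (π : X ⟶ jInterval C) (c : Fin 2) {E : SimplicialObject C}
    (e : E ⟶ X) : Prop :=
  ∀ n : SimplexCategory, IsPullback (e.app (op n)) (terminal.from (E.obj (op n)))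
    (π.app (op n))
    (Sigma.ι (fun _ : (op n).unop ⟶ ⦋1⦌ => ⊤_ C) (SimplexCategory.const n ⦋1⦌ c))

/-- The two ends of `π : X → j(Δ¹)` are `n`-groupoids in `(C, J)`. -/
def EndsAreNGroupoids {C : Type u} [Category.{v} C] [HasTerminal C] [HasFiniteCoproducts C]
    (J : MorphismProperty C) (n : ℕ∞) {X : SimplicialObject C} (π : X ⟶ jInterval C) : Prop :=
  ∀ c : Fin 2, ∃ (E : SimplicialObject C) (e : E ⟶ X), IsEnd π c e ∧ IsNGroupoid J n E

end HigherGpd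

/-! ### The category of manifolds -/

/-- A smooth manifold: a second countable Hausdorff space with a smooth atlas of finite-dimensional
charts. The dimension may vary from one connected component to another. -/
structure Mfd : Type (u + 1) where
  carrier : Type u
  [top : TopologicalSpace carrier]
  [t2 : T2Space carrier]
  [secondCountable : SecondCountableTopology carrier]
  /-- the `n`-dimensional charts -/
  atlas : ∀ n : ℕ, Set (OpenPartialHomeomorph carrier (EuclideanSpace ℝ (Fin n)))
  exists_chart : ∀ x : carrier, ∃ n, ∃ e ∈ atlas n, x ∈ e.source
  compatible : ∀ {n p : ℕ}, ∀ e ∈ atlas n, ∀ e' ∈ atlas p,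
    ContDiffOn ℝ ∞ (e' ∘ e.symm) (e.target ∩ e.symm ⁻¹' e'.source)

namespace Mfd

attribute [instance] Mfd.top Mfd.t2 Mfd.secondCountable

/-- A map between manifolds is smooth if it is continuous and smooth in charts. -/
structure IsSmooth {M N : Mfd.{u}} (f : M.carrier → N.carrier) : Prop where
  continuous : Continuous f
  contDiffOn : ∀ {n p : ℕ}, ∀ e ∈ M.atlas n, ∀ e' ∈ N.atlas p,
    ContDiffOn ℝ ∞ (e' ∘ f ∘ e.symm) (e.target ∩ e.symm ⁻¹' (f ⁻¹' e'.source))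

lemma IsSmooth.id (M : Mfd.{u}) : IsSmooth (M := M) (N := M) (fun x => x) where
  continuous := continuous_id
  contDiffOn e he e' he' := M.compatible e he e' he'

lemma IsSmooth.comp {M N L : Mfd.{u}} {g : N.carrier → L.carrier} {f : M.carrier → N.carrier}
    (hg : IsSmooth g) (hf : IsSmooth f) : IsSmooth (M := M) (N := L) (fun x => g (f x)) where
  continuous := hg.continuous.comp hf.continuous
  contDiffOn e he e'' he'' := by
    intro y hy
    obtain ⟨p, e', he', hx⟩ := N.exists_chart (f (e.symm y))
    have h1 := hf.contDiffOn e he e' he' y ⟨hy.1, hx⟩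
    have h2 := hg.contDiffOn e' he' e'' he'' (e' (f (e.symm y)))
      ⟨e'.map_source hx, by
        change g (e'.symm (e' (f (e.symm y)))) ∈ e''.source
        rw [e'.left_inv hx]; exact hy.2⟩
    have hopen : IsOpen (e.target ∩ e.symm ⁻¹' (f ⁻¹' e'.source)) :=
      e.isOpen_inter_preimage_symm (e'.open_source.preimage hf.continuous)
    have hnhds : (e.target ∩ e.symm ⁻¹' (f ⁻¹' e'.source)) ∈ nhds y :=
      hopen.mem_nhds ⟨hy.1, hx⟩
    set s := e.target ∩ e.symm ⁻¹' ((fun x => g (f x)) ⁻¹' e''.source)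
    set t := e.target ∩ e.symm ⁻¹' (f ⁻¹' e'.source)
    have h3 : ContDiffWithinAt ℝ ∞ ((e'' ∘ g ∘ e'.symm) ∘ (e' ∘ f ∘ e.symm)) (s ∩ t) y := by
      refine ContDiffWithinAt.comp y h2 (h1.mono Set.inter_subset_right) ?_
      rintro z ⟨hz, hz'⟩
      refine ⟨e'.map_source hz'.2, ?_⟩
      change g (e'.symm (e' (f (e.symm z)))) ∈ e''.source
      rw [e'.left_inv hz'.2]; exact hz.2
    have h4 : ContDiffWithinAt ℝ ∞ (e'' ∘ (fun x => g (f x)) ∘ e.symm) (s ∩ t) y := by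
      refine h3.congr ?_ ?_
      · rintro z ⟨-, hz'⟩
        change e'' (g (f (e.symm z))) = e'' (g (e'.symm (e' (f (e.symm z)))))
        rw [e'.left_inv hz'.2]
      · change e'' (g (f (e.symm y))) = e'' (g (e'.symm (e' (f (e.symm y)))))
        rw [e'.left_inv hx]
    exact (contDiffWithinAt_inter hnhds).1 h4

/-- Morphisms of manifolds are smooth maps. -/
@[ext]
structure Hom (M N : Mfd.{u}) where
  toFun : M.carrier → N.carrier
  smooth : IsSmooth toFun

instance : Category.{u} Mfd.{u} where
  Hom := Hom
  id M := ⟨fun x => x, IsSmooth.id M⟩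
  comp f g := ⟨fun x => g.toFun (f.toFun x), g.smooth.comp f.smooth⟩

/-- The one-point manifold. -/
def point : Mfd.{u} where
  carrier := PUnit
  atlas n := { e | n = 0 ∧ e.source = Set.univ }
  exists_chart x := by
    refine ⟨0, (Homeomorph.homeomorphOfUnique PUnit
      (EuclideanSpace ℝ (Fin 0))).toOpenPartialHomeomorph, ⟨rfl, rfl⟩, trivial⟩
  compatible := by
    rintro n p e ⟨rfl, he⟩ e' ⟨rfl, he'⟩
    have h : ContDiff ℝ ∞ (e' ∘ e.symm : EuclideanSpace ℝ (Fin 0) → EuclideanSpace ℝ (Fin 0)) :=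
      contDiff_of_subsingleton
    exact h.contDiffOn

instance : HasTerminal Mfd.{u} := by
  have : ∀ M : Mfd.{u}, Unique (M ⟶ point.{u}) := fun M =>
    { default :=
        { toFun := fun _ => PUnit.unit
          smooth :=
            { continuous := continuous_const
              contDiffOn := by
                intro n p e he e' he'
                have h : ContDiff ℝ ∞ (fun _ : EuclideanSpace ℝ (Fin n) => e' PUnit.unit) :=
                  contDiff_const
                exact h.contDiffOn } }
      uniq := fun f => Hom.ext (funext fun _ => rfl) }
  exact hasTerminal_of_unique point

/-- The disjoint union of a finite family of manifolds. -/
noncomputable def sigma {k : ℕ} (M : Fin k → Mfd.{u}) : Mfd.{u} where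
  carrier := Σ i, (M i).carrier
  atlas n := { e | ∃ (i : Fin k), ∃ c ∈ (M i).atlas n,
    e = c.lift_openEmbedding (Topology.IsOpenEmbedding.sigmaMk (i := i)) }
  exists_chart := by
    rintro ⟨i, x⟩
    obtain ⟨n, c, hc, hx⟩ := (M i).exists_chart x
    exact ⟨n, _, ⟨i, c, hc, rfl⟩, ⟨x, hx, rfl⟩⟩
  compatible := by
    rintro n p _ ⟨i, c, hc, rfl⟩ _ ⟨i', c', hc', rfl⟩
    by_cases h : i = i'
    · subst h
      refine ((M i).compatible c hc c' hc').congr_mono ?_ ?_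
      · intro y _
        exact OpenPartialHomeomorph.lift_openEmbedding_apply c'
          (Topology.IsOpenEmbedding.sigmaMk (i := i))
      · rintro y ⟨hy, z, hz, hzy⟩
        have h : z = c.symm y := sigma_mk_injective (β := fun i => (M i).carrier) hzy
        rw [h] at hz
        exact ⟨hy, hz⟩
    · intro y hy
      obtain ⟨-, z, hz, hzy⟩ := hy
      exact absurd (congrArg Sigma.fst hzy).symm h

instance : HasFiniteCoproducts Mfd.{u} := by
  refine ⟨fun k => ?_⟩
  have key : ∀ M : Fin k → Mfd.{u}, HasCoproduct M := by
    intro M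
    have hι : ∀ i, IsSmooth (M := M i) (N := sigma M) (fun x => ⟨i, x⟩) := fun i =>
      { continuous := continuous_sigmaMk (σ := fun i => (M i).carrier)
        contDiffOn := by
          rintro n p e he _ ⟨i', c', hc', rfl⟩
          intro y hy
          obtain ⟨-, z, hz, hzy⟩ := id hy
          obtain rfl : i' = i := congrArg Sigma.fst hzy
          refine ((M i').compatible e he c' hc').congr_mono ?_ ?_ y hy
          · intro y _
            exact OpenPartialHomeomorph.lift_openEmbedding_apply c'
              (Topology.IsOpenEmbedding.sigmaMk (i := i'))
          · rintro y ⟨hy, z, hz, hzy⟩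
            have h : z = e.symm y := sigma_mk_injective (β := fun i => (M i).carrier) hzy
            rw [h] at hz
            exact ⟨hy, hz⟩ }
    refine ⟨⟨⟨Cofan.mk (sigma M) fun i => (⟨fun x => ⟨i, x⟩, hι i⟩ : Hom (M i) (sigma M)),
      Cofan.IsColimit.mk _ (fun s => ⟨fun x => (s.inj x.1).toFun x.2, ?_⟩) ?_ ?_⟩⟩⟩
    · refine ⟨continuous_sigma fun i => (s.inj i).smooth.continuous, ?_⟩
      rintro n p _ ⟨i, c, hc, rfl⟩ e' he'
      exact (s.inj i).smooth.contDiffOn c hc e' he'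
    · intro s i
      rfl
    · intro s m hm
      refine Hom.ext (funext fun x => ?_)
      exact congrArg (fun f => Hom.toFun f x.2) (hm x.1)
  refine ⟨fun F => ?_⟩
  have := key (fun i => F.obj ⟨i⟩)
  exact hasColimit_of_iso (Discrete.natIsoFunctor (F := F))

/-- Surjective submersions: smooth maps that are surjective and whose differential, in charts, is
surjective at every point. -/
def surjectiveSubmersions : MorphismProperty Mfd.{u} := fun M N f =>
  Function.Surjective (Hom.toFun f) ∧
    ∀ {n p : ℕ}, ∀ e ∈ M.atlas n, ∀ e' ∈ N.atlas p, ∀ x ∈ e.source,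
      Hom.toFun f x ∈ e'.source →
        Function.Surjective (fderiv ℝ (e' ∘ Hom.toFun f ∘ e.symm) (e x))

end Mfd

namespace HigherGpd

/-! ### Maps of presheaves that are representable by covers -/

/-! Diagrams with prescribed colors are compatible families on sieves in the category of simplices
of Δ¹, and a subcomplex of a simplex is a lower set of sets of vertices. `IsCovering` is relative
representability by covers. Unlike `RepresentedBy` it asks nothing of the target, so it is stable
under composition and base change, and the unique Kan conditions are the case where the covers are
the isomorphisms. Attaching a simplex along a horn is a base change of restriction to that horn.
Hence `isCovering_of_toggle`: if adding and removing a vertex v preserves the difference of two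
subcomplexes, then restriction between them is built from horns at v.

Consider the horn at vertex 0 of a simplex whose first two vertices have color 0. If all vertices
have color 0, the Kan condition of an end applies. Otherwise the simplex is a join [1] * T with T
nonempty, and the horn is the union of [1] * ∂T and {0} * T. Let E and W be the simplicial
presheaves of families on [n] * T and on [n] * ∂T. A family on the horn is an edge f of W together
with a lift of its source to E, and a filler is a lift of f with this source. By
`isCovering_joinHorn`, inner horns and horns in the end of color 0 suffice to make q : E → W a right
fibration up to covers, and they also provide fillers in W. Now Joyal's argument for special outer
horns applies (`liftsFromSource`). The edge f has a right inverse g, and g has a right inverse h.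
Two fillers of Λ[3,1] show that h is homotopic to f. A right fibration lifts g with prescribed
target, then the triangle relating g and h, which lifts h with prescribed source, and then the
homotopy, which lifts f.

This yields fillers after passing to a cover. For restriction to the horn to be a cover, the horn
must be representable, which follows by induction on the dimension (`isRep_outerHorn`), and covers
must be recognizable from local sections (`DetectsCovers`). Under right cancellation a single local
section is enough. A map of manifolds needs a local section through each point of its source, and
therefore every lifting statement carries a lift prescribed over an auxiliary object P, along which
all covers split; the initial object and the point are used.

For level 2 and dimension at least 3, T has at least two vertices, so that q lifts uniquely along
Λ[1,1] and Λ[2,1]. Two lifts of f with the same source then agree, because both targets are the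
source of a lift of a right inverse of f (`lifts_eq_of_source_eq`). The right inverse exists only
over a cover, but covers are epimorphisms; and a cover that is a monomorphism is an isomorphism.
Horns at the last vertex are reduced to horns at 0 by reversing the order and the colors. -/

section Covering

variable {C : Type u} [Category.{v} C] {Q : MorphismProperty C}

/-- A map of presheaves is a covering (with respect to the class `Q`) if each element of the
target has a universal lift along a morphism in `Q`. -/
def IsCovering (Q : MorphismProperty C) {F G : Cᵒᵖ ⥤ Type v} (φ : F ⟶ G) : Prop :=
  ∀ (Z : C) (y : G.obj (op Z)), ∃ (Z' : C) (u : Z' ⟶ Z) (x : F.obj (op Z')), Q u ∧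
    φ.app _ x = G.map u.op y ∧ ∀ (T : C) (t : T ⟶ Z) (x' : F.obj (op T)),
      φ.app _ x' = G.map t.op y → ∃! s : T ⟶ Z', s ≫ u = t ∧ F.map s.op x = x'

/-- A presheaf that is isomorphic to a representable one. -/
def IsRep (F : Cᵒᵖ ⥤ Type v) : Prop := ∃ A : C, Nonempty (yoneda.obj A ≅ F)

lemma IsRep.of_iso {F G : Cᵒᵖ ⥤ Type v} (h : IsRep F) (e : F ≅ G) : IsRep G := by
  obtain ⟨A, ⟨a⟩⟩ := h
  exact ⟨A, ⟨a ≪≫ e⟩⟩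

lemma naturality_app {F G : Cᵒᵖ ⥤ Type v} (φ : F ⟶ G) {Z W : Cᵒᵖ} (f : Z ⟶ W) (x : F.obj Z) :
    φ.app W (F.map f x) = G.map f (φ.app Z x) :=
  ConcreteCategory.congr_hom (φ.naturality f) x

lemma map_op_comp (F : Cᵒᵖ ⥤ Type w) {X Y Z : C} (f : X ⟶ Y) (g : Y ⟶ Z) (x : F.obj (op Z)) :
    F.map f.op (F.map g.op x) = F.map (f ≫ g).op x := by
  simp

lemma IsCovering.comp (hQ : ∀ {X Y Z : C} (f : X ⟶ Y) (g : Y ⟶ Z), Q f → Q g → Q (f ≫ g))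
    {F G H : Cᵒᵖ ⥤ Type v} {φ : F ⟶ G} {ψ : G ⟶ H} (h₁ : IsCovering Q φ) (h₂ : IsCovering Q ψ) :
    IsCovering Q (φ ≫ ψ) := by
  intro Z y
  obtain ⟨Z₁, u₁, x₁, hu₁, hx₁, huniv₁⟩ := h₂ Z y
  obtain ⟨Z₂, u₂, x₂, hu₂, hx₂, huniv₂⟩ := h₁ Z₁ x₁
  refine ⟨Z₂, u₂ ≫ u₁, x₂, hQ _ _ hu₂ hu₁, ?_, ?_⟩
  · rw [← map_op_comp, ← hx₁, ← naturality_app, ← hx₂]; rfl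
  · intro T t x' hx'
    obtain ⟨s₁, ⟨hs₁, hs₁'⟩, hs₁u⟩ := huniv₁ T t (φ.app _ x') hx'
    obtain ⟨s₂, ⟨hs₂, hs₂'⟩, hs₂u⟩ := huniv₂ T s₁ x' hs₁'.symm
    refine ⟨s₂, ⟨by rw [← Category.assoc, hs₂, hs₁], hs₂'⟩, ?_⟩
    rintro s ⟨hs, hs'⟩
    refine hs₂u s ⟨hs₁u _ ⟨by rw [Category.assoc, hs], ?_⟩, hs'⟩
    rw [← map_op_comp, ← hx₂, ← naturality_app, hs']

/-- Coverings are stable under base change; the pullback square is given in terms of elements. -/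
lemma IsCovering.baseChange {F G F' G' : Cᵒᵖ ⥤ Type v} {φ : F ⟶ G} (h : IsCovering Q φ)
    (φ' : F' ⟶ G') (α : F' ⟶ F) (β : G' ⟶ G) (comm : φ' ≫ β = α ≫ φ)
    (hp : ∀ (Z : C) (y : G'.obj (op Z)) (x : F.obj (op Z)), φ.app _ x = β.app _ y →
      ∃! x' : F'.obj (op Z), α.app _ x' = x ∧ φ'.app _ x' = y) :
    IsCovering Q φ' := by
  have comm' : ∀ (Z : Cᵒᵖ) (x : F'.obj Z), β.app _ (φ'.app _ x) = φ.app _ (α.app _ x) :=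
    fun Z x => ConcreteCategory.congr_hom (NatTrans.congr_app comm Z) x
  intro Z y
  obtain ⟨Z', u, x, hu, hx, huniv⟩ := h Z (β.app _ y)
  obtain ⟨x', ⟨hx', hx''⟩, -⟩ := hp Z' (G'.map u.op y) x (by rw [hx, naturality_app])
  refine ⟨Z', u, x', hu, hx'', ?_⟩
  intro T t z hz
  obtain ⟨s, ⟨hs, hs'⟩, hsu⟩ := huniv T t (α.app _ z) (by rw [← comm', hz, naturality_app])
  refine ⟨s, ⟨hs, ?_⟩, ?_⟩
  · refine (hp T (G'.map t.op y) (α.app _ z) (by rw [← comm', hz])).unique ⟨?_, ?_⟩ ⟨rfl, hz⟩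
    · rw [naturality_app, hx', hs']
    · rw [naturality_app, hx'', map_op_comp, hs]
  · rintro s' ⟨h₁, h₂⟩
    exact hsu s' ⟨h₁, by rw [← h₂, naturality_app, hx']⟩

lemma IsCovering.of_iso {F G F' G' : Cᵒᵖ ⥤ Type v} {φ : F ⟶ G} (h : IsCovering Q φ)
    {φ' : F' ⟶ G'} (α : F' ≅ F) (β : G' ≅ G) (comm : φ' ≫ β.hom = α.hom ≫ φ) :
    IsCovering Q φ' := by
  refine h.baseChange φ' α.hom β.hom comm fun Z y x hxy => ?_
  refine ⟨α.inv.app _ x, ⟨by simp, ?_⟩, ?_⟩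
  · have := ConcreteCategory.congr_hom (NatTrans.congr_app comm (op Z)) (α.inv.app _ x)
    simp only [NatTrans.comp_app, types_comp_apply] at this
    have h2 : (α.hom.app (op Z)) ((α.inv.app (op Z)) x) = x := by simp
    rw [h2, hxy] at this
    have h3 := congrArg (β.inv.app (op Z)) this
    simpa using h3
  · rintro x' ⟨rfl, -⟩
    simp

lemma IsCovering.id (hQ : ∀ X : C, Q (𝟙 X)) (F : Cᵒᵖ ⥤ Type v) : IsCovering Q (𝟙 F) := by
  intro Z y
  refine ⟨Z, 𝟙 Z, y, hQ Z, by simp, fun T t x' hx' => ⟨t, ⟨by simp, hx'.symm⟩, ?_⟩⟩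
  rintro s ⟨hs, -⟩
  simpa using hs

/-- An element of the target over Z is a map from Z to the representing object; the pullback of the
representing cover along it is the universal lift. -/
lemma IsCovering.of_representedBy (hQ : IsSingletonPretopology Q) {F G : Cᵒᵖ ⥤ Type v}
    {φ : F ⟶ G} (h : RepresentedBy Q φ) : IsCovering Q φ := by
  obtain ⟨A, B, a, b, f, hf, comm⟩ := h
  have key : IsCovering Q (yoneda.map f) := by
    intro Z (y : Z ⟶ B)
    have := hQ.hasPullback f y hf
    refine ⟨pullback f y, pullback.snd f y, pullback.fst f y,
      hQ.pullback (IsPullback.of_hasPullback f y) hf, pullback.condition, ?_⟩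
    intro T t (x' : T ⟶ A) (hx' : x' ≫ f = t ≫ y)
    refine ⟨pullback.lift x' t hx', ⟨pullback.lift_snd _ _ _, pullback.lift_fst _ _ _⟩, ?_⟩
    rintro s ⟨h₁, h₂⟩
    refine pullback.hom_ext ?_ (h₁.trans (pullback.lift_snd _ _ _).symm)
    exact Eq.trans h₂ (pullback.lift_fst _ _ _).symm
  refine key.of_iso a.symm b.symm ?_
  rw [Iso.symm_hom, Iso.symm_hom, Iso.comp_inv_eq, Category.assoc, ← comm, Iso.inv_hom_id_assoc]

/-- The universal lift of the universal element of `G` is a universal element of `F`. Thus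
representability passes from the target of a covering to its source. -/
lemma IsCovering.representedBy {F G : Cᵒᵖ ⥤ Type v} {φ : F ⟶ G} (h : IsCovering Q φ)
    (hG : IsRep G) : RepresentedBy Q φ := by
  obtain ⟨B, ⟨b⟩⟩ := hG
  obtain ⟨A, f, x, hf, hx, huniv⟩ := h B (b.hom.app _ (𝟙 B))
  have hb : ∀ (T : C) (t : T ⟶ B), b.hom.app (op T) t = G.map t.op (b.hom.app _ (𝟙 B)) := by
    intro T t
    rw [← naturality_app]
    congr 1
    exact (Category.comp_id t).symm
  have hbij : ∀ T : C, Function.Bijective fun s : T ⟶ A => F.map s.op x := by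
    intro T
    have hlift : ∀ x' : F.obj (op T), ∃ t : T ⟶ B, φ.app _ x' = G.map t.op (b.hom.app _ (𝟙 B)) := by
      intro x'
      refine ⟨b.inv.app _ (φ.app _ x'), ?_⟩
      rw [← hb]
      simp
    constructor
    · intro s s' hss
      have h1 : ∀ s : T ⟶ A, b.hom.app (op T) (s ≫ f) = φ.app _ (F.map s.op x) := by
        intro s
        rw [hb, ← map_op_comp, ← hx, naturality_app]
      have h2 : s ≫ f = s' ≫ f := by
        have h3 : b.hom.app (op T) (s ≫ f) = b.hom.app (op T) (s' ≫ f) := by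
          rw [h1, h1]; exact congrArg _ hss
        have h4 := congrArg (b.inv.app (op T)) h3
        simpa using h4
      refine (huniv T (s ≫ f) (F.map s.op x) ?_).unique ⟨rfl, rfl⟩ ⟨h2.symm, hss.symm⟩
      rw [← h1, hb]
    · intro x'
      obtain ⟨t, ht⟩ := hlift x'
      obtain ⟨s, ⟨-, hs⟩, -⟩ := huniv T t x' ht
      exact ⟨s, hs⟩
  let a : yoneda.obj A ≅ F := NatIso.ofComponents
    (fun T => Equiv.toIso (Equiv.ofBijective _ (hbij T.unop))) (by
      intro T T' g
      refine ConcreteCategory.hom_ext _ _ fun s => ?_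
      exact (map_op_comp F g.unop s x).symm)
  refine ⟨A, B, a, b, f, hf, ?_⟩
  ext T s
  change φ.app _ (F.map (Quiver.Hom.op s) x) = b.hom.app _ (s ≫ f)
  rw [hb, ← map_op_comp, ← hx, naturality_app]

lemma RepresentedBy.isRep_source {F G : Cᵒᵖ ⥤ Type v} {φ : F ⟶ G} (h : RepresentedBy Q φ) :
    IsRep F := by
  obtain ⟨A, B, a, b, f, hf, comm⟩ := h
  exact ⟨A, ⟨a⟩⟩

lemma RepresentedBy.of_iso {F G F' G' : Cᵒᵖ ⥤ Type v} {φ : F ⟶ G} (h : RepresentedBy Q φ)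
    {φ' : F' ⟶ G'} (α : F ≅ F') (β : G ≅ G') (comm : φ ≫ β.hom = α.hom ≫ φ') :
    RepresentedBy Q φ' := by
  obtain ⟨A, B, a, b, f, hf, h⟩ := h
  refine ⟨A, B, a ≪≫ α, b ≪≫ β, f, hf, ?_⟩
  rw [Iso.trans_hom, Iso.trans_hom, Category.assoc, ← comm, reassoc_of% h]

lemma IsCovering.bijective {F G : Cᵒᵖ ⥤ Type v} {φ : F ⟶ G}
    (h : IsCovering (MorphismProperty.isomorphisms C) φ) (Z : C) :
    Function.Bijective (φ.app (op Z)) := by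
  have key : ∀ y : G.obj (op Z), ∃! x, φ.app (op Z) x = y := by
    intro y
    obtain ⟨Z', u, x, hu, hx, huniv⟩ := h Z y
    have : IsIso u := hu
    refine ⟨F.map (inv u).op x, ?_, ?_⟩
    · change φ.app _ (F.map (inv u).op x) = y
      rw [naturality_app, hx, map_op_comp]; simp
    · intro x' hx'
      obtain ⟨s, ⟨hs, hs'⟩, -⟩ := huniv Z (𝟙 Z) x' (by simpa using hx')
      rw [← hs', (IsIso.eq_comp_inv u).2 hs, Category.id_comp]
  exact (Function.bijective_iff_existsUnique _).2 key

/-- Allows the unique Kan conditions to be handled by the same arguments as the Kan conditions. -/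
lemma isSingletonPretopology_isomorphisms :
    IsSingletonPretopology (MorphismProperty.isomorphisms C) where
  of_isIso f hf := hf
  comp f g hf hg := by
    have : IsIso f := hf
    have : IsIso g := hg
    exact inferInstanceAs (IsIso (f ≫ g))
  hasPullback f g hf := by
    have : IsIso f := hf
    exact hasPullback_of_left_iso f g
  pullback h hf := MorphismProperty.of_isPullback (P := .isomorphisms C) h hf

/-- An object along which all covers split. -/
def IsProjectiveFor (Q : MorphismProperty C) (P : C) : Prop :=
  ∀ (Z : C) (u : Z ⟶ P), Q u → ∃ s : P ⟶ Z, s ≫ u = 𝟙 P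

/-- A lift already given over `P` factors through the universal lift, so the local lift can be made
to restrict to it. -/
lemma IsCovering.exists_lift {F G : Cᵒᵖ ⥤ Type v} {φ : F ⟶ G} (h : IsCovering Q φ) {P Z : C}
    (y : G.obj (op Z)) (w : P ⟶ Z) (x₀ : F.obj (op P)) (hx₀ : φ.app _ x₀ = G.map w.op y) :
    ∃ (Z' : C) (u : Z' ⟶ Z) (w' : P ⟶ Z') (x : F.obj (op Z')), Q u ∧ w' ≫ u = w ∧
      φ.app _ x = G.map u.op y ∧ F.map w'.op x = x₀ := by
  obtain ⟨Z', u, x, hu, hx, huniv⟩ := h Z y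
  obtain ⟨w', ⟨h₁, h₂⟩, -⟩ := huniv P w x₀ hx₀
  exact ⟨Z', u, w', x, hu, h₁, hx, h₂⟩

lemma IsCovering.surjective_app {F G : Cᵒᵖ ⥤ Type v} {φ : F ⟶ G} (h : IsCovering Q φ) {P : C}
    (hP : IsProjectiveFor Q P) (y : G.obj (op P)) : ∃ x, φ.app (op P) x = y := by
  obtain ⟨Z', u, x, hu, hx, -⟩ := h P y
  obtain ⟨s, hs⟩ := hP Z' u hu
  exact ⟨F.map s.op x, by rw [naturality_app, hx, map_op_comp, hs]; simp⟩

end Covering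

end HigherGpd

namespace HigherGpd

/-! ### Compatible families on sieves -/

section Families

variable {D : Type} [Category.{0} D]

/-- A compatible family of elements of the presheaf `A` on the sieve `S`. -/
@[ext]
structure Family (A : Dᵒᵖ ⥤ Type v) {d : D} (S : Sieve d) : Type v where
  val : ∀ {e : D} (s : e ⟶ d), S s → A.obj (op e)
  val_comp : ∀ {e e' : D} (t : e' ⟶ e) (s : e ⟶ d) (hs : S s),
    val (t ≫ s) (S.downward_closed hs t) = A.map t.op (val s hs)

namespace Family

variable {A B : Dᵒᵖ ⥤ Type v} {d d' d'' : D}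

lemma val_congr {S : Sieve d} (x : Family A S) {e : D} {s s' : e ⟶ d} (h : s = s') (hs : S s) :
    x.val s hs = x.val s' (h ▸ hs) := by
  subst h; rfl

/-- The restriction of a family along a morphism. -/
def res {S : Sieve d} {S' : Sieve d'} (f : d' ⟶ d) (h : S' ≤ S.pullback f) (x : Family A S) :
    Family A S' where
  val s hs := x.val (s ≫ f) (h _ hs)
  val_comp t s hs := by
    exact (x.val_congr (Category.assoc _ _ _) _).trans (x.val_comp t (s ≫ f) (h _ hs))

/-- The image of a family under a map of presheaves. -/
def push {S : Sieve d} (η : A ⟶ B) (x : Family A S) : Family B S where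
  val s hs := η.app _ (x.val s hs)
  val_comp t s hs := by
    rw [x.val_comp]
    exact ConcreteCategory.congr_hom (η.naturality t.op) _

lemma ext_of_cover {S : Sieve d} {x y : Family A S} {ι : Type*} {e : ι → D} (f : ∀ a, e a ⟶ d)
    (T : ∀ a, Sieve (e a)) (hT : ∀ a, T a ≤ S.pullback (f a))
    (hcov : ∀ {c : D} (s : c ⟶ d), S s → ∃ a, ∃ r : c ⟶ e a, T a r ∧ r ≫ f a = s)
    (h : ∀ a, x.res (f a) (hT a) = y.res (f a) (hT a)) : x = y := by
  ext c s hs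
  obtain ⟨a, r, hr, rfl⟩ := hcov s hs
  exact congrArg (fun z : Family A (T a) => z.val r hr) (h a)

lemma exists_glue {S : Sieve d} {ι : Type*} {e : ι → D} (f : ∀ a, e a ⟶ d)
    (T : ∀ a, Sieve (e a)) (hT : ∀ a, T a ≤ S.pullback (f a))
    (hcov : ∀ {c : D} (s : c ⟶ d), S s → ∃ a, ∃ r : c ⟶ e a, T a r ∧ r ≫ f a = s)
    (x : ∀ a, Family A (T a))
    (hx : ∀ a b {c : D} (r : c ⟶ e a) (r' : c ⟶ e b) (hr : T a r) (hr' : T b r'),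
      r ≫ f a = r' ≫ f b → (x a).val r hr = (x b).val r' hr') :
    ∃ z : Family A S, ∀ a, z.res (f a) (hT a) = x a := by
  choose a r hr hs using @hcov
  refine ⟨⟨fun s hs => (x (a s hs)).val (r s hs) (hr s hs), ?_⟩, ?_⟩
  · intro c c' t s h
    rw [← (x (a s h)).val_comp]
    exact hx _ _ _ _ _ _ (by rw [hs, Category.assoc, hs])
  · intro b
    ext c s h
    exact hx _ _ _ _ _ _ (hs _ _)

/-- When `S'` is the union of `S` and the face `ι`, families on `S'` are the fibre product of
families on the two pieces over their intersection. This turns attaching a simplex into a base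
change. -/
lemma existsUnique_glue_mono {S S' : Sieve d} (hS : S ≤ S') (hS₁ : S ≤ S'.pullback (𝟙 d))
    (ι : d' ⟶ d) [Mono ι]
    (hι : (⊤ : Sieve d') ≤ S'.pullback ι)
    (hcov : ∀ {c : D} (s : c ⟶ d), S' s → S s ∨ ∃ r, r ≫ ι = s)
    (y : Family A S) (x : Family A (⊤ : Sieve d'))
    (hxy : ∀ {c : D} (r : c ⟶ d') (h : S (r ≫ ι)), x.val r trivial = y.val (r ≫ ι) h) :
    ∃! z : Family A S', z.res ι hι = x ∧ z.res (𝟙 d) hS₁ = y := by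
  classical
  let z : ∀ {c : D} (s : c ⟶ d), S' s → A.obj (op c) := fun s hs =>
    if h : S s then y.val s h else x.val ((hcov s hs).resolve_left h).choose trivial
  have hz₁ : ∀ {c : D} (s : c ⟶ d) (hs : S s), z s (hS _ hs) = y.val s hs := fun s hs =>
    dif_pos hs
  have hz₂ : ∀ {c : D} (r : c ⟶ d') (s : c ⟶ d) (_ : r ≫ ι = s) (hs : S' s),
      z s hs = x.val r trivial := by
    rintro c r _ rfl hs
    by_cases h : S (r ≫ ι)
    · exact (hz₁ _ h).trans (hxy r h).symm
    · refine (dif_neg h).trans (x.val_congr ?_ _)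
      exact (cancel_mono ι).1 ((hcov _ hs).resolve_left h).choose_spec
  refine ⟨⟨z, ?_⟩, ⟨?_, ?_⟩, ?_⟩
  · intro c c' t s hs
    rcases hcov s hs with h | ⟨r, rfl⟩
    · rw [hz₁ _ h, hz₁ _ (S.downward_closed h t), y.val_comp]
    · rw [hz₂ r _ rfl hs, hz₂ (t ≫ r) _ (Category.assoc _ _ _) (S'.downward_closed hs t),
        x.val_comp]
  · ext c r hr
    exact hz₂ r _ rfl (hι _ hr)
  · ext c s hs
    exact (hz₁ _ (by rwa [Category.comp_id])).trans (y.val_congr (Category.comp_id s) _)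
  · rintro z' ⟨h₁, h₂⟩
    ext c s hs
    rcases hcov s hs with h | ⟨r, rfl⟩
    · refine Eq.trans ?_ (hz₁ s h).symm
      rw [← h₂]
      exact z'.val_congr (Category.comp_id s).symm _
    · refine Eq.trans ?_ (hz₂ r _ rfl hs).symm
      rw [← h₁]
      rfl

lemma res_res {S : Sieve d} {S' : Sieve d'} {S'' : Sieve d''} (f : d' ⟶ d) (g : d'' ⟶ d')
    (k : d'' ⟶ d) (hk : g ≫ f = k)
    (hf : S' ≤ S.pullback f) (hg : S'' ≤ S'.pullback g) (h : S'' ≤ S.pullback k)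
    (x : Family A S) : (x.res f hf).res g hg = x.res k h := by
  subst hk
  ext c s hs
  exact x.val_congr (Category.assoc _ _ _) _

lemma res_id {S : Sieve d} (h : S ≤ S.pullback (𝟙 d)) (x : Family A S) : x.res (𝟙 d) h = x := by
  ext c s hs
  exact x.val_congr (Category.comp_id _) _

/-- Families on the maximal sieve are elements. -/
def topEquiv : Family A (⊤ : Sieve d) ≃ A.obj (op d) where
  toFun x := x.val (𝟙 d) trivial
  invFun a := ⟨fun s _ => A.map s.op a, fun t s _ => by simp⟩
  left_inv x := by
    ext c s hs
    exact (x.val_comp s (𝟙 d) trivial).symm.trans (x.val_congr (Category.comp_id _) _)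
  right_inv a := by simp

end Family

variable {C : Type u} [Category.{v} C] (X : Cᵒᵖ ⥤ Dᵒᵖ ⥤ Type v)

/-- The presheaf of compatible families on a sieve. -/
@[simps obj]
def families {d : D} (S : Sieve d) : Cᵒᵖ ⥤ Type v where
  obj Z := Family (X.obj Z) S
  map g := ↾ Family.push (X.map g)
  map_id Z := by
    refine ConcreteCategory.hom_ext _ _ fun x => ?_
    refine Family.ext ?_
    funext c s hs
    change (X.map (𝟙 Z)).app _ (x.val s hs) = x.val s hs
    simp
  map_comp g h := by
    refine ConcreteCategory.hom_ext _ _ fun x => ?_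
    refine Family.ext ?_
    funext c s hs
    change (X.map (g ≫ h)).app _ (x.val s hs) = (X.map h).app _ ((X.map g).app _ (x.val s hs))
    simp

/-- The restriction of families along a morphism. -/
def familiesRes {d d' : D} {S : Sieve d} {S' : Sieve d'} (f : d' ⟶ d) (h : S' ≤ S.pullback f) :
    families X S ⟶ families X S' where
  app Z := ↾ Family.res f h

lemma Sieve_le_pullback_id {d : D} {S S' : Sieve d} (h : S' ≤ S) : S' ≤ S.pullback (𝟙 d) := by
  intro c s hs
  change S (s ≫ 𝟙 d)
  rw [Category.comp_id]
  exact h _ hs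

/-- The restriction of families to a smaller sieve. -/
abbrev familiesRestrict {d : D} {S S' : Sieve d} (h : S' ≤ S) : families X S ⟶ families X S' :=
  familiesRes X (𝟙 d) (Sieve_le_pullback_id h)

lemma familiesRes_comp {d d' d'' : D} {S : Sieve d} {S' : Sieve d'} {S'' : Sieve d''}
    (f : d' ⟶ d) (g : d'' ⟶ d') (k : d'' ⟶ d) (hk : g ≫ f = k) (hf : S' ≤ S.pullback f)
    (hg : S'' ≤ S'.pullback g) (h : S'' ≤ S.pullback k) :
    familiesRes X f hf ≫ familiesRes X g hg = familiesRes X k h := by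
  ext Z x
  exact Family.res_res (A := X.obj Z) f g k hk hf hg h x

lemma familiesRestrict_comp {d : D} {S S' S'' : Sieve d} (h : S' ≤ S) (h' : S'' ≤ S') :
    familiesRestrict X h ≫ familiesRestrict X h' = familiesRestrict X (h'.trans h) :=
  familiesRes_comp X _ _ _ (Category.comp_id _) _ _ _

lemma familiesRestrict_self {d : D} {S : Sieve d} (h : S ≤ S) :
    familiesRestrict X h = 𝟙 _ := by
  ext Z x
  exact Family.res_id (A := X.obj Z) _ _

/-- Families on a sieve generated by a monomorphism are elements over its source. -/
lemma families_iso_of_mono {d e : D} (ι : e ⟶ d) [Mono ι] {S : Sieve d}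
    (hS : ∀ {c : D} (s : c ⟶ d), S s ↔ ∃ r, r ≫ ι = s) :
    Nonempty (families X S ≅ families X (⊤ : Sieve e)) := by
  have h : (⊤ : Sieve e) ≤ S.pullback ι := fun c s _ => (hS _).2 ⟨s, rfl⟩
  have hb : ∀ Z, Function.Bijective (Family.res (A := X.obj Z) ι h) := by
    intro Z
    constructor
    · intro x y hxy
      refine Family.ext_of_cover (ι := Unit) (fun _ => ι) (fun _ => ⊤) (fun _ => h) ?_
        (fun _ => hxy)
      intro c s hs
      obtain ⟨r, hr⟩ := (hS s).1 hs
      exact ⟨(), r, trivial, hr⟩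
    · intro x
      obtain ⟨z, hz⟩ := Family.exists_glue (S := S) (ι := Unit) (fun _ => ι) (fun _ => ⊤)
        (fun _ => h) (fun s hs => by
          obtain ⟨r, hr⟩ := (hS s).1 hs
          exact ⟨(), r, trivial, hr⟩) (fun _ => x) (fun _ _ c r r' hr hr' hrr => by
            exact x.val_congr ((cancel_mono ι).1 hrr) _)
      exact ⟨z, hz ()⟩
  exact ⟨NatIso.ofComponents (fun Z => (Equiv.ofBijective _ (hb Z)).toIso)
    (fun g => ((familiesRes X ι h).naturality g))⟩

end Families

/-! ### Colored simplices and their subcomplexes -/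

/-- The category of simplices of `Δ¹`, that is, of simplices colored by `0` and `1`. -/
abbrev ColoredSimplex : Type := Over (⦋1⦌ : SimplexCategory)

namespace ColoredSimplex

/-- The type of vertices. -/
abbrev Vertex (d : ColoredSimplex) : Type := Fin (d.left.len + 1)

/-- The action of a morphism on vertices. -/
def vmap {e d : ColoredSimplex} (s : e ⟶ d) : e.Vertex →o d.Vertex := s.left.toOrderHom

/-- The color of a vertex. -/
def color (d : ColoredSimplex) (a : d.Vertex) : Fin 2 := d.hom.toOrderHom a

lemma color_monotone (d : ColoredSimplex) : Monotone d.color := d.hom.toOrderHom.monotone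

lemma color_vmap {e d : ColoredSimplex} (s : e ⟶ d) (a : e.Vertex) :
    d.color (vmap s a) = e.color a := by
  have := Over.w s
  exact congrArg (fun t : e.left ⟶ ⦋1⦌ => t.toOrderHom a) this

lemma vmap_comp {e d c : ColoredSimplex} (s : e ⟶ d) (t : d ⟶ c) (a : e.Vertex) :
    vmap (s ≫ t) a = vmap t (vmap s a) := rfl

lemma hom_ext {e d : ColoredSimplex} {s t : e ⟶ d} (h : ∀ a, vmap s a = vmap t a) : s = t := by
  refine Over.OverMorphism.ext ?_
  ext a : 3
  exact h a

/-- The morphism with a given monotone map on vertices. -/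
def homMk {e d : ColoredSimplex} (f : e.Vertex →o d.Vertex)
    (hf : ∀ a, d.color (f a) = e.color a) : e ⟶ d :=
  Over.homMk (SimplexCategory.Hom.mk f) (by
    ext a : 3
    exact hf a)

/-- The set of vertices that are hit by a morphism. -/
def supp {e d : ColoredSimplex} (s : e ⟶ d) : Finset d.Vertex := Finset.univ.image (vmap s)

lemma mem_supp {e d : ColoredSimplex} {s : e ⟶ d} {b : d.Vertex} :
    b ∈ supp s ↔ ∃ a, vmap s a = b := by
  simp [supp]

lemma supp_comp {e d c : ColoredSimplex} (s : e ⟶ d) (t : d ⟶ c) :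
    supp (s ≫ t) = (supp s).image (vmap t) := by
  ext b
  simp only [mem_supp, Finset.mem_image]
  constructor
  · rintro ⟨a, rfl⟩
    exact ⟨_, ⟨a, rfl⟩, rfl⟩
  · rintro ⟨_, ⟨a, rfl⟩, rfl⟩
    exact ⟨a, rfl⟩

lemma supp_comp_subset {e d c : ColoredSimplex} (s : e ⟶ d) (t : d ⟶ c) :
    supp (s ≫ t) ⊆ supp t := by
  intro b
  simp only [mem_supp]
  rintro ⟨a, rfl⟩
  exact ⟨_, rfl⟩

lemma mono_of_injective {e d : ColoredSimplex} {s : e ⟶ d} (hs : Function.Injective (vmap s)) :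
    Mono s :=
  ⟨fun _ _ h => hom_ext fun a => hs (congrArg (fun t => vmap t a) h)⟩

/-- Simplices are determined by their vertices, so lying in a face is a condition on the support
alone; injectivity of `ι` makes the map on vertices monotone. -/
lemma exists_factor {c d e : ColoredSimplex} {ι : e ⟶ d} (hι : Function.Injective (vmap ι))
    {s : c ⟶ d} (h : supp s ⊆ supp ι) : ∃ r : c ⟶ e, r ≫ ι = s := by
  have : ∀ a, ∃ b, vmap ι b = vmap s a := fun a => mem_supp.1 (h (mem_supp.2 ⟨a, rfl⟩))
  choose f hf using this
  refine ⟨homMk ⟨f, fun a b hab => ?_⟩ fun a => ?_, hom_ext fun a => hf a⟩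
  · by_contra hlt
    have h1 := (vmap ι).monotone (le_of_not_ge hlt)
    rw [hf, hf] at h1
    have h2 : vmap s a = vmap s b := le_antisymm ((vmap s).monotone hab) h1
    exact hlt (hι (by rw [hf, hf, h2])).le
  · change e.color (f a) = _
    rw [← color_vmap ι, hf, color_vmap]

/-- The face of a colored simplex that is spanned by a nonempty set of vertices. -/
lemma exists_face (d : ColoredSimplex) (U : Finset d.Vertex) (hU : U.Nonempty) :
    ∃ (e : ColoredSimplex) (ι : e ⟶ d), Function.Injective (vmap ι) ∧ supp ι = U ∧
      e.left.len + 1 = U.card := by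
  obtain ⟨n, hn⟩ : ∃ n, U.card = n + 1 := ⟨U.card - 1, by have := hU.card_pos; omega⟩
  let f : (⦋n⦌ : SimplexCategory) ⟶ d.left :=
    SimplexCategory.Hom.mk (U.orderEmbOfFin hn).toOrderHom
  refine ⟨Over.mk (f ≫ d.hom), Over.homMk f rfl, (U.orderEmbOfFin hn).injective, ?_, hn.symm⟩
  ext b
  rw [mem_supp]
  have := Finset.range_orderEmbOfFin U hn
  rw [← Finset.mem_coe, ← this]
  rfl

/-- The sieve of all simplices whose set of vertices belongs to a lower set. -/
def sieve {d : ColoredSimplex} (K : LowerSet (Finset d.Vertex)) : Sieve d where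
  arrows _ s := supp s ∈ K
  downward_closed {_ _ _} hf _ := by
    refine K.lower ?_ hf
    exact supp_comp_subset _ _

lemma mem_sieve {d c : ColoredSimplex} {K : LowerSet (Finset d.Vertex)} {s : c ⟶ d} :
    sieve K s ↔ supp s ∈ K := Iff.rfl

lemma sieve_mono {d : ColoredSimplex} {K L : LowerSet (Finset d.Vertex)} (h : K ≤ L) :
    sieve K ≤ sieve L := fun _ _ hs => h hs

/-- The lower set of sets of vertices of the horn with missing face opposite to `k`. -/
def hornSet {d : ColoredSimplex} (k : d.Vertex) : LowerSet (Finset d.Vertex) where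
  carrier := {U | ∃ j, j ≠ k ∧ j ∉ U}
  lower' := by
    rintro U V hVU ⟨j, hj, hjU⟩
    exact ⟨j, hj, fun h => hjU (hVU h)⟩

end ColoredSimplex

open ColoredSimplex

/-! ### Attaching simplices along horns -/

section Toggle

variable {C : Type u} [Category.{v} C] {Q : MorphismProperty C}
  (X : Cᵒᵖ ⥤ ColoredSimplexᵒᵖ ⥤ Type v)

/-- The restriction from a simplex to its `k`-th horn is a covering. -/
def HornCovering (Q : MorphismProperty C) (X : Cᵒᵖ ⥤ ColoredSimplexᵒᵖ ⥤ Type v)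
    (d : ColoredSimplex) (k : d.Vertex) : Prop :=
  IsCovering Q (familiesRestrict X (le_top : sieve (hornSet k) ≤ (⊤ : Sieve d)))

variable {X}

/-- By `h₂` only simplices of the face `ι` are added to `K`, and by `h₃` this face meets `K` exactly
in its horn at `k`. So the restriction is a base change of restriction from the face to its horn. -/
lemma isCovering_attach {d e : ColoredSimplex} (ι : e ⟶ d) (hι : Function.Injective (vmap ι))
    (k : e.Vertex) (h : HornCovering Q X e k) {K K' : LowerSet (Finset d.Vertex)} (hK : K ≤ K')
    (h₁ : supp ι ∈ K') (h₂ : ∀ V ∈ K', V ∉ K → V ⊆ supp ι)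
    (h₃ : ∀ V ⊆ supp ι, V ∈ K ↔ ¬ (supp ι).erase (vmap ι k) ⊆ V) :
    IsCovering Q (familiesRestrict X (sieve_mono hK)) := by
  have hmono := mono_of_injective hι
  have a₁ : (⊤ : Sieve e) ≤ (sieve K').pullback ι := fun c s _ =>
    K'.lower (supp_comp_subset s ι) h₁
  have a₂ : sieve (hornSet k) ≤ (sieve K).pullback ι := by
    rintro c s ⟨j, hj, hjs⟩
    refine (h₃ _ (supp_comp_subset s ι)).2 fun hsub => ?_
    have := hsub (Finset.mem_erase.2 ⟨fun h => hj (hι h), mem_supp.2 ⟨j, rfl⟩⟩)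
    rw [supp_comp, Finset.mem_image] at this
    obtain ⟨j', hj', hjj⟩ := this
    exact hjs (hι hjj ▸ hj')
  have a₃ : ∀ {c : ColoredSimplex} (r : c ⟶ e), supp (r ≫ ι) ∈ K → sieve (hornSet k) r := by
    intro c r hr
    have := (h₃ _ (supp_comp_subset r ι)).1 hr
    obtain ⟨b, hb, hb'⟩ := Finset.not_subset.1 this
    obtain ⟨hbk, hb⟩ := Finset.mem_erase.1 hb
    obtain ⟨j, rfl⟩ := mem_supp.1 hb
    refine ⟨j, fun h => hbk (by rw [h]), fun h => hb' ?_⟩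
    rw [supp_comp]
    exact Finset.mem_image_of_mem _ h
  refine h.baseChange _ (familiesRes X ι a₁) (familiesRes X ι a₂) ?_ ?_
  · have a₄ : sieve (hornSet k) ≤ (sieve K').pullback ι := fun c s hs => sieve_mono hK _ (a₂ _ hs)
    rw [familiesRes_comp X (𝟙 d) ι ι (Category.comp_id _) _ _ a₄,
      familiesRes_comp X ι (𝟙 e) ι (Category.id_comp _) _ _ a₄]
  · intro Z y x hxy
    have hxy' : ∀ {c : ColoredSimplex} (r : c ⟶ e) (hr : sieve (hornSet k) r),
        x.val r trivial = y.val (r ≫ ι) (a₂ _ hr) := by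
      intro c r hr
      have := congrArg (fun z : Family (X.obj (op Z)) (sieve (hornSet k)) => z.val r hr) hxy
      exact (x.val_congr (Category.comp_id r).symm trivial).trans this
    refine Family.existsUnique_glue_mono (A := X.obj (op Z)) (sieve_mono hK) _ ι a₁ ?_ y x
      fun r hr => hxy' r (a₃ r hr)
    intro c s hs
    by_cases hsK : sieve K s
    · exact Or.inl hsK
    · exact Or.inr (exists_factor hι (h₂ _ hs hsK))

/-- If the difference of two subcomplexes of a simplex is invariant under adding and removing the
vertex `v`, and the restrictions to the horns with missing face opposite to `v` are coverings, then
so is the restriction of families to the smaller subcomplex. -/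
theorem isCovering_of_toggle (hQ : IsSingletonPretopology Q) {d : ColoredSimplex}
    (L : LowerSet (Finset d.Vertex)) (v : d.Vertex) (K : LowerSet (Finset d.Vertex)) (hK : K ≤ L)
    (h₀ : ∅ ∈ K) (h₁ : ∀ U ∈ L, U ∉ K → insert v U ∈ L ∧ U.erase v ∉ K)
    (h₂ : ∀ (e : ColoredSimplex) (ι : e ⟶ d) (k : e.Vertex), Function.Injective (vmap ι) →
      supp ι ∈ L → supp ι ∉ K → vmap ι k = v → HornCovering Q X e k) :
    IsCovering Q (familiesRestrict X (sieve_mono hK)) := by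
  -- `K` is enlarged one simplex at a time; this stops because there are finitely many sets of
  -- vertices.
  induction K using WellFoundedGT.induction with
  | ind K ih =>
  by_cases hKL : L ≤ K
  · obtain rfl : K = L := le_antisymm hK hKL
    rw [familiesRestrict_self]
    exact IsCovering.id (fun X => hQ.of_isIso _ inferInstance) _
  obtain ⟨U₀, hU₀L, hU₀K⟩ : ∃ U ∈ L, U ∉ K := by
    by_contra! hcon
    exact hKL hcon
  let B : Set (Finset d.Vertex) := {U | U ∈ L ∧ U ∉ K ∧ v ∈ U}
  have hB : B.Nonempty := ⟨insert v U₀, (h₁ _ hU₀L hU₀K).1,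
    fun h => hU₀K (K.lower (Finset.subset_insert v U₀) h), Finset.mem_insert_self _ _⟩
  -- By minimality and the toggling hypothesis, the only subsets of `U` outside `K` are `U` and
  -- `U.erase v`. Hence `U` meets `K` in its horn at `v`.
  obtain ⟨U, ⟨hUL, hUK, hvU⟩, hmin⟩ := Set.Finite.exists_minimal (Set.toFinite B) hB
  have hmin' : ∀ V ⊆ U, V ∈ L → V ∉ K → U.erase v ⊆ V := by
    intro V hVU hVL hVK
    have h3 : insert v V ∈ B := ⟨(h₁ V hVL hVK).1,
      fun h => hVK (K.lower (Finset.subset_insert v V) h), Finset.mem_insert_self _ _⟩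
    have h4 := hmin h3 (Finset.insert_subset hvU hVU)
    exact Finset.subset_insert_iff.1 h4
  obtain ⟨e, ι, hι, hsupp, -⟩ := exists_face d U ⟨v, hvU⟩
  obtain ⟨k, hk⟩ := mem_supp.1 (hsupp.symm ▸ hvU : v ∈ supp ι)
  let K' : LowerSet (Finset d.Vertex) := K ⊔ LowerSet.Iic U
  have hmem : ∀ V, V ∈ K' ↔ V ∈ K ∨ V ⊆ U := fun V => by
    simp [K', LowerSet.mem_sup_iff]
  have hKK' : K ≤ K' := le_sup_left
  have hK'L : K' ≤ L := by
    intro V hV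
    rcases (hmem V).1 hV with h | h
    · exact hK h
    · exact L.lower h hUL
  have hlt : K < K' := lt_of_le_of_ne hKK' (fun h => hUK (h ▸ (hmem U).2 (Or.inr subset_rfl)))
  have c₁ : IsCovering Q (familiesRestrict X (sieve_mono hKK')) := by
    refine isCovering_attach ι hι k (h₂ e ι k hι (hsupp ▸ hUL) (hsupp ▸ hUK) hk) hKK' ?_ ?_ ?_
    · rw [hsupp]; exact (hmem U).2 (Or.inr subset_rfl)
    · intro V hV hVK
      rw [hsupp]
      exact ((hmem V).1 hV).resolve_left hVK
    · intro V hV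
      rw [hsupp] at hV ⊢
      rw [hk]
      constructor
      · intro hVK hsub
        exact (h₁ U hUL hUK).2 (K.lower hsub hVK)
      · intro hns
        by_contra hVK
        exact hns (hmin' V hV (L.lower hV hUL) hVK)
  have c₂ : IsCovering Q (familiesRestrict X (sieve_mono hK'L)) := by
    -- Since `U` and `U.erase v` are added together, what remains of the difference is still
    -- invariant under toggling `v`.
    refine ih K' hlt hK'L (hKK' h₀) ?_ ?_
    · intro V hVL hVK'
      have hVK : V ∉ K := fun h => hVK' (hKK' h)
      refine ⟨(h₁ V hVL hVK).1, fun h => ?_⟩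
      rcases (hmem _).1 h with h | h
      · exact (h₁ V hVL hVK).2 h
      · refine hVK' ((hmem V).2 (Or.inr fun a ha => ?_))
        by_cases hav : a = v
        · exact hav ▸ hvU
        · exact h (Finset.mem_erase.2 ⟨hav, ha⟩)
    · intro e ι k hι hL hnK hk
      exact h₂ e ι k hι hL (fun h => hnK (hKK' h)) hk
  rw [← familiesRestrict_comp X (sieve_mono hK'L) (sieve_mono hKK')]
  exact c₂.comp hQ.comp c₁

end Toggle

end HigherGpd

namespace HigherGpd

open ColoredSimplex

/-! ### Joins with a fixed colored simplex -/

section Join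

variable (t a : ℕ)

/-- The join of `[n]`, in color `0`, with a simplex with `t` vertices, the first `a` of which have
color `0`. -/
def joinObj (n : SimplexCategory) : ColoredSimplex := Over.mk (colorMap (n.len + t) (n.len + 1 + a))

/-- The vertices of the join that come from the first factor. -/
def joinHead (n : SimplexCategory) (i : Fin (n.len + 1)) : (joinObj t a n).Vertex :=
  ⟨i.val, by
    have := i.isLt
    change _ < n.len + t + 1
    omega⟩

/-- The vertices of the join that come from the second factor. -/
def joinTail (n : SimplexCategory) (j : Fin t) : (joinObj t a n).Vertex :=
  ⟨n.len + 1 + j.val, by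
    have := j.isLt
    change _ < n.len + t + 1
    omega⟩

variable {t a}

lemma joinHead_val {n : SimplexCategory} (i : Fin (n.len + 1)) :
    (joinHead t a n i).val = i.val := rfl

lemma joinTail_val {n : SimplexCategory} (j : Fin t) :
    (joinTail t a n j).val = n.len + 1 + j.val := rfl

lemma join_cases {n : SimplexCategory} (b : (joinObj t a n).Vertex) :
    (∃ i, b = joinHead t a n i) ∨ ∃ j, b = joinTail t a n j := by
  have hb : b.val < n.len + t + 1 := b.isLt
  by_cases h : b.val < n.len + 1
  · exact Or.inl ⟨⟨b.val, h⟩, rfl⟩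
  · refine Or.inr ⟨⟨b.val - (n.len + 1), by omega⟩, Fin.ext ?_⟩
    rw [joinTail_val]
    change b.val = n.len + 1 + (b.val - (n.len + 1))
    omega

lemma joinHead_injective {n : SimplexCategory} : Function.Injective (joinHead t a n) := by
  intro i j h
  exact Fin.ext (congrArg (fun b : (joinObj t a n).Vertex => b.val) h)

lemma joinTail_injective {n : SimplexCategory} : Function.Injective (joinTail t a n) := by
  intro i j h
  have := congrArg Fin.val h
  rw [joinTail_val, joinTail_val] at this
  exact Fin.ext (by omega)

lemma joinHead_lt_joinTail {n : SimplexCategory} (i : Fin (n.len + 1)) (j : Fin t) :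
    joinHead t a n i < joinTail t a n j := by
  have := i.isLt
  rw [Fin.lt_def, joinHead_val, joinTail_val]
  omega

lemma color_joinObj {n : SimplexCategory} (b : (joinObj t a n).Vertex) :
    (joinObj t a n).color b = if b.val < n.len + 1 + a then 0 else 1 := rfl

lemma color_joinHead {n : SimplexCategory} (i : Fin (n.len + 1)) :
    (joinObj t a n).color (joinHead t a n i) = 0 := by
  have := i.isLt
  rw [color_joinObj, joinHead_val, if_pos (by omega)]

variable (t a) in
/-- The underlying function of the join with an identity. -/
def joinFun {n n' : SimplexCategory} (θ : n ⟶ n') (b : (joinObj t a n).Vertex) :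
    (joinObj t a n').Vertex :=
  if h : b.val < n.len + 1 then joinHead t a n' (θ.toOrderHom ⟨b.val, h⟩)
  else joinTail t a n' ⟨b.val - (n.len + 1), by
    have hb : b.val < n.len + t + 1 := b.isLt
    omega⟩

lemma joinFun_head {n n' : SimplexCategory} (θ : n ⟶ n') (i : Fin (n.len + 1)) :
    joinFun t a θ (joinHead t a n i) = joinHead t a n' (θ.toOrderHom i) :=
  dif_pos i.isLt

lemma joinFun_tail {n n' : SimplexCategory} (θ : n ⟶ n') (j : Fin t) :
    joinFun t a θ (joinTail t a n j) = joinTail t a n' j := by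
  refine (dif_neg (by rw [joinTail_val]; omega)).trans ?_
  congr 1
  refine Fin.ext ?_
  change n.len + 1 + j.val - (n.len + 1) = j.val
  omega

variable (t a) in
/-- The join of a morphism with the identity of a fixed colored simplex. -/
def joinMap {n n' : SimplexCategory} (θ : n ⟶ n') : joinObj t a n ⟶ joinObj t a n' :=
  homMk ⟨joinFun t a θ, by
    intro b c hbc
    rcases join_cases b with ⟨i, rfl⟩ | ⟨i, rfl⟩ <;> rcases join_cases c with ⟨j, rfl⟩ | ⟨j, rfl⟩
    · rw [joinFun_head, joinFun_head]
      exact θ.toOrderHom.monotone (show i ≤ j from hbc)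
    · rw [joinFun_head, joinFun_tail]
      exact (joinHead_lt_joinTail _ _).le
    · exact absurd hbc (not_le.2 (joinHead_lt_joinTail _ _))
    · rw [joinFun_tail, joinFun_tail]
      rw [Fin.le_def, joinTail_val, joinTail_val] at hbc ⊢
      omega⟩ (by
    intro b
    change (joinObj t a n').color (joinFun t a θ b) = _
    rcases join_cases b with ⟨i, rfl⟩ | ⟨i, rfl⟩
    · rw [joinFun_head, color_joinHead, color_joinHead]
    · rw [joinFun_tail, color_joinObj, color_joinObj, joinTail_val, joinTail_val]
      by_cases h : i.val < a
      · rw [if_pos (by omega), if_pos (by omega)]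
      · rw [if_neg (by omega), if_neg (by omega)])

lemma joinMap_id (n : SimplexCategory) : joinMap t a (𝟙 n) = 𝟙 _ := by
  refine hom_ext fun b => ?_
  change joinFun t a _ b = b
  rcases join_cases b with ⟨i, rfl⟩ | ⟨i, rfl⟩
  · rw [joinFun_head]; rfl
  · rw [joinFun_tail]

lemma joinMap_comp {n n' n'' : SimplexCategory} (θ : n ⟶ n') (η : n' ⟶ n'') :
    joinMap t a (θ ≫ η) = joinMap t a θ ≫ joinMap t a η := by
  refine hom_ext fun b => ?_
  change joinFun t a _ b = joinFun t a η (joinFun t a θ b)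
  rcases join_cases b with ⟨i, rfl⟩ | ⟨i, rfl⟩
  · rw [joinFun_head, joinFun_head, joinFun_head]; rfl
  · rw [joinFun_tail, joinFun_tail, joinFun_tail]

lemma vmap_joinMap {n n' : SimplexCategory} (θ : n ⟶ n') (b : (joinObj t a n).Vertex) :
    vmap (joinMap t a θ) b = joinFun t a θ b := rfl

lemma joinMap_injective {n n' : SimplexCategory} {θ : n ⟶ n'}
    (hθ : Function.Injective θ.toOrderHom) : Function.Injective (vmap (joinMap t a θ)) := by
  intro b c hbc
  change joinFun t a θ b = joinFun t a θ c at hbc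
  rcases join_cases b with ⟨i, rfl⟩ | ⟨i, rfl⟩ <;> rcases join_cases c with ⟨j, rfl⟩ | ⟨j, rfl⟩
  · rw [joinFun_head, joinFun_head] at hbc
    rw [hθ (joinHead_injective hbc)]
  · rw [joinFun_head, joinFun_tail] at hbc
    exact absurd hbc (joinHead_lt_joinTail _ _).ne
  · rw [joinFun_head, joinFun_tail] at hbc
    exact absurd hbc.symm (joinHead_lt_joinTail _ _).ne
  · rw [joinFun_tail, joinFun_tail] at hbc
    rw [joinTail_injective hbc]

/-- The part of a set of vertices that comes from the second factor of the join. -/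
def tailSet {n : SimplexCategory} (U : Finset (joinObj t a n).Vertex) : Finset (Fin t) :=
  Finset.univ.filter fun j => joinTail t a n j ∈ U

lemma mem_tailSet {n : SimplexCategory} {U : Finset (joinObj t a n).Vertex} {j : Fin t} :
    j ∈ tailSet U ↔ joinTail t a n j ∈ U := by
  simp [tailSet]

lemma tailSet_mono {n : SimplexCategory} {U V : Finset (joinObj t a n).Vertex} (h : U ⊆ V) :
    tailSet U ⊆ tailSet V := fun _ hj => mem_tailSet.2 (h (mem_tailSet.1 hj))

lemma tailSet_image {n n' : SimplexCategory} (θ : n ⟶ n') (U : Finset (joinObj t a n).Vertex) :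
    tailSet (U.image (vmap (joinMap t a θ))) = tailSet U := by
  ext j
  rw [mem_tailSet, mem_tailSet, Finset.mem_image]
  constructor
  · rintro ⟨b, hb, hb'⟩
    rw [vmap_joinMap] at hb'
    rcases join_cases b with ⟨i, rfl⟩ | ⟨i, rfl⟩
    · rw [joinFun_head] at hb'
      exact absurd hb' (joinHead_lt_joinTail _ _).ne
    · rw [joinFun_tail] at hb'
      rwa [← joinTail_injective hb']
  · intro h
    exact ⟨_, h, joinFun_tail _ _⟩

lemma tailSet_insert_head {n : SimplexCategory} (U : Finset (joinObj t a n).Vertex)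
    (i : Fin (n.len + 1)) : tailSet (insert (joinHead t a n i) U) = tailSet U := by
  ext j
  rw [mem_tailSet, mem_tailSet, Finset.mem_insert]
  exact or_iff_right (joinHead_lt_joinTail _ _).ne'

lemma tailSet_erase_head {n : SimplexCategory} (U : Finset (joinObj t a n).Vertex)
    (i : Fin (n.len + 1)) : tailSet (U.erase (joinHead t a n i)) = tailSet U := by
  ext j
  rw [mem_tailSet, mem_tailSet, Finset.mem_erase]
  exact and_iff_right (joinHead_lt_joinTail _ _).ne'

variable (n : SimplexCategory) (B B' : LowerSet (Finset (Fin t)))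

variable (a) in
/-- The join of `[n]` with a subcomplex of a fixed colored simplex. -/
def joinSet : LowerSet (Finset (joinObj t a n).Vertex) where
  carrier := {U | tailSet U ∈ B}
  lower' _ _ h hU := B.lower (tailSet_mono h) hU

variable {n B} in
lemma mem_joinSet {U : Finset (joinObj t a n).Vertex} : U ∈ joinSet a n B ↔ tailSet U ∈ B := Iff.rfl

variable (a) in
/-- The union of the join of a horn of `[n]` with a subcomplex of a fixed colored simplex and the
join of `[n]` with a smaller subcomplex. -/
def joinHornSet (k : Fin (n.len + 1)) : LowerSet (Finset (joinObj t a n).Vertex) where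
  carrier := {U | tailSet U ∈ B ∧ (tailSet U ∈ B' ∨ ∃ i, i ≠ k ∧ joinHead t a n i ∉ U)}
  lower' U V h hU := by
    refine ⟨B.lower (tailSet_mono h) hU.1, ?_⟩
    rcases hU.2 with h' | ⟨i, hi, hi'⟩
    · exact Or.inl (B'.lower (tailSet_mono h) h')
    · exact Or.inr ⟨i, hi, fun hh => hi' (h hh)⟩

lemma joinHornSet_le (k : Fin (n.len + 1)) : joinHornSet a n B B' k ≤ joinSet a n B :=
  fun _ hU => hU.1

end Join

/-! ### Horns of a join in its first factor -/

section JoinCovering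

variable {C : Type u} [Category.{v} C] {Q : MorphismProperty C}
  {X : Cᵒᵖ ⥤ ColoredSimplexᵒᵖ ⥤ Type v} {t a : ℕ}

/-- Restrictions to horns of dimension at least `N` are coverings, if they are inner horns or
horns in the end of color `0` with missing face not opposite to the first vertex. -/
def HasHornCoverings (Q : MorphismProperty C) (X : Cᵒᵖ ⥤ ColoredSimplexᵒᵖ ⥤ Type v) (N : ℕ) :
    Prop :=
  ∀ (d : ColoredSimplex) (k : d.Vertex), N ≤ d.left.len → 0 < k →
    (k < Fin.last _ ∨ ∀ b, d.color b = 0) → HornCovering Q X d k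

/-- Sets outside the smaller complex contain all heads other than `k` and have a tail outside `B'`,
which does not depend on head `k`: this is the vertex to toggle. In a face containing all heads,
head `k` is not the first vertex because `k ≠ 0`. If there is a tail vertex, it is not the last one
either and the horn is inner; otherwise the face has only color `0`. A face with tail `S` has `n.len
+ 1 + S.card` vertices, whence the form of `hN`. -/
lemma isCovering_joinHorn (hQ : IsSingletonPretopology Q) {N : ℕ} (hX : HasHornCoverings Q X N)
    (n : SimplexCategory) (B B' : LowerSet (Finset (Fin t))) (hB : ∅ ∈ B)
    (k : Fin (n.len + 1)) (hk : k ≠ 0) (hN : ∀ S ∈ B, S ∉ B' → N ≤ n.len + S.card) :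
    IsCovering Q (familiesRestrict X (sieve_mono (joinHornSet_le (a := a) n B B' k))) := by
  refine isCovering_of_toggle hQ _ (joinHead t a n k) _ (joinHornSet_le n B B' k) ?_ ?_ ?_
  · refine ⟨?_, Or.inr ⟨0, hk.symm, Finset.notMem_empty _⟩⟩
    have : tailSet (∅ : Finset (joinObj t a n).Vertex) = ∅ := by
      ext j; simp [mem_tailSet]
    rwa [this]
  · intro U hUL hUK
    refine ⟨?_, fun h => hUK ⟨hUL, ?_⟩⟩
    · rw [mem_joinSet, tailSet_insert_head]
      exact hUL
    · rcases h.2 with h | ⟨i, hi, hi'⟩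
      · rw [tailSet_erase_head] at h
        exact Or.inl h
      · refine Or.inr ⟨i, hi, fun h => hi' (Finset.mem_erase.2 ⟨fun h => hi ?_, h⟩)⟩
        exact joinHead_injective h
  · intro e ι k' hι hL hnK hk'
    have h₁ : tailSet (supp ι) ∉ B' := fun h => hnK ⟨hL, Or.inl h⟩
    have h₂ : ∀ i, joinHead t a n i ∈ supp ι := by
      intro i
      by_cases hi : i = k
      · rw [hi, ← hk']; exact mem_supp.2 ⟨_, rfl⟩
      · by_contra h
        exact hnK ⟨hL, Or.inr ⟨i, hi, h⟩⟩
    have hlt : ∀ b c, vmap ι b < vmap ι c → b < c := fun b c h => (vmap ι).monotone.reflect_lt h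
    refine hX e k' ?_ ?_ ?_
    · refine (hN _ hL h₁).trans ?_
      have hc : (supp ι).card = e.left.len + 1 := by
        rw [supp, Finset.card_image_of_injective _ hι, Finset.card_univ, Fintype.card_fin]
      have hsub : Finset.univ.image (joinHead t a n) ∪ (tailSet (supp ι)).image (joinTail t a n) ⊆
          supp ι := by
        intro b
        simp only [Finset.mem_union, Finset.mem_image, Finset.mem_univ, true_and]
        rintro (⟨i, rfl⟩ | ⟨j, hj, rfl⟩)
        · exact h₂ i
        · exact mem_tailSet.1 hj
      have := Finset.card_le_card hsub
      rw [Finset.card_union_of_disjoint, Finset.card_image_of_injective _ joinHead_injective,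
        Finset.card_image_of_injective _ joinTail_injective, Finset.card_univ, Fintype.card_fin,
        hc] at this
      · omega
      · rw [Finset.disjoint_left]
        intro b
        simp only [Finset.mem_image, Finset.mem_univ, true_and]
        rintro ⟨i, rfl⟩ ⟨j, -, hj⟩
        exact (joinHead_lt_joinTail i j).ne' hj
    · obtain ⟨b, hb⟩ := mem_supp.1 (h₂ 0)
      refine lt_of_le_of_lt (Fin.zero_le b) (hlt _ _ ?_)
      rw [hb, hk']
      exact Fin.pos_of_ne_zero hk
    · by_cases hS : (tailSet (supp ι)).Nonempty
      · obtain ⟨j, hj⟩ := hS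
        obtain ⟨b, hb⟩ := mem_supp.1 (mem_tailSet.1 hj)
        refine Or.inl (lt_of_lt_of_le (hlt _ _ ?_) (Fin.le_last b))
        rw [hb, hk']
        exact joinHead_lt_joinTail _ _
      · refine Or.inr fun b => ?_
        rw [← color_vmap ι]
        rcases join_cases (vmap ι b) with ⟨i, hi⟩ | ⟨j, hj⟩
        · rw [hi, color_joinHead]
        · exact absurd ⟨j, mem_tailSet.2 (hj ▸ mem_supp.2 ⟨b, rfl⟩)⟩ hS

end JoinCovering

/-! ### Simplicial presheaves of joins -/

section JoinPresheaf

variable {C : Type u} [Category.{v} C] {Q : MorphismProperty C}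
  (X : Cᵒᵖ ⥤ ColoredSimplexᵒᵖ ⥤ Type v) {t : ℕ} (a : ℕ) (B B' : LowerSet (Finset (Fin t)))

lemma joinSet_le_pullback {n n' : SimplexCategory} (θ : n ⟶ n') :
    sieve (joinSet a n B) ≤ (sieve (joinSet a n' B)).pullback (joinMap t a θ) := by
  intro c s hs
  change tailSet (supp (s ≫ joinMap t a θ)) ∈ B
  rw [supp_comp, tailSet_image]
  exact hs

/-- The simplicial presheaf of families on joins of simplices with a fixed subcomplex. -/
def joinPresheaf : Cᵒᵖ ⥤ SSet.{v} :=
  Functor.flip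
    { obj n := families X (sieve (joinSet a n.unop B))
      map θ := familiesRes X (joinMap t a θ.unop) (joinSet_le_pullback a B θ.unop)
      map_id n := by
        ext Z x
        refine (congrArg (fun f => f) ?_ : _ = _)
        refine Family.ext ?_
        funext c s hs
        refine (x : Family _ _).val_congr ?_ _
        change s ≫ joinMap t a (𝟙 n.unop) = s
        rw [joinMap_id]
        exact Category.comp_id s
      map_comp {n p q} θ η := by
        symm
        refine familiesRes_comp X _ _ _ ?_ _ _ _
        exact (joinMap_comp _ _).symm }

end JoinPresheaf

end HigherGpd

namespace HigherGpd

/-! ### Lifting edges through right fibrations -/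

section LowDimensional

section Identities

variable {S : SSet.{v}}

/-- Suppose also that `d₀ t₁ = f : x → y`, and put `g = d₂ t₁` and `h = d₂ t₂`. The three triangles
`t₁`, `σ₁ h`, `t₂` are the faces 0, 2, 3 of a horn Λ[3,1] with vertices x, y, x, y whose consecutive
edges are `h`, `g`, `f`. -/
lemma face_compat_of_triangles {f : S _⦋1⦌} {t₁ t₂ : S _⦋2⦌}
    (h₁' : S.δ 1 t₁ = S.σ 0 (S.δ 0 f)) (h₂ : S.δ 0 t₂ = S.δ 2 t₁) :
    S.δ 0 (S.σ 1 (S.δ 2 t₂)) = S.δ 1 t₁ ∧ S.δ 0 t₂ = S.δ 2 t₁ ∧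
      S.δ 2 t₂ = S.δ 2 (S.σ 1 (S.δ 2 t₂)) := by
  refine ⟨?_, h₂, (S.δ_comp_σ_succ_apply (1 : Fin 2) (S.δ 2 t₂)).symm⟩
  have e₁ : S.δ 0 (S.δ 2 t₂) = S.δ 0 f := by
    calc S.δ 0 (S.δ 2 t₂) = S.δ 1 (S.δ 0 t₂) := S.δ_comp_δ_apply (i := 0) (j := 1) (by decide) t₂
      _ = S.δ 1 (S.δ 2 t₁) := by rw [h₂]
      _ = S.δ 1 (S.δ 1 t₁) := (S.δ_comp_δ_self_apply (i := 1) t₁).symm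
      _ = S.δ 0 f := by rw [h₁']; exact S.δ_comp_σ_succ_apply (0 : Fin 1) _
  calc S.δ 0 (S.σ 1 (S.δ 2 t₂)) = S.σ 0 (S.δ 0 (S.δ 2 t₂)) :=
        S.δ_comp_σ_of_le_apply (i := 0) (j := 0) (by decide) _
    _ = S.δ 1 t₁ := by rw [e₁, h₁']

/-- The missing face, on the vertices 0, 2, 3, compares `f` with the right inverse `d₂ t₂` of its
right inverse: it is a homotopy whose first edge is degenerate. -/
lemma faces_of_tetrahedron {f : S _⦋1⦌} {t₁ t₂ : S _⦋2⦌} (h₁ : S.δ 0 t₁ = f)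
    (h₂' : S.δ 1 t₂ = S.σ 0 (S.δ 0 (S.δ 2 t₁))) {T : S _⦋3⦌}
    (k₀ : S.δ 0 T = t₁) (k₂ : S.δ 2 T = S.σ 1 (S.δ 2 t₂)) (k₃ : S.δ 3 T = t₂) :
    S.δ 0 (S.δ 1 T) = f ∧ S.δ 1 (S.δ 1 T) = S.δ 2 t₂ ∧ S.δ 2 (S.δ 1 T) = S.σ 0 (S.δ 1 f) := by
  refine ⟨?_, ?_, ?_⟩
  · rw [← h₁, ← k₀]
    exact (S.δ_comp_δ_self_apply (i := 0) T).symm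
  · calc S.δ 1 (S.δ 1 T) = S.δ 1 (S.δ 2 T) := S.δ_comp_δ_self_apply (i := 1) T
      _ = S.δ 2 t₂ := by rw [k₂]; exact S.δ_comp_σ_self_apply (1 : Fin 2) _
  · calc S.δ 2 (S.δ 1 T) = S.δ 1 (S.δ 3 T) :=
          (S.δ_comp_δ_apply (i := 1) (j := 2) (by decide) T).symm
      _ = S.σ 0 (S.δ 0 (S.δ 2 t₁)) := by rw [k₃, h₂']
      _ = S.σ 0 (S.δ 1 (S.δ 0 t₁)) :=
          congrArg (S.σ 0) (S.δ_comp_δ_apply (i := 0) (j := 1) (by decide) t₁)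
      _ = S.σ 0 (S.δ 1 f) := by rw [h₁]

/-- A horn Λ[3,1] with vertices x, x, y, y for `f : x → y`, filled in order to move the degenerate
edge of a homotopy from the start to the end. -/
lemma face_compat_of_homotopy {f : S _⦋1⦌} {t₃ : S _⦋2⦌} (h₀ : S.δ 0 t₃ = f)
    (h₂ : S.δ 2 t₃ = S.σ 0 (S.δ 1 f)) :
    S.δ 0 t₃ = S.δ 1 (S.σ 1 f) ∧ S.δ 0 (S.σ 0 f) = S.δ 2 (S.σ 1 f) ∧
      S.δ 2 (S.σ 0 f) = S.δ 2 t₃ := by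
  refine ⟨?_, ?_, ?_⟩
  · rw [h₀]; exact (S.δ_comp_σ_self_apply (1 : Fin 2) f).symm
  · exact (S.δ_comp_σ_self_apply (0 : Fin 2) f).trans (S.δ_comp_σ_succ_apply (1 : Fin 2) f).symm
  · rw [h₂]
    exact S.δ_comp_σ_of_gt_apply (i := 1) (j := 0) (by decide) f

/-- The new face is a homotopy between `f` and `h` whose last edge is degenerate. Then `h` and the
degenerate edge form a horn Λ[2,2], along which a right fibration lifts, and `f` is the remaining
edge. -/
lemma faces_of_homotopy {f h : S _⦋1⦌} {t₃ : S _⦋2⦌} (h₁ : S.δ 1 t₃ = h) {T : S _⦋3⦌}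
    (k₀ : S.δ 0 T = S.σ 1 f) (k₂ : S.δ 2 T = t₃) (k₃ : S.δ 3 T = S.σ 0 f) :
    S.δ 0 (S.δ 1 T) = S.σ 0 (S.δ 0 f) ∧ S.δ 1 (S.δ 1 T) = h ∧ S.δ 2 (S.δ 1 T) = f := by
  refine ⟨?_, ?_, ?_⟩
  · calc S.δ 0 (S.δ 1 T) = S.δ 0 (S.δ 0 T) := (S.δ_comp_δ_self_apply (i := 0) T).symm
      _ = _ := by rw [k₀]; exact S.δ_comp_σ_of_le_apply (i := 0) (j := 0) (by decide) f
  · calc S.δ 1 (S.δ 1 T) = S.δ 1 (S.δ 2 T) := S.δ_comp_δ_self_apply (i := 1) T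
      _ = h := by rw [k₂, h₁]
  · calc S.δ 2 (S.δ 1 T) = S.δ 1 (S.δ 3 T) :=
          (S.δ_comp_δ_apply (i := 1) (j := 2) (by decide) T).symm
      _ = f := by rw [k₃]; exact S.δ_comp_σ_succ_apply (0 : Fin 2) f

end Identities

variable {C : Type u} [Category.{v} C] (Q : MorphismProperty C)

/-- The restriction of a simplex of a simplicial presheaf. -/
def pull (F : Cᵒᵖ ⥤ SSet.{v}) {Z' Z : C} (u : Z' ⟶ Z) {n : ℕ} (x : (F.obj (op Z)) _⦋n⦌) :
    (F.obj (op Z')) _⦋n⦌ := (F.map u.op).app (op ⦋n⦌) x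

/-- The image of a simplex under a map of simplicial presheaves. -/
def mapSimplex {F G : Cᵒᵖ ⥤ SSet.{v}} (q : F ⟶ G) {Z : C} {n : ℕ} (x : (F.obj (op Z)) _⦋n⦌) :
    (G.obj (op Z)) _⦋n⦌ := (q.app (op Z)).app (op ⦋n⦌) x

section

variable {F G : Cᵒᵖ ⥤ SSet.{v}} (q : F ⟶ G) {Z Z' Z'' : C} {n : ℕ}

lemma pull_pull (u : Z' ⟶ Z) (u' : Z'' ⟶ Z') (x : (F.obj (op Z)) _⦋n⦌) :
    pull F u' (pull F u x) = pull F (u' ≫ u) x := by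
  simp [pull]

lemma pull_id (x : (F.obj (op Z)) _⦋n⦌) : pull F (𝟙 Z) x = x := by
  simp [pull]

lemma δ_pull (u : Z' ⟶ Z) (i : Fin (n + 2)) (x : (F.obj (op Z)) _⦋n + 1⦌) :
    (F.obj (op Z')).δ i (pull F u x) = pull F u ((F.obj (op Z)).δ i x) :=
  (SSet.δ_naturality_apply (F.map u.op) i x).symm

lemma σ_pull (u : Z' ⟶ Z) (i : Fin (n + 1)) (x : (F.obj (op Z)) _⦋n⦌) :
    (F.obj (op Z')).σ i (pull F u x) = pull F u ((F.obj (op Z)).σ i x) :=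
  (SSet.σ_naturality_apply (F.map u.op) i x).symm

lemma δ_mapSimplex (i : Fin (n + 2)) (x : (F.obj (op Z)) _⦋n + 1⦌) :
    (G.obj (op Z)).δ i (mapSimplex q x) = mapSimplex q ((F.obj (op Z)).δ i x) :=
  (SSet.δ_naturality_apply (q.app (op Z)) i x).symm

lemma σ_mapSimplex (i : Fin (n + 1)) (x : (F.obj (op Z)) _⦋n⦌) :
    (G.obj (op Z)).σ i (mapSimplex q x) = mapSimplex q ((F.obj (op Z)).σ i x) :=
  (SSet.σ_naturality_apply (q.app (op Z)) i x).symm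

lemma mapSimplex_pull (u : Z' ⟶ Z) (x : (F.obj (op Z)) _⦋n⦌) :
    mapSimplex q (pull F u x) = pull G u (mapSimplex q x) := by
  have := ConcreteCategory.congr_hom (NatTrans.congr_app (q.naturality u.op) (op ⦋n⦌)) x
  exact this

end

/-- Lifting along the horn inclusion `Λ[1, 1] ⟶ Δ[1]`, locally and with prescribed restriction to
a given object. -/
def LiftsEdge {F G : Cᵒᵖ ⥤ SSet.{v}} (q : F ⟶ G) : Prop :=
  ∀ {Z P : C} (w : P ⟶ Z) (x₀ : (F.obj (op Z)) _⦋0⦌) (y : (G.obj (op Z)) _⦋1⦌),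
    mapSimplex q x₀ = (G.obj (op Z)).δ 0 y →
    ∀ s : (F.obj (op P)) _⦋1⦌, (F.obj (op P)).δ 0 s = pull F w x₀ →
      mapSimplex q s = pull G w y →
    ∃ (Z' : C) (u : Z' ⟶ Z) (w' : P ⟶ Z') (s' : (F.obj (op Z')) _⦋1⦌), Q u ∧ w' ≫ u = w ∧
      (F.obj (op Z')).δ 0 s' = pull F u x₀ ∧ mapSimplex q s' = pull G u y ∧ pull F w' s' = s

/-- Lifting along the horn inclusion `Λ[2, 2] ⟶ Δ[2]`, locally and with prescribed restriction to
a given object. -/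
def LiftsTriangle {F G : Cᵒᵖ ⥤ SSet.{v}} (q : F ⟶ G) : Prop :=
  ∀ {Z P : C} (w : P ⟶ Z) (x₀ x₁ : (F.obj (op Z)) _⦋1⦌) (y : (G.obj (op Z)) _⦋2⦌),
    (F.obj (op Z)).δ 0 x₁ = (F.obj (op Z)).δ 0 x₀ →
    mapSimplex q x₀ = (G.obj (op Z)).δ 0 y → mapSimplex q x₁ = (G.obj (op Z)).δ 1 y →
    ∀ s : (F.obj (op P)) _⦋2⦌, (F.obj (op P)).δ 0 s = pull F w x₀ →
      (F.obj (op P)).δ 1 s = pull F w x₁ → mapSimplex q s = pull G w y →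
    ∃ (Z' : C) (u : Z' ⟶ Z) (w' : P ⟶ Z') (s' : (F.obj (op Z')) _⦋2⦌), Q u ∧ w' ≫ u = w ∧
      (F.obj (op Z')).δ 0 s' = pull F u x₀ ∧ (F.obj (op Z')).δ 1 s' = pull F u x₁ ∧
      mapSimplex q s' = pull G u y ∧ pull F w' s' = s

/-- Filling of horns `Λ[2, 2]`, locally and with prescribed restriction to a given object. -/
def FillsTriangle (F : Cᵒᵖ ⥤ SSet.{v}) : Prop :=
  ∀ {Z P : C} (w : P ⟶ Z) (x₀ x₁ : (F.obj (op Z)) _⦋1⦌),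
    (F.obj (op Z)).δ 0 x₁ = (F.obj (op Z)).δ 0 x₀ →
    ∀ s : (F.obj (op P)) _⦋2⦌, (F.obj (op P)).δ 0 s = pull F w x₀ →
      (F.obj (op P)).δ 1 s = pull F w x₁ →
    ∃ (Z' : C) (u : Z' ⟶ Z) (w' : P ⟶ Z') (s' : (F.obj (op Z')) _⦋2⦌), Q u ∧ w' ≫ u = w ∧
      (F.obj (op Z')).δ 0 s' = pull F u x₀ ∧ (F.obj (op Z')).δ 1 s' = pull F u x₁ ∧
      pull F w' s' = s

/-- Filling of horns `Λ[3, 1]`, locally and with prescribed restriction to a given object. -/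
def FillsTetrahedron (F : Cᵒᵖ ⥤ SSet.{v}) : Prop :=
  ∀ {Z P : C} (w : P ⟶ Z) (x₀ x₂ x₃ : (F.obj (op Z)) _⦋2⦌),
    ((F.obj (op Z)).δ 0 x₂ = (F.obj (op Z)).δ 1 x₀ ∧
      (F.obj (op Z)).δ 0 x₃ = (F.obj (op Z)).δ 2 x₀ ∧
      (F.obj (op Z)).δ 2 x₃ = (F.obj (op Z)).δ 2 x₂) →
    ∀ s : (F.obj (op P)) _⦋3⦌, (F.obj (op P)).δ 0 s = pull F w x₀ →
      (F.obj (op P)).δ 2 s = pull F w x₂ → (F.obj (op P)).δ 3 s = pull F w x₃ →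
    ∃ (Z' : C) (u : Z' ⟶ Z) (w' : P ⟶ Z') (s' : (F.obj (op Z')) _⦋3⦌), Q u ∧ w' ≫ u = w ∧
      (F.obj (op Z')).δ 0 s' = pull F u x₀ ∧ (F.obj (op Z')).δ 2 s' = pull F u x₂ ∧
      (F.obj (op Z')).δ 3 s' = pull F u x₃ ∧ pull F w' s' = s

/-- Filling of horns `Λ[2, 2]` over `P`. -/
def FillsTriangleAt (F : Cᵒᵖ ⥤ SSet.{v}) (P : C) : Prop :=
  ∀ (x₀ x₁ : (F.obj (op P)) _⦋1⦌), (F.obj (op P)).δ 0 x₁ = (F.obj (op P)).δ 0 x₀ →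
    ∃ s : (F.obj (op P)) _⦋2⦌, (F.obj (op P)).δ 0 s = x₀ ∧ (F.obj (op P)).δ 1 s = x₁

/-- Filling of horns `Λ[3, 1]` over `P`. -/
def FillsTetrahedronAt (F : Cᵒᵖ ⥤ SSet.{v}) (P : C) : Prop :=
  ∀ (x₀ x₂ x₃ : (F.obj (op P)) _⦋2⦌),
    ((F.obj (op P)).δ 0 x₂ = (F.obj (op P)).δ 1 x₀ ∧
      (F.obj (op P)).δ 0 x₃ = (F.obj (op P)).δ 2 x₀ ∧
      (F.obj (op P)).δ 2 x₃ = (F.obj (op P)).δ 2 x₂) →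
    ∃ s : (F.obj (op P)) _⦋3⦌, (F.obj (op P)).δ 0 s = x₀ ∧ (F.obj (op P)).δ 2 s = x₂ ∧
      (F.obj (op P)).δ 3 s = x₃

/-- After passing to a cover, the edge `f` lifts to an edge with source `e₀` that restricts to
the given edge `s` over `P`. -/
def LiftsFromSource {E W : Cᵒᵖ ⥤ SSet.{v}} (q : E ⟶ W) {Z P : C} (w : P ⟶ Z)
    (f : (W.obj (op Z)) _⦋1⦌) (e₀ : (E.obj (op Z)) _⦋0⦌) (s : (E.obj (op P)) _⦋1⦌) : Prop :=
  ∃ (Z' : C) (u : Z' ⟶ Z) (w' : P ⟶ Z') (e : (E.obj (op Z')) _⦋1⦌), Q u ∧ w' ≫ u = w ∧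
    (E.obj (op Z')).δ 1 e = pull E u e₀ ∧ mapSimplex q e = pull W u f ∧ pull E w' e = s

variable {Q}

lemma LiftsFromSource.of_pull (hQ : ∀ {X Y Z : C} (f : X ⟶ Y) (g : Y ⟶ Z), Q f → Q g → Q (f ≫ g))
    {E W : Cᵒᵖ ⥤ SSet.{v}} {q : E ⟶ W} {Z Z' P : C} {w : P ⟶ Z} (u : Z' ⟶ Z) (hu : Q u)
    {w' : P ⟶ Z'} (hw : w' ≫ u = w)
    {f : (W.obj (op Z)) _⦋1⦌} {e₀ : (E.obj (op Z)) _⦋0⦌} {s : (E.obj (op P)) _⦋1⦌}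
    (h : LiftsFromSource Q q w' (pull W u f) (pull E u e₀) s) :
    LiftsFromSource Q q w f e₀ s := by
  obtain ⟨Z₁, u₁, w₁, e, hu₁, hw₁, h₁, h₂, h₃⟩ := h
  refine ⟨Z₁, u₁ ≫ u, w₁, e, hQ _ _ hu₁ hu, ?_, ?_, ?_, h₃⟩
  · rw [← Category.assoc, hw₁, hw]
  · rw [h₁, pull_pull]
  · rw [h₂, pull_pull]

/-- An edge with a left inverse up to homotopy lifts from its source. -/
lemma liftsFromSource_of_triangles
    (hQ : ∀ {X Y Z : C} (f : X ⟶ Y) (g : Y ⟶ Z), Q f → Q g → Q (f ≫ g))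
    {E W : Cᵒᵖ ⥤ SSet.{v}} {q : E ⟶ W} (h₁ : LiftsEdge Q q) (h₂ : LiftsTriangle Q q)
    {Z P : C} (w : P ⟶ Z) (f : (W.obj (op Z)) _⦋1⦌) (e₀ : (E.obj (op Z)) _⦋0⦌)
    (s : (E.obj (op P)) _⦋1⦌) (he₀ : mapSimplex q e₀ = (W.obj (op Z)).δ 1 f)
    (t₂ t₄ : (W.obj (op Z)) _⦋2⦌) (s₂ s₄ : (E.obj (op P)) _⦋2⦌)
    (hs₂ : mapSimplex q s₂ = pull W w t₂) (hs₄ : mapSimplex q s₄ = pull W w t₄)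
    (a₁ : (W.obj (op Z)).δ 1 t₂ = (W.obj (op Z)).σ 0 ((W.obj (op Z)).δ 1 f))
    (b₀ : (W.obj (op Z)).δ 0 t₄ = (W.obj (op Z)).σ 0 ((W.obj (op Z)).δ 0 f))
    (b₁ : (W.obj (op Z)).δ 1 t₄ = (W.obj (op Z)).δ 2 t₂) (b₂ : (W.obj (op Z)).δ 2 t₄ = f)
    (c₁ : (E.obj (op P)).δ 1 s₂ = (E.obj (op P)).σ 0 (pull E w e₀))
    (d₀ : (E.obj (op P)).δ 0 s₄ = (E.obj (op P)).σ 0 ((E.obj (op P)).δ 0 s))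
    (d₁ : (E.obj (op P)).δ 1 s₄ = (E.obj (op P)).δ 2 s₂) (d₂ : (E.obj (op P)).δ 2 s₄ = s) :
    LiftsFromSource Q q w f e₀ s := by
  have k₁ : mapSimplex q e₀ = (W.obj (op Z)).δ 0 ((W.obj (op Z)).δ 0 t₂) := by
    calc mapSimplex q e₀ = (W.obj (op Z)).δ 0 ((W.obj (op Z)).δ 1 t₂) := by
          rw [he₀, a₁]; exact (SSet.δ_comp_σ_self_apply (0 : Fin 1) _).symm
      _ = _ := (SSet.δ_comp_δ_self_apply (i := 0) t₂).symm
  have k₂ : (E.obj (op P)).δ 0 ((E.obj (op P)).δ 0 s₂) = pull E w e₀ := by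
    calc (E.obj (op P)).δ 0 ((E.obj (op P)).δ 0 s₂)
        = (E.obj (op P)).δ 0 ((E.obj (op P)).δ 1 s₂) := SSet.δ_comp_δ_self_apply (i := 0) s₂
      _ = _ := by rw [c₁]; exact SSet.δ_comp_σ_self_apply (0 : Fin 1) _
  -- Write `h = d₂ t₂`. The edge `d₀ t₂` is a left inverse of `h`; it is lifted with target `e₀`.
  obtain ⟨Z₁, u₁, w₁, γ, hu₁, hw₁, γ₀, γq, γP⟩ := h₁ w e₀ ((W.obj (op Z)).δ 0 t₂) k₁
    ((E.obj (op P)).δ 0 s₂) k₂ (by rw [← δ_mapSimplex, hs₂, δ_pull])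
  -- The lift of `t₂` has `d₁` degenerate at `e₀`, so its face `d₂` is a lift of `h` that starts at
  -- `e₀`.
  obtain ⟨Z₂, u₂, w₂, τ, hu₂, hw₂, τ₀, τ₁, τq, τP⟩ := h₂ w₁ γ
    ((E.obj (op Z₁)).σ 0 (pull E u₁ e₀)) (pull W u₁ t₂)
    (by rw [γ₀]; exact SSet.δ_comp_σ_self_apply (0 : Fin 1) _)
    (by rw [γq, δ_pull])
    (by rw [← σ_mapSimplex, mapSimplex_pull, δ_pull, a₁, ← σ_pull, he₀])
    s₂ γP.symm (by rw [c₁, ← σ_pull, pull_pull, hw₁]) (by rw [hs₂, pull_pull, hw₁])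
  have η₁ : (E.obj (op Z₂)).δ 1 ((E.obj (op Z₂)).δ 2 τ) = pull E (u₂ ≫ u₁) e₀ := by
    calc (E.obj (op Z₂)).δ 1 ((E.obj (op Z₂)).δ 2 τ)
        = (E.obj (op Z₂)).δ 1 ((E.obj (op Z₂)).δ 1 τ) := (SSet.δ_comp_δ_self_apply (i := 1) τ).symm
      _ = pull E (u₂ ≫ u₁) e₀ := by
          rw [τ₁, δ_pull, ← pull_pull]
          exact congrArg (pull E u₂) (SSet.δ_comp_σ_succ_apply (0 : Fin 1) _)
  have ηq : mapSimplex q ((E.obj (op Z₂)).δ 2 τ) = pull W (u₂ ≫ u₁) ((W.obj (op Z)).δ 1 t₄) := by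
    rw [← δ_mapSimplex, τq, pull_pull, δ_pull, b₁]
  have ηP : pull E w₂ ((E.obj (op Z₂)).δ 2 τ) = (E.obj (op P)).δ 2 s₂ := by
    rw [← δ_pull, τP]
  have hw : w₂ ≫ u₂ ≫ u₁ = w := by rw [← Category.assoc, hw₂, hw₁]
  have l₁ : (W.obj (op Z)).δ 0 ((W.obj (op Z)).δ 1 t₄) = (W.obj (op Z)).δ 0 f := by
    calc (W.obj (op Z)).δ 0 ((W.obj (op Z)).δ 1 t₄)
        = (W.obj (op Z)).δ 0 ((W.obj (op Z)).δ 0 t₄) := (SSet.δ_comp_δ_self_apply (i := 0) t₄).symm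
      _ = _ := by rw [b₀]; exact SSet.δ_comp_σ_self_apply (0 : Fin 1) _
  have l₂ : (E.obj (op P)).δ 0 ((E.obj (op P)).δ 2 s₂) = (E.obj (op P)).δ 0 s := by
    calc (E.obj (op P)).δ 0 ((E.obj (op P)).δ 2 s₂)
        = (E.obj (op P)).δ 0 ((E.obj (op P)).δ 1 s₄) := by rw [d₁]
      _ = (E.obj (op P)).δ 0 ((E.obj (op P)).δ 0 s₄) := (SSet.δ_comp_δ_self_apply (i := 0) s₄).symm
      _ = _ := by rw [d₀]; exact SSet.δ_comp_σ_self_apply (0 : Fin 1) _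
  -- Lifting the homotopy `t₄`, with degenerate last edge, replaces the lift of `h` by a lift of `f`
  -- without moving the source.
  obtain ⟨Z₃, u₃, w₃, ρ, hu₃, hw₃, ρ₀, ρ₁, ρq, ρP⟩ := h₂ w₂
    ((E.obj (op Z₂)).σ 0 ((E.obj (op Z₂)).δ 0 ((E.obj (op Z₂)).δ 2 τ)))
    ((E.obj (op Z₂)).δ 2 τ) (pull W (u₂ ≫ u₁) t₄)
    (SSet.δ_comp_σ_self_apply (0 : Fin 1) _).symm
    (by rw [← σ_mapSimplex, ← δ_mapSimplex, ηq, δ_pull, l₁, σ_pull, δ_pull, b₀])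
    (by rw [ηq, δ_pull])
    s₄ (by rw [d₀, ← σ_pull, ← δ_pull, ηP, l₂]) (by rw [d₁, ηP])
    (by rw [hs₄, pull_pull, hw])
  refine ⟨Z₃, u₃ ≫ u₂ ≫ u₁, w₃, (E.obj (op Z₃)).δ 2 ρ, hQ _ _ hu₃ (hQ _ _ hu₂ hu₁), ?_, ?_, ?_, ?_⟩
  · rw [← Category.assoc, hw₃, hw]
  · calc (E.obj (op Z₃)).δ 1 ((E.obj (op Z₃)).δ 2 ρ)
        = (E.obj (op Z₃)).δ 1 ((E.obj (op Z₃)).δ 1 ρ) := (SSet.δ_comp_δ_self_apply (i := 1) ρ).symm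
      _ = _ := by rw [ρ₁, δ_pull, η₁, pull_pull]
  · rw [← δ_mapSimplex, ρq, pull_pull, δ_pull, b₂]
  · rw [← δ_pull, ρP, d₂]

/-- Let `q` be a local right fibration, such that the edges of the base have right inverses.
Then edges lift along `q` from their sources. -/
theorem liftsFromSource (hQ : ∀ {X Y Z : C} (f : X ⟶ Y) (g : Y ⟶ Z), Q f → Q g → Q (f ≫ g))
    {E W : Cᵒᵖ ⥤ SSet.{v}} {q : E ⟶ W} (h₁ : LiftsEdge Q q) (h₂ : LiftsTriangle Q q)
    (hW₂ : FillsTriangle Q W) (hW₃ : FillsTetrahedron Q W) {Z P : C}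
    (hE₂ : FillsTriangleAt E P) (hE₃ : FillsTetrahedronAt E P)
    (w : P ⟶ Z) (f : (W.obj (op Z)) _⦋1⦌) (e₀ : (E.obj (op Z)) _⦋0⦌)
    (s : (E.obj (op P)) _⦋1⦌) (he₀ : mapSimplex q e₀ = (W.obj (op Z)).δ 1 f)
    (hs : mapSimplex q s = pull W w f) (hs₀ : (E.obj (op P)).δ 1 s = pull E w e₀) :
    LiftsFromSource Q q w f e₀ s := by
  -- The whole construction is first carried out in `E` over `P`, starting from `s`. The images
  -- under `q` are the values over `P` that the fillers in `W` have to extend, and the lifts to `E`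
  -- are then made to restrict to the simplices chosen here.
  obtain ⟨s₁, x₁₀, x₁₁⟩ := hE₂ s ((E.obj (op P)).σ 0 ((E.obj (op P)).δ 0 s))
    (SSet.δ_comp_σ_self_apply (0 : Fin 1) _)
  obtain ⟨s₂, x₂₀, x₂₁⟩ := hE₂ ((E.obj (op P)).δ 2 s₁)
    ((E.obj (op P)).σ 0 ((E.obj (op P)).δ 0 ((E.obj (op P)).δ 2 s₁)))
    (SSet.δ_comp_σ_self_apply (0 : Fin 1) _)
  obtain ⟨S₃, X₃₀, X₃₂, X₃₃⟩ := hE₃ s₁ ((E.obj (op P)).σ 1 ((E.obj (op P)).δ 2 s₂)) s₂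
    (face_compat_of_triangles (f := s) x₁₁ x₂₀)
  obtain ⟨x₃₀, x₃₁, x₃₂⟩ := faces_of_tetrahedron x₁₀ x₂₁ X₃₀ X₃₂ X₃₃
  obtain ⟨S₄, X₄₀, X₄₂, X₄₃⟩ := hE₃ _ _ _ (face_compat_of_homotopy x₃₀ x₃₂)
  obtain ⟨x₄₀, x₄₁, x₄₂⟩ := faces_of_homotopy x₃₁ X₄₀ X₄₂ X₄₃
  have c₁ : (E.obj (op P)).δ 1 s₂ = (E.obj (op P)).σ 0 ((E.obj (op P)).δ 1 s) := by
    rw [x₂₁]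
    refine congrArg _ ?_
    exact (SSet.δ_comp_δ_apply (i := 0) (j := 1) (by decide) s₁).trans (congrArg _ x₁₀)
  -- given all but the last tetrahedron
  have stage₄ : ∀ {Z : C} (w : P ⟶ Z) (f : (W.obj (op Z)) _⦋1⦌) (e₀ : (E.obj (op Z)) _⦋0⦌)
      (_ : mapSimplex q e₀ = (W.obj (op Z)).δ 1 f) (_ : mapSimplex q s = pull W w f)
      (_ : (E.obj (op P)).δ 1 s = pull E w e₀) (t₂ t₃ : (W.obj (op Z)) _⦋2⦌)
      (_ : (W.obj (op Z)).δ 1 t₂ = (W.obj (op Z)).σ 0 ((W.obj (op Z)).δ 1 f))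
      (_ : mapSimplex q s₂ = pull W w t₂)
      (_ : (W.obj (op Z)).δ 0 t₃ = f) (_ : (W.obj (op Z)).δ 1 t₃ = (W.obj (op Z)).δ 2 t₂)
      (_ : (W.obj (op Z)).δ 2 t₃ = (W.obj (op Z)).σ 0 ((W.obj (op Z)).δ 1 f))
      (_ : mapSimplex q ((E.obj (op P)).δ 1 S₃) = pull W w t₃),
      LiftsFromSource Q q w f e₀ s := by
    intro Z w f e₀ he₀ hs hs₀ t₂ t₃ ht₂ hst₂ ht₃₀ ht₃₁ ht₃₂ hst₃
    obtain ⟨Z', u, w', T, hu, hw, T₀, T₂, T₃, TP⟩ := hW₃ w _ _ _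
      (face_compat_of_homotopy ht₃₀ ht₃₂) (mapSimplex q S₄)
      (by rw [δ_mapSimplex, X₄₀, ← σ_mapSimplex, hs, σ_pull])
      (by rw [δ_mapSimplex, X₄₂, hst₃])
      (by rw [δ_mapSimplex, X₄₃, ← σ_mapSimplex, hs, σ_pull])
    rw [← σ_pull] at T₀ T₃
    obtain ⟨y₀, y₁, y₂⟩ := faces_of_homotopy (δ_pull u 1 t₃) T₀ T₂ T₃
    refine LiftsFromSource.of_pull hQ u hu hw ?_
    refine liftsFromSource_of_triangles hQ h₁ h₂ w' (pull W u f) (pull E u e₀) s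
      (by rw [mapSimplex_pull, he₀, δ_pull]) (pull W u t₂) ((W.obj (op Z')).δ 1 T)
      s₂ ((E.obj (op P)).δ 1 S₄) (by rw [pull_pull, hw, hst₂])
      (by rw [← δ_mapSimplex, ← TP, δ_pull]) (by rw [δ_pull, ht₂, δ_pull, σ_pull]) y₀
      (by rw [y₁, ht₃₁, δ_pull]) y₂ (by rw [c₁, hs₀, pull_pull, hw]) x₄₀ x₄₁ x₄₂
  -- Given the two triangles, it remains to fill the first tetrahedron. The object `Z` is kept
  -- variable because each filler exists only over a further cover.
  have stage₃ : ∀ {Z : C} (w : P ⟶ Z) (f : (W.obj (op Z)) _⦋1⦌) (e₀ : (E.obj (op Z)) _⦋0⦌)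
      (_ : mapSimplex q e₀ = (W.obj (op Z)).δ 1 f) (_ : mapSimplex q s = pull W w f)
      (_ : (E.obj (op P)).δ 1 s = pull E w e₀) (t₁ t₂ : (W.obj (op Z)) _⦋2⦌)
      (_ : (W.obj (op Z)).δ 0 t₁ = f)
      (_ : (W.obj (op Z)).δ 1 t₁ = (W.obj (op Z)).σ 0 ((W.obj (op Z)).δ 0 f))
      (_ : mapSimplex q s₁ = pull W w t₁)
      (_ : (W.obj (op Z)).δ 0 t₂ = (W.obj (op Z)).δ 2 t₁)
      (_ : (W.obj (op Z)).δ 1 t₂ =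
        (W.obj (op Z)).σ 0 ((W.obj (op Z)).δ 0 ((W.obj (op Z)).δ 2 t₁)))
      (_ : mapSimplex q s₂ = pull W w t₂),
      LiftsFromSource Q q w f e₀ s := by
    intro Z w f e₀ he₀ hs hs₀ t₁ t₂ ht₁₀ ht₁₁ hst₁ ht₂₀ ht₂₁ hst₂
    obtain ⟨Z', u, w', T, hu, hw, T₀, T₂, T₃, TP⟩ := hW₃ w _ _ _
      (face_compat_of_triangles (f := f) ht₁₁ ht₂₀) (mapSimplex q S₃)
      (by rw [δ_mapSimplex, X₃₀, hst₁])
      (by rw [δ_mapSimplex, X₃₂, ← σ_mapSimplex, ← δ_mapSimplex, hst₂, δ_pull, σ_pull])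
      (by rw [δ_mapSimplex, X₃₃, hst₂])
    rw [← σ_pull, ← δ_pull] at T₂
    have ht₂₁' : (W.obj (op Z)).δ 1 t₂ = (W.obj (op Z)).σ 0 ((W.obj (op Z)).δ 1 f) := by
      rw [ht₂₁]
      refine congrArg _ ?_
      exact (SSet.δ_comp_δ_apply (i := 0) (j := 1) (by decide) t₁).trans (congrArg _ ht₁₀)
    obtain ⟨y₀, y₁, y₂⟩ := faces_of_tetrahedron (f := pull W u f) (t₁ := pull W u t₁)
      (t₂ := pull W u t₂) (by rw [δ_pull, ht₁₀])
      (by rw [δ_pull, ht₂₁, δ_pull, δ_pull, σ_pull]) T₀ T₂ T₃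
    refine LiftsFromSource.of_pull hQ u hu hw ?_
    refine stage₄ w' (pull W u f) (pull E u e₀) (by rw [mapSimplex_pull, he₀, δ_pull])
      (by rw [hs, pull_pull, hw]) (by rw [hs₀, pull_pull, hw]) (pull W u t₂)
      ((W.obj (op Z')).δ 1 T) (by rw [δ_pull, ht₂₁', δ_pull, σ_pull])
      (by rw [hst₂, pull_pull, hw]) y₀ y₁ y₂ (by rw [← δ_mapSimplex, ← TP, δ_pull])
  -- The triangle `t₁` provides a right inverse of `f`, and `t₂` below a right inverse of that one.
  obtain ⟨Z₁, u₁, w₁, t₁, hu₁, hw₁, t₁₀, t₁₁, t₁P⟩ := hW₂ w f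
    ((W.obj (op Z)).σ 0 ((W.obj (op Z)).δ 0 f)) (SSet.δ_comp_σ_self_apply (0 : Fin 1) _)
    (mapSimplex q s₁) (by rw [δ_mapSimplex, x₁₀, hs])
    (by rw [δ_mapSimplex, x₁₁, ← σ_mapSimplex, ← δ_mapSimplex, hs, δ_pull, σ_pull])
  obtain ⟨Z₂, u₂, w₂, t₂, hu₂, hw₂, t₂₀, t₂₁, t₂P⟩ := hW₂ w₁ ((W.obj (op Z₁)).δ 2 t₁)
    ((W.obj (op Z₁)).σ 0 ((W.obj (op Z₁)).δ 0 ((W.obj (op Z₁)).δ 2 t₁)))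
    (SSet.δ_comp_σ_self_apply (0 : Fin 1) _) (mapSimplex q s₂)
    (by rw [δ_mapSimplex, x₂₀, ← δ_mapSimplex, ← t₁P, δ_pull])
    (by rw [δ_mapSimplex, x₂₁, ← σ_mapSimplex, ← δ_mapSimplex, ← δ_mapSimplex, ← t₁P, δ_pull,
      δ_pull, σ_pull])
  have hw : w₂ ≫ u₂ ≫ u₁ = w := by rw [← Category.assoc, hw₂, hw₁]
  refine LiftsFromSource.of_pull hQ (u₂ ≫ u₁) (hQ _ _ hu₂ hu₁) hw ?_
  refine stage₃ w₂ _ _ (by rw [mapSimplex_pull, he₀, δ_pull])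
    (by rw [hs, pull_pull, hw]) (by rw [hs₀, pull_pull, hw]) (pull W u₂ t₁) t₂ ?_ ?_ ?_ ?_ ?_ ?_
  · rw [δ_pull, t₁₀, pull_pull]
  · rw [δ_pull, t₁₁, ← pull_pull, δ_pull, δ_pull, ← σ_pull, ← σ_pull]
  · rw [pull_pull, hw₂, t₁P]
  · rw [t₂₀, δ_pull]
  · rw [t₂₁, δ_pull, δ_pull, σ_pull]
  · exact t₂P.symm

/-- Let `q` have unique lifts along `Λ[1, 1] ⟶ Δ[1]` and `Λ[2, 1] ⟶ Δ[2]`. Then two lifts of an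
edge with a right inverse up to homotopy agree if they have the same source. -/
theorem lifts_eq_of_source_eq {E W : SSet.{v}} (q : E ⟶ W)
    (hex : ∀ (x₀ : E _⦋0⦌) (y : W _⦋1⦌), q.app _ x₀ = W.δ 0 y → ∃ e : E _⦋1⦌, E.δ 0 e = x₀ ∧
      q.app _ e = y)
    (huniq : ∀ e e' : E _⦋1⦌, E.δ 0 e = E.δ 0 e' → q.app _ e = q.app _ e' → e = e')
    (hex₂ : ∀ (x₀ x₂ : E _⦋1⦌) (y : W _⦋2⦌), E.δ 0 x₂ = E.δ 1 x₀ → q.app _ x₀ = W.δ 0 y →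
      q.app _ x₂ = W.δ 2 y → ∃ s : E _⦋2⦌, E.δ 0 s = x₀ ∧ E.δ 2 s = x₂ ∧ q.app _ s = y)
    (f : W _⦋1⦌) (t : W _⦋2⦌) (ht₀ : W.δ 0 t = f) (ht₁ : W.δ 1 t = W.σ 0 (W.δ 0 f))
    (e e' : E _⦋1⦌) (he : q.app _ e = f) (he' : q.app _ e' = f) (hee' : E.δ 1 e = E.δ 1 e') :
    e = e' := by
  refine huniq e e' ?_ (he.trans he'.symm)
  have hq : ∀ (i : Fin 2) (x : E _⦋1⦌), q.app _ (E.δ i x) = W.δ i (q.app _ x) :=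
    fun i x => SSet.δ_naturality_apply q i x
  have hq₂ : ∀ (i : Fin 3) (x : E _⦋2⦌), q.app _ (E.δ i x) = W.δ i (q.app _ x) :=
    fun i x => SSet.δ_naturality_apply q i x
  -- A lift of the right inverse `d₂ t` of `f`, with target the common source of `e` and `e'`.
  obtain ⟨g, hg₀, hg⟩ := hex (E.δ 1 e) (W.δ 2 t) (by
    rw [hq, he, ← ht₀]
    exact (SSet.δ_comp_δ_apply (i := 0) (j := 1) (by decide) t).symm)
  -- Filling Λ[2,1] over `t` with `g` and a lift `x` of `f` gives a third edge over a degenerate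
  -- edge. By uniqueness of lifts it is degenerate, so the target of `x` is the source of `g`.
  have key : ∀ x : E _⦋1⦌, q.app _ x = f → E.δ 1 x = E.δ 1 e → E.δ 0 x = E.δ 1 g := by
    intro x hx hx₁
    obtain ⟨s, hs₀, hs₂, hs⟩ := hex₂ x g t (by rw [hg₀, hx₁]) (by rw [hx, ht₀]) hg
    have h₁ : E.δ 1 s = E.σ 0 (E.δ 0 x) := by
      refine huniq _ _ ?_ ?_
      · refine ((SSet.δ_comp_δ_self_apply (i := 0) s).symm.trans ?_).trans
          (SSet.δ_comp_σ_self_apply (0 : Fin 1) _).symm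
        exact congrArg _ hs₀
      · rw [hq₂, hs, ht₁, SSet.σ_naturality_apply, hq, hx]
    calc E.δ 0 x = E.δ 1 (E.σ 0 (E.δ 0 x)) := (SSet.δ_comp_σ_succ_apply (0 : Fin 1) _).symm
      _ = E.δ 1 (E.δ 1 s) := by rw [h₁]
      _ = E.δ 1 (E.δ 2 s) := SSet.δ_comp_δ_self_apply (i := 1) s
      _ = E.δ 1 g := by rw [hs₂]
  rw [key e he rfl, key e' he' hee'.symm]

end LowDimensional

end HigherGpd

namespace HigherGpd

open ColoredSimplex

/-! ### Families on horns of joins in terms of faces -/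

section JoinHornFamilies

variable {t a : ℕ} {n : ℕ}

lemma head_notMem_supp_joinMap_δ (i : Fin (n + 2)) {c : ColoredSimplex}
    (r : c ⟶ joinObj t a ⦋n⦌) :
    joinHead t a ⦋n + 1⦌ i ∉ supp (r ≫ joinMap t a (SimplexCategory.δ i)) := by
  intro h
  obtain ⟨b, hb⟩ := mem_supp.1 h
  rw [vmap_comp, vmap_joinMap] at hb
  rcases join_cases (vmap r b) with ⟨j, hj⟩ | ⟨j, hj⟩
  · rw [hj, joinFun_head] at hb
    exact Fin.succAbove_ne i j (joinHead_injective hb)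
  · rw [hj, joinFun_tail] at hb
    exact (joinHead_lt_joinTail _ _).ne' hb

lemma mem_supp_joinMap {m n : SimplexCategory} {θ : m ⟶ n} {b : (joinObj t a n).Vertex}
    (hb : ∀ i, b = joinHead t a n i → ∃ j, θ.toOrderHom j = i) : b ∈ supp (joinMap t a θ) := by
  rcases join_cases b with ⟨i, rfl⟩ | ⟨i, rfl⟩
  · obtain ⟨j, rfl⟩ := hb i rfl
    exact mem_supp.2 ⟨joinHead t a m j, joinFun_head θ j⟩
  · exact mem_supp.2 ⟨joinTail t a m i, joinFun_tail θ i⟩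

lemma joinMap_δ_injective (i : Fin (n + 2)) :
    Function.Injective (vmap (joinMap t a (SimplexCategory.δ i))) :=
  joinMap_injective (Fin.succAbove_right_injective (p := i))

lemma joinMap_δ_δ_injective (i : Fin (n + 3)) (j : Fin (n + 2)) :
    Function.Injective (vmap (joinMap t a (SimplexCategory.δ j ≫ SimplexCategory.δ i))) :=
  joinMap_injective ((Fin.succAbove_right_injective (p := i)).comp
    (Fin.succAbove_right_injective (p := j)))

lemma exists_factor_joinMap_δ (i : Fin (n + 2)) {c : ColoredSimplex}
    {s : c ⟶ joinObj t a ⦋n + 1⦌} (h : joinHead t a ⦋n + 1⦌ i ∉ supp s) :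
    ∃ r, r ≫ joinMap t a (SimplexCategory.δ i) = s := by
  refine exists_factor (joinMap_δ_injective i) fun b hb => mem_supp_joinMap fun j hj => ?_
  have hji : j ≠ i := by
    rintro rfl
    exact h (hj ▸ hb)
  exact Fin.exists_succAbove_eq hji

lemma tailSet_supp_joinMap {m n : SimplexCategory} (θ : m ⟶ n) {c : ColoredSimplex}
    (r : c ⟶ joinObj t a m) : tailSet (supp (r ≫ joinMap t a θ)) = tailSet (supp r) := by
  rw [supp_comp, tailSet_image]

variable {A : ColoredSimplexᵒᵖ ⥤ Type v} {B B' : LowerSet (Finset (Fin t))}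

/-- A collection of faces that agree on their intersections, where the `k`-th face is ignored. -/
def FacesAgree (k : Fin (n + 2)) (x : Fin (n + 2) → Family A (sieve (joinSet a ⦋n⦌ B))) : Prop :=
  ∀ i j, i ≠ k → j ≠ k → ∀ {c : ColoredSimplex} (r r' : c ⟶ joinObj t a ⦋n⦌)
    (hr : sieve (joinSet a ⦋n⦌ B) r) (hr' : sieve (joinSet a ⦋n⦌ B) r'),
    r ≫ joinMap t a (SimplexCategory.δ i) = r' ≫ joinMap t a (SimplexCategory.δ j) →
      (x i).val r hr = (x j).val r' hr'

/-- A simplex lying in two different faces `i` and `j` misses both heads, so it factors through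
their common face of codimension two. The simplicial identities therefore test all overlaps. -/
lemma facesAgree_of_δ {k : Fin (n + 3)}
    (x : Fin (n + 3) → Family A (sieve (joinSet a ⦋n + 1⦌ B)))
    (h : ∀ i j : Fin (n + 2), i ≤ j → i.castSucc ≠ k → j.succ ≠ k →
      (x j.succ).res (joinMap t a (SimplexCategory.δ i)) (joinSet_le_pullback a B _) =
        (x i.castSucc).res (joinMap t a (SimplexCategory.δ j)) (joinSet_le_pullback a B _)) :
    FacesAgree k x := by
  have key : ∀ i j : Fin (n + 3), i < j → i ≠ k → j ≠ k → ∀ {c : ColoredSimplex}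
      (r r' : c ⟶ joinObj t a ⦋n + 1⦌)
      (hr : sieve (joinSet a ⦋n + 1⦌ B) r) (hr' : sieve (joinSet a ⦋n + 1⦌ B) r'),
      r ≫ joinMap t a (SimplexCategory.δ i) = r' ≫ joinMap t a (SimplexCategory.δ j) →
        (x i).val r hr = (x j).val r' hr' := by
    intro i j hij hi hj c r r' hr hr' hrr
    obtain ⟨i, rfl⟩ : ∃ i', i = Fin.castSucc i' := Fin.exists_castSucc_eq.2
      (ne_of_lt (lt_of_lt_of_le hij (Fin.le_last j))) |>.imp fun _ h => h.symm
    obtain ⟨j, rfl⟩ : ∃ j', j = Fin.succ j' := Fin.exists_succ_eq.2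
      (ne_of_gt (lt_of_le_of_lt (Fin.zero_le _) hij)) |>.imp fun _ h => h.symm
    have hij' : i ≤ j := Fin.castSucc_lt_succ_iff.1 hij
    have e₁ : joinMap t a (SimplexCategory.δ i) ≫ joinMap t a (SimplexCategory.δ j.succ) =
        joinMap t a (SimplexCategory.δ i ≫ SimplexCategory.δ j.succ) := (joinMap_comp _ _).symm
    have e₂ : joinMap t a (SimplexCategory.δ j) ≫ joinMap t a (SimplexCategory.δ i.castSucc) =
        joinMap t a (SimplexCategory.δ i ≫ SimplexCategory.δ j.succ) := by
      rw [SimplexCategory.δ_comp_δ hij', joinMap_comp]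
    obtain ⟨r'', hr''⟩ : ∃ r'', r'' ≫ joinMap t a (SimplexCategory.δ i ≫ SimplexCategory.δ j.succ) =
        r' ≫ joinMap t a (SimplexCategory.δ j.succ) := by
      refine exists_factor (joinMap_δ_δ_injective _ _) fun b hb => mem_supp_joinMap fun l hl => ?_
      have h₁ : l ≠ j.succ := by
        rintro rfl
        exact head_notMem_supp_joinMap_δ _ r' (hl ▸ hb)
      have h₂ : l ≠ i.castSucc := by
        rintro rfl
        refine head_notMem_supp_joinMap_δ i.castSucc r ?_
        rw [hrr]
        exact hl ▸ hb
      obtain ⟨l', hl'⟩ := Fin.exists_succAbove_eq h₁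
      have h₃ : l' ≠ i := by
        rintro rfl
        exact h₂ (hl' ▸ Fin.succAbove_of_castSucc_lt _ _ hij)
      obtain ⟨l'', hl''⟩ := Fin.exists_succAbove_eq h₃
      refine ⟨l'', ?_⟩
      change Fin.succAbove _ (Fin.succAbove _ l'') = l
      rw [hl'', hl']
    have m₁ := mono_of_injective (joinMap_δ_injective (t := t) (a := a) i.castSucc)
    have m₂ := mono_of_injective (joinMap_δ_injective (t := t) (a := a) j.succ)
    have q₁ : r = r'' ≫ joinMap t a (SimplexCategory.δ j) := by
      rw [← cancel_mono (joinMap t a (SimplexCategory.δ i.castSucc)), Category.assoc, e₂, hr'', hrr]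
    have q₂ : r' = r'' ≫ joinMap t a (SimplexCategory.δ i) := by
      rw [← cancel_mono (joinMap t a (SimplexCategory.δ j.succ)), Category.assoc, e₁, hr'']
    have hs : sieve (joinSet a ⦋n⦌ B) r'' := by
      rw [q₁, mem_sieve, mem_joinSet, tailSet_supp_joinMap] at hr
      exact hr
    have := congrArg (fun z : Family A (sieve (joinSet a ⦋n⦌ B)) => z.val r'' hs) (h i j hij' hi hj)
    exact ((x _).val_congr q₁ _).trans (this.symm.trans ((x _).val_congr q₂.symm _))
  intro i j hi hj c r r' hr hr' hrr
  rcases lt_trichotomy i j with h | rfl | h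
  · exact key i j h hi hj r r' hr hr' hrr
  · have := mono_of_injective (joinMap_δ_injective (t := t) (a := a) i)
    exact (x i).val_congr ((cancel_mono _).1 hrr) _
  · exact (key j i h hj hi r' r hr' hr hrr.symm).symm

lemma face_le_joinHorn {k i : Fin (n + 2)} (hi : i ≠ k) :
    sieve (joinSet a ⦋n⦌ B) ≤
      (sieve (joinHornSet a ⦋n + 1⦌ B B' k)).pullback (joinMap t a (SimplexCategory.δ i)) := by
  intro c s hs
  change supp (s ≫ joinMap t a (SimplexCategory.δ i)) ∈ joinHornSet a ⦋n + 1⦌ B B' k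
  refine ⟨?_, Or.inr ⟨i, hi, head_notMem_supp_joinMap_δ i s⟩⟩
  rw [tailSet_supp_joinMap]
  exact hs

lemma joinSet_le_joinHorn (h : B' ≤ B) (k : Fin (n + 2)) :
    sieve (joinSet a ⦋n + 1⦌ B') ≤
      (sieve (joinHornSet a ⦋n + 1⦌ B B' k)).pullback (𝟙 _) :=
  Sieve_le_pullback_id fun _ _ hs => ⟨h hs, Or.inl hs⟩

lemma joinHorn_cover {k : Fin (n + 2)} {c : ColoredSimplex} {s : c ⟶ joinObj t a ⦋n + 1⦌}
    (hs : sieve (joinHornSet a ⦋n + 1⦌ B B' k) s) :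
    sieve (joinSet a ⦋n + 1⦌ B') s ∨ ∃ i, i ≠ k ∧ ∃ r, sieve (joinSet a ⦋n⦌ B) r ∧
      r ≫ joinMap t a (SimplexCategory.δ i) = s := by
  rcases hs.2 with h | ⟨i, hi, h⟩
  · exact Or.inl h
  · obtain ⟨r, rfl⟩ := exists_factor_joinMap_δ i h
    refine Or.inr ⟨i, hi, r, ?_, rfl⟩
    have := hs.1
    rw [tailSet_supp_joinMap] at this
    exact this

lemma joinHorn_ext (hB : B' ≤ B) {k : Fin (n + 2)}
    {z z' : Family A (sieve (joinHornSet a ⦋n + 1⦌ B B' k))}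
    (h : ∀ i (hi : i ≠ k), z.res (joinMap t a (SimplexCategory.δ i)) (face_le_joinHorn hi) =
      z'.res (joinMap t a (SimplexCategory.δ i)) (face_le_joinHorn hi))
    (h' : z.res (𝟙 _) (joinSet_le_joinHorn hB k) = z'.res (𝟙 _) (joinSet_le_joinHorn hB k)) :
    z = z' := by
  ext c s hs
  rcases joinHorn_cover hs with h₁ | ⟨i, hi, r, hr, rfl⟩
  · have := congrArg (fun y : Family A (sieve (joinSet a ⦋n + 1⦌ B')) => y.val s h₁) h'
    exact (z.val_congr (Category.comp_id s).symm _).trans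
      (this.trans (z'.val_congr (Category.comp_id s) _))
  · exact congrArg (fun y : Family A (sieve (joinSet a ⦋n⦌ B)) => y.val r hr) (h i hi)

lemma joinSet_mono (h : B' ≤ B) (m : SimplexCategory) : joinSet a m B' ≤ joinSet a m B :=
  fun _ hU => h hU

lemma exists_joinHorn_family (hB : B' ≤ B) {k : Fin (n + 2)}
    (x : Fin (n + 2) → Family A (sieve (joinSet a ⦋n⦌ B)))
    (y : Family A (sieve (joinSet a ⦋n + 1⦌ B'))) (hx : FacesAgree k x)
    (hxy : ∀ i, i ≠ k → (x i).res (𝟙 _) (Sieve_le_pullback_id (sieve_mono (joinSet_mono hB _))) =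
      y.res (joinMap t a (SimplexCategory.δ i)) (joinSet_le_pullback a B' _)) :
    ∃ z : Family A (sieve (joinHornSet a ⦋n + 1⦌ B B' k)),
      (∀ i (hi : i ≠ k), z.res (joinMap t a (SimplexCategory.δ i)) (face_le_joinHorn hi) = x i) ∧
      z.res (𝟙 _) (joinSet_le_joinHorn hB k) = y := by
  have hxy' : ∀ i, i ≠ k → ∀ {c : ColoredSimplex} (r : c ⟶ joinObj t a ⦋n⦌)
      (hr : sieve (joinSet a ⦋n⦌ B) r) (s : c ⟶ joinObj t a ⦋n + 1⦌)
      (hs : sieve (joinSet a ⦋n + 1⦌ B') s), r ≫ joinMap t a (SimplexCategory.δ i) = s →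
      (x i).val r hr = y.val s hs := by
    rintro i hi c r hr _ hs rfl
    have hr' : sieve (joinSet a ⦋n⦌ B') r := by
      rw [mem_sieve, mem_joinSet, tailSet_supp_joinMap] at hs
      exact hs
    have := congrArg (fun y : Family A (sieve (joinSet a ⦋n⦌ B')) => y.val r hr') (hxy i hi)
    exact ((x i).val_congr (Category.comp_id r).symm _).trans this
  -- The index `none` stands for the join of the full simplex with `B'`, and `some i` for the `i`-th
  -- face joined with `B`.
  let e : Option {i // i ≠ k} → ColoredSimplex := fun o => match o with
    | none => joinObj t a ⦋n + 1⦌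
    | some _ => joinObj t a ⦋n⦌
  let f : ∀ o, e o ⟶ joinObj t a ⦋n + 1⦌ := fun o => match o with
    | none => 𝟙 _
    | some i => joinMap t a (SimplexCategory.δ i.1)
  let T : ∀ o, Sieve (e o) := fun o => match o with
    | none => sieve (joinSet a ⦋n + 1⦌ B')
    | some _ => sieve (joinSet a ⦋n⦌ B)
  let X : ∀ o, Family A (T o) := fun o => match o with
    | none => y
    | some i => x i.1
  obtain ⟨z, hz⟩ := Family.exists_glue (A := A) (S := sieve (joinHornSet a ⦋n + 1⦌ B B' k)) f T (by
      rintro (_ | ⟨i, hi⟩)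
      · exact joinSet_le_joinHorn hB k
      · exact face_le_joinHorn hi) (by
      intro c s hs
      rcases joinHorn_cover hs with h₁ | ⟨i, hi, r, hr, hrs⟩
      · exact ⟨none, s, h₁, Category.comp_id s⟩
      · exact ⟨some ⟨i, hi⟩, r, hr, hrs⟩) X (by
      rintro (_ | ⟨i, hi⟩) (_ | ⟨j, hj⟩) c r r' hr hr' hrr
      · exact y.val_congr ((Category.comp_id _).symm.trans (hrr.trans (Category.comp_id _))) _
      · exact (hxy' j hj r' hr' r hr (hrr.symm.trans (Category.comp_id _))).symm
      · exact hxy' i hi r hr r' hr' (hrr.trans (Category.comp_id _))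
      · exact hx i j hi hj r r' hr hr' hrr)
  exact ⟨z, fun i hi => hz (some ⟨i, hi⟩), hz none⟩

end JoinHornFamilies

/-! ### Lifting problems between simplicial presheaves of joins -/

section Lifting

variable {C : Type u} [Category.{v} C] {Q : MorphismProperty C}
  (X : Cᵒᵖ ⥤ ColoredSimplexᵒᵖ ⥤ Type v) {t : ℕ} (a : ℕ) {B B' : LowerSet (Finset (Fin t))}

/-- The restriction to the join with a smaller subcomplex. -/
def joinRestrict (h : B' ≤ B) : joinPresheaf X a B ⟶ joinPresheaf X a B' where
  app Z :=
    { app n := (familiesRestrict X (S := sieve (joinSet a n.unop B))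
        (S' := sieve (joinSet a n.unop B')) (sieve_mono (joinSet_mono h _))).app Z
      naturality n m θ := by
        have e : familiesRes X (joinMap t a θ.unop) (joinSet_le_pullback a B θ.unop) ≫
            familiesRestrict X (sieve_mono (joinSet_mono h _)) =
              familiesRestrict X (sieve_mono (joinSet_mono h _)) ≫
              familiesRes X (joinMap t a θ.unop) (joinSet_le_pullback a B' θ.unop) := by
          have hle : sieve (joinSet a m.unop B') ≤
              (sieve (joinSet a n.unop B)).pullback (joinMap t a θ.unop) :=
            fun c s hs => joinSet_le_pullback a B θ.unop _ (h hs)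
          rw [familiesRes_comp X _ _ _ (Category.id_comp _) _ _ hle,
            familiesRes_comp X _ _ _ (Category.comp_id _) _ _ hle]
        exact NatTrans.congr_app e Z }
  naturality Z W g := by
    ext n x
    rfl

variable {X a} {n : ℕ} {k : Fin (n + 2)}

/-- A lifting problem for Λ[n+1,k] against `joinRestrict` becomes a single element `z` of a presheaf
of families. The equivalence is stated after every base change `g`, so that it can be used over
covers and over `P` alike. -/
lemma joinPresheaf_horn {Z : C} (hB : B' ≤ B)
    (x : Fin (n + 2) → ((joinPresheaf X a B).obj (op Z)) _⦋n⦌)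
    (y : ((joinPresheaf X a B').obj (op Z)) _⦋n + 1⦌)
    (hx : FacesAgree (A := X.obj (op Z)) (B := B) (a := a) k x)
    (hxy : ∀ i, i ≠ k → mapSimplex (joinRestrict X a hB) (x i) =
      ((joinPresheaf X a B').obj (op Z)).δ i y) :
    ∃ z : (families X (sieve (joinHornSet a ⦋n + 1⦌ B B' k))).obj (op Z),
      ∀ (T : C) (g : T ⟶ Z) (s : ((joinPresheaf X a B).obj (op T)) _⦋n + 1⦌),
        (familiesRestrict X (sieve_mono (joinHornSet_le ⦋n + 1⦌ B B' k))).app (op T) s =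
          (families X _).map g.op z ↔
        (∀ i, i ≠ k → ((joinPresheaf X a B).obj (op T)).δ i s = pull _ g (x i)) ∧
          mapSimplex (joinRestrict X a hB) s = pull _ g y := by
  obtain ⟨z, hz, hz'⟩ := exists_joinHorn_family (A := X.obj (op Z)) hB x y hx hxy
  refine ⟨z, fun T g s => ?_⟩
  have e₁ : ∀ i (hi : i ≠ k), (Family.res (joinMap t a (SimplexCategory.δ i)) (face_le_joinHorn hi)
      (((familiesRestrict X (sieve_mono (joinHornSet_le ⦋n + 1⦌ B B' k))).app (op T) s :) :
        Family (X.obj (op T)) _)) = ((joinPresheaf X a B).obj (op T)).δ i s := fun i hi =>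
    Family.res_res (A := X.obj (op T)) _ _ _ (Category.comp_id _) _ _ _ s
  have e₂ : ∀ i (hi : i ≠ k), (Family.res (joinMap t a (SimplexCategory.δ i)) (face_le_joinHorn hi)
      (((families X _).map g.op z :) : Family (X.obj (op T)) _)) = pull _ g (x i) := fun i hi =>
    congrArg (Family.push (X.map g.op)) (hz i hi)
  have e₃ : (Family.res (𝟙 _) (joinSet_le_joinHorn hB k)
      (((familiesRestrict X (sieve_mono (joinHornSet_le ⦋n + 1⦌ B B' k))).app (op T) s :) :
        Family (X.obj (op T)) _)) = mapSimplex (joinRestrict X a hB) s :=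
    Family.res_res (A := X.obj (op T)) _ _ _ (Category.comp_id _) _ _ _ s
  have e₄ : (Family.res (𝟙 _) (joinSet_le_joinHorn hB k)
      (((families X _).map g.op z :) : Family (X.obj (op T)) _)) = pull _ g y :=
    congrArg (Family.push (X.map g.op)) hz'
  constructor
  · intro h
    refine ⟨fun i hi => ?_, ?_⟩
    · rw [← e₁ i hi, h, e₂ i hi]
    · rw [← e₃, h, e₄]
  · rintro ⟨h₁, h₂⟩
    refine joinHorn_ext hB (fun i hi => ?_) ?_
    · rw [e₁ i hi, h₁ i hi, e₂ i hi]
    · rw [e₃, h₂, e₄]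

lemma joinPresheaf_lift {Z P : C} (hB : B' ≤ B)
    (hcov : IsCovering Q (familiesRestrict X
      (sieve_mono (joinHornSet_le (a := a) ⦋n + 1⦌ B B' k))))
    (w : P ⟶ Z) (x : Fin (n + 2) → ((joinPresheaf X a B).obj (op Z)) _⦋n⦌)
    (y : ((joinPresheaf X a B').obj (op Z)) _⦋n + 1⦌)
    (hx : FacesAgree (A := X.obj (op Z)) (B := B) (a := a) k x)
    (hxy : ∀ i, i ≠ k → mapSimplex (joinRestrict X a hB) (x i) =
      ((joinPresheaf X a B').obj (op Z)).δ i y)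
    (s : ((joinPresheaf X a B).obj (op P)) _⦋n + 1⦌)
    (hs : ∀ i, i ≠ k → ((joinPresheaf X a B).obj (op P)).δ i s = pull _ w (x i))
    (hs' : mapSimplex (joinRestrict X a hB) s = pull _ w y) :
    ∃ (Z' : C) (u : Z' ⟶ Z) (w' : P ⟶ Z') (s' : ((joinPresheaf X a B).obj (op Z')) _⦋n + 1⦌),
      Q u ∧ w' ≫ u = w ∧
      (∀ i, i ≠ k → ((joinPresheaf X a B).obj (op Z')).δ i s' = pull _ u (x i)) ∧
      mapSimplex (joinRestrict X a hB) s' = pull _ u y ∧ pull _ w' s' = s := by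
  obtain ⟨z, hz⟩ := joinPresheaf_horn hB x y hx hxy
  obtain ⟨Z', u, w', s', hu, hw, h₁, h₂⟩ := hcov.exists_lift z w s ((hz P w s).2 ⟨hs, hs'⟩)
  obtain ⟨h₃, h₄⟩ := (hz Z' u s').1 h₁
  exact ⟨Z', u, w', s', hu, hw, h₃, h₄, h₂⟩

lemma joinPresheaf_lift_of_surjective {P : C} (hB : B' ≤ B)
    (hsurj : Function.Surjective ((familiesRestrict X
      (sieve_mono (joinHornSet_le (a := a) ⦋n + 1⦌ B B' k))).app (op P)))
    (x : Fin (n + 2) → ((joinPresheaf X a B).obj (op P)) _⦋n⦌)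
    (y : ((joinPresheaf X a B').obj (op P)) _⦋n + 1⦌)
    (hx : FacesAgree (A := X.obj (op P)) (B := B) (a := a) k x)
    (hxy : ∀ i, i ≠ k → mapSimplex (joinRestrict X a hB) (x i) =
      ((joinPresheaf X a B').obj (op P)).δ i y) :
    ∃ s : ((joinPresheaf X a B).obj (op P)) _⦋n + 1⦌,
      (∀ i, i ≠ k → ((joinPresheaf X a B).obj (op P)).δ i s = x i) ∧
      mapSimplex (joinRestrict X a hB) s = y := by
  obtain ⟨z, hz⟩ := joinPresheaf_horn hB x y hx hxy
  obtain ⟨s, hs⟩ := hsurj z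
  obtain ⟨h₃, h₄⟩ := (hz P (𝟙 P) s).1 (by rw [hs]; simp)
  refine ⟨s, fun i hi => ?_, ?_⟩
  · rw [h₃ i hi, pull_id]
  · rw [h₄, pull_id]

lemma joinPresheaf_eq_of_injective {P : C} (hB : B' ≤ B)
    (hinj : Function.Injective ((familiesRestrict X
      (sieve_mono (joinHornSet_le (a := a) ⦋n + 1⦌ B B' k))).app (op P)))
    (s s' : ((joinPresheaf X a B).obj (op P)) _⦋n + 1⦌)
    (h : ∀ i, i ≠ k → ((joinPresheaf X a B).obj (op P)).δ i s =
      ((joinPresheaf X a B).obj (op P)).δ i s')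
    (h' : mapSimplex (joinRestrict X a hB) s = mapSimplex (joinRestrict X a hB) s') : s = s' := by
  have e₁ : ∀ (s : ((joinPresheaf X a B).obj (op P)) _⦋n + 1⦌) i (hi : i ≠ k),
      (Family.res (joinMap t a (SimplexCategory.δ i)) (face_le_joinHorn hi)
      (((familiesRestrict X (sieve_mono (joinHornSet_le ⦋n + 1⦌ B B' k))).app (op P) s :) :
        Family (X.obj (op P)) _)) = ((joinPresheaf X a B).obj (op P)).δ i s := fun s i hi =>
    Family.res_res (A := X.obj (op P)) _ _ _ (Category.comp_id _) _ _ _ s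
  have e₃ : ∀ (s : ((joinPresheaf X a B).obj (op P)) _⦋n + 1⦌),
      (Family.res (𝟙 _) (joinSet_le_joinHorn hB k)
      (((familiesRestrict X (sieve_mono (joinHornSet_le ⦋n + 1⦌ B B' k))).app (op P) s :) :
        Family (X.obj (op P)) _)) = mapSimplex (joinRestrict X a hB) s := fun s =>
    Family.res_res (A := X.obj (op P)) _ _ _ (Category.comp_id _) _ _ _ s
  refine hinj (joinHorn_ext hB (fun i hi => ?_) ?_)
  · rw [e₁ s i hi, h i hi, e₁ s' i hi]
  · rw [e₃ s, h', e₃ s']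

/-- Only the face with index 0 counts. Here and in the vectors of faces below, the entry at the
missing index is a placeholder. -/
lemma facesAgree_edge {Z : C} (x : Fin 2 → ((joinPresheaf X a B).obj (op Z)) _⦋0⦌) :
    FacesAgree (A := X.obj (op Z)) (B := B) (a := a) (n := 0) 1 x := by
  intro i j hi hj c r r' hr hr' hrr
  obtain rfl : i = j := by omega
  have := mono_of_injective (joinMap_δ_injective (t := t) (a := a) i)
  exact Family.val_congr (A := X.obj (op Z)) _ ((cancel_mono _).1 hrr) _

lemma facesAgree_triangle {Z : C} (x₀ x₁ : ((joinPresheaf X a B).obj (op Z)) _⦋1⦌)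
    (h : ((joinPresheaf X a B).obj (op Z)).δ 0 x₁ = ((joinPresheaf X a B).obj (op Z)).δ 0 x₀) :
    FacesAgree (A := X.obj (op Z)) (B := B) (a := a) (n := 1) 2 ![x₀, x₁, x₁] := by
  refine facesAgree_of_δ _ fun i j hij hi hj => ?_
  obtain rfl : j = 0 := by
    by_contra hne
    obtain rfl : j = 1 := Fin.eq_one_of_ne_zero j hne
    exact hj rfl
  obtain rfl : i = 0 := le_antisymm hij (Fin.zero_le i)
  exact h

lemma facesAgree_inner_triangle {Z : C} (x₀ x₂ : ((joinPresheaf X a B).obj (op Z)) _⦋1⦌)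
    (h : ((joinPresheaf X a B).obj (op Z)).δ 0 x₂ = ((joinPresheaf X a B).obj (op Z)).δ 1 x₀) :
    FacesAgree (A := X.obj (op Z)) (B := B) (a := a) (n := 1) 1 ![x₀, x₀, x₂] := by
  refine facesAgree_of_δ _ fun i j hij hi hj => ?_
  obtain rfl : j = 1 := Fin.eq_one_of_ne_zero j fun h => hj (h ▸ rfl)
  obtain rfl : i = 0 := by
    by_contra hne
    obtain rfl : i = 1 := Fin.eq_one_of_ne_zero i hne
    exact hi rfl
  exact h

lemma facesAgree_tetrahedron {Z : C} (x₀ x₂ x₃ : ((joinPresheaf X a B).obj (op Z)) _⦋2⦌)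
    (h : ((joinPresheaf X a B).obj (op Z)).δ 0 x₂ = ((joinPresheaf X a B).obj (op Z)).δ 1 x₀ ∧
      ((joinPresheaf X a B).obj (op Z)).δ 0 x₃ = ((joinPresheaf X a B).obj (op Z)).δ 2 x₀ ∧
      ((joinPresheaf X a B).obj (op Z)).δ 2 x₃ = ((joinPresheaf X a B).obj (op Z)).δ 2 x₂) :
    FacesAgree (A := X.obj (op Z)) (B := B) (a := a) (n := 2) 1 ![x₀, x₀, x₂, x₃] := by
  refine facesAgree_of_δ _ fun i j hij hi hj => ?_
  have hj' : j = 1 ∨ j = 2 := by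
    have h₀ : ∀ j : Fin 3, j ≠ 0 → j = 1 ∨ j = 2 := by decide
    exact h₀ j fun h => hj (h ▸ rfl)
  have hi' : i = 0 ∨ i = 2 := by
    have h₀ : ∀ i : Fin 3, i ≠ 1 → i = 0 ∨ i = 2 := by decide
    exact h₀ i fun h => hi (h ▸ rfl)
  rcases hj' with rfl | rfl <;> rcases hi' with rfl | rfl
  · exact h.1
  · exact absurd hij (by decide)
  · exact h.2.1
  · exact h.2.2

end Lifting

/-! ### Lifting and filling properties of joins -/

section JoinLifting

variable {C : Type u} [Category.{v} C] {Q : MorphismProperty C}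
  {X : Cᵒᵖ ⥤ ColoredSimplexᵒᵖ ⥤ Type v} {t a : ℕ} {B B' : LowerSet (Finset (Fin t))}

/-- The lower set `⊥` lacks even the empty set, so its join with `[n]` is the empty sieve. Filling a
horn is thus the special case `B' = ⊥` of lifting. -/
lemma subsingleton_joinPresheaf_bot (Z : C) (n : ℕ) :
    Subsingleton (((joinPresheaf X (t := t) a ⊥).obj (op Z)) _⦋n⦌) :=
  ⟨fun _ _ => Family.ext (funext fun _ => funext fun _ => funext fun hs =>
    (LowerSet.notMem_bot hs).elim)⟩

lemma nonempty_joinPresheaf_bot (Z : C) (n : ℕ) :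
    Nonempty (((joinPresheaf X (t := t) a ⊥).obj (op Z)) _⦋n⦌) :=
  ⟨(⟨fun _ hs => (LowerSet.notMem_bot hs).elim, fun _ _ hs => (LowerSet.notMem_bot hs).elim⟩ :
    Family (X.obj (op Z)) (sieve (joinSet a ⦋n⦌ ⊥)))⟩

lemma liftsEdge_joinRestrict (hQ : IsSingletonPretopology Q) (hX : HasHornCoverings Q X 0)
    (hB : B' ≤ B) (h₀ : ∅ ∈ B) :
    LiftsEdge Q (joinRestrict X a hB) := by
  intro Z P w x₀ y hxy s hs hs'
  have hcov := isCovering_joinHorn (a := a) hQ hX ⦋0 + 1⦌ B B' h₀ 1 (by decide)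
    fun _ _ _ => Nat.zero_le _
  have hi' : ∀ i : Fin 2, i ≠ 1 → i = 0 := by decide
  obtain ⟨Z', u, w', s', hu, hw, h₁, h₂, h₃⟩ := joinPresheaf_lift hB hcov w ![x₀, x₀] y
    (facesAgree_edge _) (fun i hi => by
      obtain rfl := hi' i hi
      exact hxy) s (fun i hi => by
      obtain rfl := hi' i hi
      exact hs) hs'
  exact ⟨Z', u, w', s', hu, hw, h₁ 0 (by decide), h₂, h₃⟩

lemma liftsTriangle_joinRestrict (hQ : IsSingletonPretopology Q) (hX : HasHornCoverings Q X 0)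
    (hB : B' ≤ B) (h₀ : ∅ ∈ B) :
    LiftsTriangle Q (joinRestrict X a hB) := by
  intro Z P w x₀ x₁ y hx hxy₀ hxy₁ s hs₀ hs₁ hs'
  have hcov := isCovering_joinHorn (a := a) hQ hX ⦋1 + 1⦌ B B' h₀ 2 (by decide)
    fun _ _ _ => Nat.zero_le _
  have hi' : ∀ i : Fin 3, i ≠ 2 → i = 0 ∨ i = 1 := by decide
  obtain ⟨Z', u, w', s', hu, hw, h₁, h₂, h₃⟩ := joinPresheaf_lift hB hcov w ![x₀, x₁, x₁] y
    (facesAgree_triangle _ _ hx) (fun i hi => by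
      rcases hi' i hi with rfl | rfl
      · exact hxy₀
      · exact hxy₁) s (fun i hi => by
      rcases hi' i hi with rfl | rfl
      · exact hs₀
      · exact hs₁) hs'
  exact ⟨Z', u, w', s', hu, hw, h₁ 0 (by decide), h₁ 1 (by decide), h₂, h₃⟩

lemma fillsTriangle_joinPresheaf (hQ : IsSingletonPretopology Q) (hX : HasHornCoverings Q X 0)
    (h₀ : ∅ ∈ B) :
    FillsTriangle Q (joinPresheaf X a B) := by
  intro Z P w x₀ x₁ hx s hs₀ hs₁
  have := fun Z n => subsingleton_joinPresheaf_bot (X := X) (t := t) (a := a) Z n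
  obtain ⟨y⟩ := nonempty_joinPresheaf_bot (X := X) (t := t) (a := a) Z 2
  obtain ⟨Z', u, w', s', hu, hw, h₁, h₂, -, h₃⟩ := liftsTriangle_joinRestrict (a := a) hQ hX
    (bot_le : (⊥ : LowerSet (Finset (Fin t))) ≤ B) h₀ w x₀ x₁ y hx (Subsingleton.elim _ _)
    (Subsingleton.elim _ _) s hs₀ hs₁ (Subsingleton.elim _ _)
  exact ⟨Z', u, w', s', hu, hw, h₁, h₂, h₃⟩

lemma fillsTetrahedron_joinPresheaf (hQ : IsSingletonPretopology Q) (hX : HasHornCoverings Q X 0)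
    (h₀ : ∅ ∈ B) :
    FillsTetrahedron Q (joinPresheaf X a B) := by
  intro Z P w x₀ x₂ x₃ hx s hs₀ hs₂ hs₃
  have := fun Z n => subsingleton_joinPresheaf_bot (X := X) (t := t) (a := a) Z n
  obtain ⟨y⟩ := nonempty_joinPresheaf_bot (X := X) (t := t) (a := a) Z 3
  have hcov := isCovering_joinHorn (a := a) hQ hX ⦋2 + 1⦌ B ⊥ h₀ 1 (by decide)
    fun _ _ _ => Nat.zero_le _
  have hi' : ∀ i : Fin 4, i ≠ 1 → i = 0 ∨ i = 2 ∨ i = 3 := by decide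
  obtain ⟨Z', u, w', s', hu, hw, h₁, h₂, h₃⟩ := joinPresheaf_lift bot_le hcov w
    ![x₀, x₀, x₂, x₃] y (facesAgree_tetrahedron _ _ _ hx) (fun i hi => Subsingleton.elim _ _)
    s (fun i hi => by
      rcases hi' i hi with rfl | rfl | rfl
      · exact hs₀
      · exact hs₂
      · exact hs₃) (Subsingleton.elim _ _)
  exact ⟨Z', u, w', s', hu, hw, h₁ 0 (by decide), h₁ 2 (by decide), h₁ 3 (by decide), h₃⟩

/-- Covers of `P` split, so the universal filler can be pulled back to `P` itself. -/
lemma fillsTriangleAt_joinPresheaf (hQ : IsSingletonPretopology Q) (hX : HasHornCoverings Q X 0)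
    (h₀ : ∅ ∈ B) {P : C}
    (hP : IsProjectiveFor Q P) : FillsTriangleAt (joinPresheaf X a B) P := by
  intro x₀ x₁ hx
  have := fun Z n => subsingleton_joinPresheaf_bot (X := X) (t := t) (a := a) Z n
  obtain ⟨y⟩ := nonempty_joinPresheaf_bot (X := X) (t := t) (a := a) P 2
  have hcov := isCovering_joinHorn (a := a) hQ hX ⦋1 + 1⦌ B ⊥ h₀ 2 (by decide)
    fun _ _ _ => Nat.zero_le _
  obtain ⟨s, hs, -⟩ := joinPresheaf_lift_of_surjective bot_le (fun z => hcov.surjective_app hP z)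
    ![x₀, x₁, x₁] y (facesAgree_triangle _ _ hx) (fun i hi => Subsingleton.elim _ _)
  exact ⟨s, hs 0 (by decide), hs 1 (by decide)⟩

lemma fillsTetrahedronAt_joinPresheaf (hQ : IsSingletonPretopology Q)
    (hX : HasHornCoverings Q X 0) (h₀ : ∅ ∈ B) {P : C}
    (hP : IsProjectiveFor Q P) : FillsTetrahedronAt (joinPresheaf X a B) P := by
  intro x₀ x₂ x₃ hx
  have := fun Z n => subsingleton_joinPresheaf_bot (X := X) (t := t) (a := a) Z n
  obtain ⟨y⟩ := nonempty_joinPresheaf_bot (X := X) (t := t) (a := a) P 3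
  have hcov := isCovering_joinHorn (a := a) hQ hX ⦋2 + 1⦌ B ⊥ h₀ 1 (by decide)
    fun _ _ _ => Nat.zero_le _
  obtain ⟨s, hs, -⟩ := joinPresheaf_lift_of_surjective bot_le (fun z => hcov.surjective_app hP z)
    ![x₀, x₀, x₂, x₃] y (facesAgree_tetrahedron _ _ _ hx) (fun i hi => Subsingleton.elim _ _)
  exact ⟨s, hs 0 (by decide), hs 2 (by decide), hs 3 (by decide)⟩

end JoinLifting

end HigherGpd

namespace HigherGpd

open ColoredSimplex

/-! ### Recognizing covers by local sections -/

section Detection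

variable {C : Type u} [Category.{v} C] {Q : MorphismProperty C}

/-- A morphism is a cover as soon as each partial section, defined over a projective object,
extends to a section over a cover of the target. -/
def DetectsCovers (Q : MorphismProperty C) : Prop :=
  ∀ {A B : C} (g : A ⟶ B), (∀ P : C, IsProjectiveFor Q P → ∀ (w : P ⟶ B) (a : P ⟶ A), a ≫ g = w →
    ∃ (Z : C) (u : Z ⟶ B) (w' : P ⟶ Z) (x : Z ⟶ A), Q u ∧ w' ≫ u = w ∧ x ≫ g = u ∧
      w' ≫ x = a) → Q g

/-- Lifts of the universal element of `G` over covers are, by Yoneda, local sections of the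
representing morphism, and the element over `P` is the partial section to be extended. -/
lemma representedBy_of_lifts (hQ : DetectsCovers Q) {F G : Cᵒᵖ ⥤ Type v} {φ : F ⟶ G}
    (hF : IsRep F) (hG : IsRep G)
    (h : ∀ P Z : C, IsProjectiveFor Q P → ∀ (w : P ⟶ Z) (y : G.obj (op Z)) (x₀ : F.obj (op P)),
      φ.app _ x₀ = G.map w.op y → ∃ (Z' : C) (u : Z' ⟶ Z) (w' : P ⟶ Z') (x : F.obj (op Z')),
        Q u ∧ w' ≫ u = w ∧ φ.app _ x = G.map u.op y ∧ F.map w'.op x = x₀) :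
    RepresentedBy Q φ := by
  obtain ⟨A, ⟨a⟩⟩ := hF
  obtain ⟨B, ⟨b⟩⟩ := hG
  obtain ⟨g, hg⟩ := yoneda.map_surjective (a.hom ≫ φ ≫ b.inv)
  have hg' : a.hom ≫ φ = yoneda.map g ≫ b.hom := by rw [hg]; simp
  have hg'' : ∀ (T : C) (s : T ⟶ A), φ.app _ (a.hom.app (op T) s) = b.hom.app (op T) (s ≫ g) :=
    fun T s => ConcreteCategory.congr_hom (NatTrans.congr_app hg' (op T)) s
  have ha : ∀ {T T' : C} (s : T ⟶ A) (r : T' ⟶ T),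
      F.map r.op (a.hom.app (op T) s) = a.hom.app (op T') (r ≫ s) :=
    fun s r => (naturality_app a.hom r.op s).symm
  have hb : ∀ {T T' : C} (s : T ⟶ B) (r : T' ⟶ T),
      G.map r.op (b.hom.app (op T) s) = b.hom.app (op T') (r ≫ s) :=
    fun s r => (naturality_app b.hom r.op s).symm
  have ha' : ∀ (T : C) (s s' : T ⟶ A), a.hom.app (op T) s = a.hom.app (op T) s' → s = s' :=
    fun T s s' hs => by simpa using congrArg (a.inv.app (op T)) hs
  have hb' : ∀ (T : C) (s s' : T ⟶ B), b.hom.app (op T) s = b.hom.app (op T) s' → s = s' :=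
    fun T s s' hs => by simpa using congrArg (b.inv.app (op T)) hs
  refine ⟨A, B, a, b, g, hQ g fun P hP w p hp => ?_, hg'⟩
  obtain ⟨Z', u, w', x, hu, hw, h₁, h₂⟩ := h P B hP w (b.hom.app _ (𝟙 B)) (a.hom.app _ p) (by
    rw [hg'', hb, hp, Category.comp_id])
  obtain ⟨x, rfl⟩ : ∃ x', a.hom.app _ x' = x := ⟨a.inv.app _ x, by simp⟩
  refine ⟨Z', u, w', x, hu, hw, ?_, ?_⟩
  · rw [hg'', hb, Category.comp_id] at h₁
    exact hb' _ _ _ h₁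
  · rw [ha] at h₂
    exact ha' _ _ _ h₂

end Detection

/-! ### Outer horns -/

lemma exists_eq_colorMap {m : ℕ} (f : (⦋m⦌ : SimplexCategory) ⟶ ⦋1⦌) :
    ∃ i ≤ m + 1, f = colorMap m i := by
  classical
  have hf : Monotone f.toOrderHom := f.toOrderHom.monotone
  have h01 : ∀ c : Fin 2, c ≠ 0 → c = 1 := by decide
  by_cases h : ∃ k : ℕ, ∃ hk : k < m + 1, f.toOrderHom ⟨k, hk⟩ ≠ 0
  · refine ⟨Nat.find h, (Nat.find_spec h).1.le, ?_⟩
    ext k : 3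
    change f.toOrderHom k = if k.val < Nat.find h then 0 else 1
    split_ifs with hk
    · by_contra hne
      exact Nat.find_min h hk ⟨k.isLt, hne⟩
    · obtain ⟨hl, hne⟩ := Nat.find_spec h
      refine h01 _ fun h0 => hne ?_
      exact le_antisymm ((hf (show ⟨_, hl⟩ ≤ k from not_lt.1 hk)).trans h0.le) (Fin.zero_le _)
  · push Not at h
    refine ⟨m + 1, le_rfl, ?_⟩
    ext k : 3
    change f.toOrderHom k = if k.val < m + 1 then 0 else 1
    rw [if_pos k.isLt]
    exact h k.val k.isLt

lemma exists_eq_joinObj (d : ColoredSimplex) (hd : ∃ b : d.Vertex, b ≠ 0 ∧ d.color b = 0)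
    (hc : ¬ ∀ b, d.color b = 0) : ∃ t a, 0 < t ∧ d = joinObj t a ⦋1⦌ := by
  obtain ⟨i, hi, hdi⟩ := exists_eq_colorMap d.hom
  obtain ⟨b, hb, hb'⟩ := hd
  have hcol : ∀ b : d.Vertex, d.color b = if b.val < i then 0 else 1 := fun b =>
    congrArg (fun f : d.left ⟶ ⦋1⦌ => f.toOrderHom b) hdi
  have hbi : b.val < i := by
    by_contra h
    rw [hcol, if_neg h] at hb'
    exact absurd hb' (by decide)
  have hb0 := Fin.val_ne_zero_iff.2 hb
  obtain ⟨c, hc⟩ := not_forall.1 hc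
  have hci : ¬ c.val < i := fun h => hc (by rw [hcol, if_pos h])
  have hcl := c.isLt
  -- Two of the `d.left.len + 1` vertices, both among the `i` vertices of color `0`, form the factor
  -- `[1]`.
  refine ⟨d.left.len - 1, i - 2, by omega, ?_⟩
  have e₁ : d = Over.mk (colorMap d.left.len i) := by
    rw [← hdi]
    rfl
  rw [e₁]
  change Over.mk _ = Over.mk (colorMap (1 + (d.left.len - 1)) (1 + 1 + (i - 2)))
  rw [show 1 + 1 + (i - 2) = i by omega]
  generalize hl : d.left.len = l
  obtain ⟨l, rfl⟩ : ∃ l', l = 1 + l' := ⟨l - 1, by omega⟩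
  rw [Nat.add_sub_cancel_left]

section OuterHorn

variable {C : Type u} [Category.{v} C] {Q : MorphismProperty C}
  {X : Cᵒᵖ ⥤ ColoredSimplexᵒᵖ ⥤ Type v} {t a : ℕ}

variable (t) in
/-- The proper subsets. -/
def properSubsets : LowerSet (Finset (Fin t)) where
  carrier := {S | ∃ j, j ∉ S}
  lower' _ _ h hS := hS.imp fun _ hj hj' => hj (h hj')

lemma outerHorn_le : sieve (hornSet (joinHead t a ⦋1⦌ 0)) ≤
    sieve (joinSet a ⦋1⦌ (⊤ : LowerSet (Finset (Fin t)))) := fun _ _ _ => trivial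

lemma joinSet_properSubsets_le :
    sieve (joinSet a ⦋1⦌ (properSubsets t)) ≤ sieve (hornSet (joinHead t a ⦋1⦌ 0)) := by
  rintro c s ⟨j, hj⟩
  exact ⟨joinTail t a ⦋1⦌ j, (joinHead_lt_joinTail _ _).ne', fun h => hj (mem_tailSet.2 h)⟩

lemma sourceFace_le_horn : sieve (joinSet a ⦋0⦌ (⊤ : LowerSet (Finset (Fin t)))) ≤
    (sieve (hornSet (joinHead t a ⦋1⦌ 0))).pullback
      (joinMap t a (SimplexCategory.δ (1 : Fin 2))) := by
  intro c s _
  exact ⟨joinHead t a ⦋1⦌ 1, fun h => absurd (joinHead_injective h) (by decide),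
    head_notMem_supp_joinMap_δ 1 s⟩

/-- The horn at vertex 0 is the union of the join of `[1]` with the boundary of the second factor
and the face opposite to vertex 1. -/
lemma outerHorn_ext {A : ColoredSimplexᵒᵖ ⥤ Type v}
    {y y' : Family A (sieve (hornSet (joinHead t a ⦋1⦌ 0)))}
    (h : y.res (𝟙 _) (Sieve_le_pullback_id joinSet_properSubsets_le) =
      y'.res (𝟙 _) (Sieve_le_pullback_id joinSet_properSubsets_le))
    (h' : y.res (joinMap t a (SimplexCategory.δ (1 : Fin 2))) sourceFace_le_horn =
      y'.res (joinMap t a (SimplexCategory.δ (1 : Fin 2))) sourceFace_le_horn) : y = y' := by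
  ext c s hs
  obtain ⟨j, hj, hjs⟩ := hs
  rcases join_cases j with ⟨i, rfl⟩ | ⟨i, rfl⟩
  · obtain rfl : i = 1 := Fin.eq_one_of_ne_zero i fun hi => hj (hi ▸ rfl)
    obtain ⟨r, rfl⟩ := exists_factor_joinMap_δ _ hjs
    exact congrArg (fun z : Family A (sieve (joinSet a ⦋0⦌ ⊤)) => z.val r trivial) h'
  · have hs' : sieve (joinSet a ⦋1⦌ (properSubsets t)) s := ⟨i, fun h => hjs (mem_tailSet.1 h)⟩
    exact (y.val_congr (Category.comp_id s).symm _).trans ((congrArg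
      (fun z : Family A (sieve (joinSet a ⦋1⦌ (properSubsets t))) => z.val s hs') h).trans
        (y'.val_congr (Category.comp_id s) _))

/-- Families on the outer horn are pairs of an edge in the join with the boundary and a lifting of
its source. -/
lemma outerHorn_eq_iff {Z T : C}
    (y : (families X (sieve (hornSet (joinHead t a ⦋1⦌ 0)))).obj (op Z)) (g : T ⟶ Z)
    (s : ((joinPresheaf X a (⊤ : LowerSet (Finset (Fin t)))).obj (op T)) _⦋1⦌) :
    (familiesRestrict X outerHorn_le).app (op T) s = (families X _).map g.op y ↔
      mapSimplex (joinRestrict X a (le_top : properSubsets t ≤ ⊤)) s =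
        pull (joinPresheaf X a (properSubsets t)) (n := 1) g
          ((familiesRestrict X joinSet_properSubsets_le).app _ y) ∧
      ((joinPresheaf X a (⊤ : LowerSet (Finset (Fin t)))).obj (op T)).δ 1 s =
        pull (joinPresheaf X a (⊤ : LowerSet (Finset (Fin t)))) (n := 0) g
          ((familiesRes X _ sourceFace_le_horn).app _ y) := by
  have e₁ : (Family.res (𝟙 _) (Sieve_le_pullback_id joinSet_properSubsets_le)
      (((familiesRestrict X outerHorn_le).app (op T) s :) : Family (X.obj (op T)) _)) =
        mapSimplex (joinRestrict X a (le_top : properSubsets t ≤ ⊤)) s :=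
    Family.res_res (A := X.obj (op T)) _ _ _ (Category.comp_id _) _ _ _ s
  have e₂ : (Family.res (joinMap t a (SimplexCategory.δ (1 : Fin 2))) sourceFace_le_horn
      (((familiesRestrict X outerHorn_le).app (op T) s :) : Family (X.obj (op T)) _)) =
        ((joinPresheaf X a (⊤ : LowerSet (Finset (Fin t)))).obj (op T)).δ 1 s :=
    Family.res_res (A := X.obj (op T)) _ _ _ (Category.comp_id _) _ _ _ s
  constructor
  · intro h
    rw [← e₁, ← e₂, h]
    exact ⟨rfl, rfl⟩
  · rintro ⟨h₁, h₂⟩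
    exact outerHorn_ext (e₁.trans h₁) (e₂.trans h₂)

lemma outerHorn_compat {Z : C}
    (y : (families X (sieve (hornSet (joinHead t a ⦋1⦌ 0)))).obj (op Z)) :
    mapSimplex (joinRestrict X a (le_top : properSubsets t ≤ ⊤)) (n := 0)
      ((familiesRes X _ sourceFace_le_horn).app _ y) =
    ((joinPresheaf X a (properSubsets t)).obj (op Z)).δ 1
      ((familiesRestrict X joinSet_properSubsets_le).app _ y) := by
  have hle : sieve (joinSet a ⦋0⦌ (properSubsets t)) ≤
      (sieve (hornSet (joinHead t a ⦋1⦌ 0))).pullback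
        (joinMap t a (SimplexCategory.δ (1 : Fin 2))) := fun c s _ => sourceFace_le_horn s trivial
  exact (Family.res_res (A := X.obj (op Z)) _ _ _ (Category.id_comp _) _ _ hle y).trans
    (Family.res_res (A := X.obj (op Z)) _ _ _ (Category.comp_id _) _ _ hle y).symm

lemma exists_lift_outerHorn (hQ : IsSingletonPretopology Q) (hX : HasHornCoverings Q X 0)
    (ht : 0 < t) {P Z : C} (hP : IsProjectiveFor Q P) (w : P ⟶ Z)
    (y : (families X (sieve (hornSet (joinHead t a ⦋1⦌ 0)))).obj (op Z))
    (x₀ : (families X (sieve (joinSet a ⦋1⦌ (⊤ : LowerSet (Finset (Fin t)))))).obj (op P))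
    (h : (familiesRestrict X outerHorn_le).app (op P) x₀ = (families X _).map w.op y) :
    ∃ (Z' : C) (u : Z' ⟶ Z) (w' : P ⟶ Z') (x : (families X _).obj (op Z')), Q u ∧ w' ≫ u = w ∧
      (familiesRestrict X outerHorn_le).app (op Z') x = (families X _).map u.op y ∧
      (families X _).map w'.op x = x₀ := by
  -- Since `0 < t`, the boundary of the second factor contains the empty set, so the join with the
  -- boundary contains the head simplex itself. This is needed for filling horns in the base.
  have h₀ : ∅ ∈ properSubsets t := ⟨⟨0, ht⟩, Finset.notMem_empty _⟩
  have h₁ : (∅ : Finset (Fin t)) ∈ (⊤ : LowerSet (Finset (Fin t))) := trivial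
  obtain ⟨hx₁, hx₂⟩ := (outerHorn_eq_iff y w x₀).1 h
  obtain ⟨Z', u, w', x, hu, hw, k₁, k₂, k₃⟩ := liftsFromSource hQ.comp
    (liftsEdge_joinRestrict hQ hX le_top h₁) (liftsTriangle_joinRestrict hQ hX le_top h₁)
    (fillsTriangle_joinPresheaf hQ hX h₀) (fillsTetrahedron_joinPresheaf hQ hX h₀)
    (fillsTriangleAt_joinPresheaf hQ hX h₁ hP) (fillsTetrahedronAt_joinPresheaf hQ hX h₁ hP)
    w _ _ x₀ (outerHorn_compat y) hx₁ hx₂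
  exact ⟨Z', u, w', x, hu, hw, (outerHorn_eq_iff y u x).2 ⟨k₂, k₁⟩, k₃⟩

lemma RepresentedBy.of_eq_top {d : ColoredSimplex} {S S' : Sieve d} {h : S' ≤ S}
    (hS : S = ⊤) (hr : RepresentedBy Q (familiesRestrict X h)) :
    RepresentedBy Q (familiesRestrict X (le_top : S' ≤ ⊤)) := by
  subst hS
  exact hr

/-- Let `F` be the face on vertex 0 and all vertices of color `1`. A face of the horn not contained
in `F` has a nonzero vertex of color `0`, and this remains so when vertex 0 is toggled. So
restriction from the horn to `F` is built from outer horns at vertex 0 of smaller dimension. It is a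
covering, and families on `F` are representable. -/
lemma isRep_outerHorn (hQ : IsSingletonPretopology Q)
    (hrep : ∀ d : ColoredSimplex, IsRep (families X (⊤ : Sieve d))) (d : ColoredSimplex)
    (hd : ∃ b : d.Vertex, b ≠ 0 ∧ d.color b = 0)
    (hlt : ∀ e : ColoredSimplex, e.left.len < d.left.len →
      (∃ b : e.Vertex, b ≠ 0 ∧ e.color b = 0) → HornCovering Q X e 0) :
    IsRep (families X (sieve (hornSet (0 : d.Vertex)))) := by
  classical
  let F : Finset d.Vertex := Finset.univ.filter fun b => b ≠ 0 → d.color b ≠ 0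
  have hF : ∀ b, b ∈ F ↔ (b ≠ 0 → d.color b ≠ 0) := fun b => by simp [F]
  have hle : LowerSet.Iic F ≤ hornSet (0 : d.Vertex) := by
    intro U hU
    obtain ⟨b, hb, hb'⟩ := hd
    exact ⟨b, hb, fun h => (hF b).1 (hU h) hb hb'⟩
  have hcov : IsCovering Q (familiesRestrict X (sieve_mono hle)) := by
    refine isCovering_of_toggle hQ _ 0 _ hle (Finset.empty_subset F) ?_ ?_
    · rintro U ⟨j, hj, hjU⟩ hU
      refine ⟨⟨j, hj, fun h => (Finset.mem_insert.1 h).elim hj hjU⟩, fun h => hU fun b hb => ?_⟩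
      by_cases hb0 : b = 0
      · exact (hF b).2 fun h => absurd hb0 h
      · exact h (Finset.mem_erase.2 ⟨hb0, hb⟩)
    · intro e ι k hι hL hK hk
      obtain ⟨b, hb, hbF⟩ := Finset.not_subset.1 hK
      rw [hF] at hbF
      push Not at hbF
      obtain ⟨b, rfl⟩ := mem_supp.1 hb
      obtain rfl : k = 0 := by
        refine hι (le_antisymm ?_ ((vmap ι).monotone (Fin.zero_le k)))
        rw [hk]
        exact Fin.zero_le _
      refine hlt e ?_ ⟨b, fun h => hbF.1 (h ▸ hk), ?_⟩
      · obtain ⟨j, -, hj⟩ := hL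
        have h₁ : (supp ι).card = e.left.len + 1 := by
          rw [supp, Finset.card_image_of_injective _ hι, Finset.card_univ, Fintype.card_fin]
        have h₂ : (supp ι).card < (Finset.univ : Finset d.Vertex).card :=
          Finset.card_lt_card ⟨Finset.subset_univ _, fun h => hj (h (Finset.mem_univ j))⟩
        rw [Finset.card_univ, Fintype.card_fin, h₁] at h₂
        omega
      · rw [← color_vmap ι]
        exact hbF.2
  refine (hcov.representedBy ?_).isRep_source
  obtain ⟨e, ι, hι, hs, -⟩ := exists_face d F ⟨0, (hF 0).2 fun h => absurd rfl h⟩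
  have := mono_of_injective hι
  obtain ⟨i⟩ := families_iso_of_mono X ι (S := sieve (LowerSet.Iic F)) (by
    intro c s
    constructor
    · intro h
      exact exists_factor hι (hs.symm ▸ h)
    · rintro ⟨r, rfl⟩
      exact (supp_comp_subset r ι).trans hs.subset)
  exact (hrep e).of_iso i.symm

/-- Outer horns with at least two vertices of color `0`. -/
theorem representedBy_outerHorn (hQ : IsSingletonPretopology Q) (hQ' : DetectsCovers Q)
    (hrep : ∀ d : ColoredSimplex, IsRep (families X (⊤ : Sieve d)))
    (hX : HasHornCoverings Q X 0)
    (hE : ∀ d : ColoredSimplex, 0 < d.left.len → (∀ b, d.color b = 0) → HornCovering Q X d 0)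
    (d : ColoredSimplex) (hd : ∃ b : d.Vertex, b ≠ 0 ∧ d.color b = 0) :
    RepresentedBy Q (familiesRestrict X (le_top : sieve (hornSet (0 : d.Vertex)) ≤ ⊤)) := by
  obtain ⟨m, hm⟩ : ∃ m, d.left.len = m := ⟨_, rfl⟩
  induction m using Nat.strong_induction_on generalizing d with
  | _ m ih =>
  subst hm
  -- The induction on the dimension serves only to make the horn representable; the lifting argument
  -- itself does not use smaller outer horns.
  have hr := isRep_outerHorn hQ hrep d hd fun e he he' =>
    IsCovering.of_representedBy hQ (ih _ he e he' rfl)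
  -- In this case the simplex lies in an end, where all horns are covered by hypothesis. This also
  -- ensures below that the second factor of the join is nonempty.
  by_cases hc : ∀ b, d.color b = 0
  · refine IsCovering.representedBy (hE d ?_ hc) hr
    obtain ⟨b, hb, -⟩ := hd
    have h₁ := b.isLt
    have h₂ := Fin.val_ne_zero_iff.2 hb
    omega
  obtain ⟨t, a, ht, rfl⟩ := exists_eq_joinObj d hd hc
  refine RepresentedBy.of_eq_top (S := sieve (joinSet a ⦋1⦌ ⊤)) (h := outerHorn_le)
    (top_unique fun _ _ _ => trivial) ?_
  have hrep' : IsRep (families X (sieve (joinSet a ⦋1⦌ (⊤ : LowerSet (Finset (Fin t)))))) := by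
    rw [show sieve (joinSet a ⦋1⦌ (⊤ : LowerSet (Finset (Fin t)))) = ⊤ from
      top_unique fun _ _ _ => trivial]
    exact hrep _
  exact representedBy_of_lifts hQ' hrep' hr fun P Z hP w y x₀ h =>
    exists_lift_outerHorn hQ hX ht hP w y x₀ h

end OuterHorn

end HigherGpd

namespace HigherGpd

open ColoredSimplex

/-! ### Uniqueness of fillers of outer horns -/

section Uniqueness

variable {C : Type u} [Category.{v} C] {Q : MorphismProperty C}

lemma RepresentedBy.isomorphisms_of_injective {F G : Cᵒᵖ ⥤ Type v} {φ : F ⟶ G}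
    (hiso : ∀ {A B : C} (f : A ⟶ B), Q f → Mono f → IsIso f) (h : RepresentedBy Q φ)
    (hφ : ∀ Z : C, Function.Injective (φ.app (op Z))) :
    RepresentedBy (MorphismProperty.isomorphisms C) φ := by
  obtain ⟨A, B, a, b, f, hf, h⟩ := h
  have hf' : ∀ (T : C) (s : T ⟶ A), φ.app _ (a.hom.app (op T) s) = b.hom.app (op T) (s ≫ f) :=
    fun T s => ConcreteCategory.congr_hom (NatTrans.congr_app h (op T)) s
  refine ⟨A, B, a, b, f, hiso f hf ⟨fun {T} s s' hss => ?_⟩, h⟩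
  have e₁ : a.hom.app (op T) s = a.hom.app (op T) s' := hφ T (by rw [hf', hf', hss])
  simpa using congrArg (a.inv.app (op T)) e₁

lemma IsRep.map_injective {F : Cᵒᵖ ⥤ Type v} (hF : IsRep F) {Z Z' : C} (u : Z' ⟶ Z) [Epi u] :
    Function.Injective (F.map u.op) := by
  obtain ⟨A, ⟨a⟩⟩ := hF
  intro x y hxy
  have h₁ : u ≫ a.inv.app (op Z) x = u ≫ a.inv.app (op Z) y :=
    (naturality_app a.inv u.op x).symm.trans
      ((congrArg (a.inv.app (op Z')) hxy).trans (naturality_app a.inv u.op y))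
  simpa using congrArg (a.hom.app (op Z)) ((cancel_epi u).1 h₁)

variable {X : Cᵒᵖ ⥤ ColoredSimplexᵒᵖ ⥤ Type v} {t a : ℕ}

/-- Two fillers of the same horn are two lifts of one edge `f` with the same source. They agree
wherever `f` has a right inverse, which is the case over a cover, and hence they agree, since covers
are epimorphisms. -/
lemma outerHorn_injective (hQ : IsSingletonPretopology Q)
    (hepi : ∀ {A B : C} (f : A ⟶ B), Q f → Epi f)
    (hX : HasHornCoverings Q X 0) (hX' : HasHornCoverings (MorphismProperty.isomorphisms C) X 3)
    (ht : 2 ≤ t) (hrep : IsRep (families X (sieve (joinSet a ⦋1⦌ (⊤ : LowerSet (Finset (Fin t)))))))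
    (Z : C) : Function.Injective
      ((familiesRestrict X (outerHorn_le (t := t) (a := a))).app (op Z)) := by
  have h₀ : ∅ ∈ properSubsets t := ⟨⟨0, by omega⟩, Finset.notMem_empty _⟩
  have h₁ : (∅ : Finset (Fin t)) ∈ (⊤ : LowerSet (Finset (Fin t))) := trivial
  have hcard : ∀ S : Finset (Fin t), S ∉ properSubsets t → S.card = t := by
    intro S hS
    have : S = Finset.univ := by
      ext j
      refine iff_of_true ?_ (Finset.mem_univ j)
      by_contra h
      exact hS ⟨j, h⟩
    rw [this, Finset.card_univ, Fintype.card_fin]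
  intro (e : ((joinPresheaf X a (⊤ : LowerSet (Finset (Fin t)))).obj (op Z)) _⦋1⦌)
    (e' : ((joinPresheaf X a (⊤ : LowerSet (Finset (Fin t)))).obj (op Z)) _⦋1⦌) hee
  obtain ⟨k₁, k₂⟩ := (outerHorn_eq_iff _ (𝟙 Z) e).1 (by simpa using hee)
  obtain ⟨k₁', k₂'⟩ := (outerHorn_eq_iff
      ((familiesRestrict X (outerHorn_le (t := t) (a := a))).app (op Z) e') (𝟙 Z) e').1
      (by simp)
  let q := joinRestrict X a (le_top : properSubsets t ≤ ⊤)
  have hq : mapSimplex q (n := 1) e = mapSimplex q (n := 1) e' := k₁.trans k₁'.symm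
  have hδ : ((joinPresheaf X a ⊤).obj (op Z)).δ (1 : Fin 2) e =
    ((joinPresheaf X a ⊤).obj (op Z)).δ (1 : Fin 2) e' := k₂.trans k₂'.symm
  clear k₁ k₂ k₁' k₂'
  let W := joinPresheaf X a (properSubsets t)
  let f : (W.obj (op Z)) _⦋1⦌ := mapSimplex q e
  have := fun Z n => subsingleton_joinPresheaf_bot (X := X) (t := t) (a := a) Z n
  obtain ⟨y⟩ := nonempty_joinPresheaf_bot (X := X) (t := t) (a := a) Z 2
  have hcov := isCovering_joinHorn (a := a) hQ hX ⦋1 + 1⦌ (properSubsets t) ⊥ h₀ 2 (by decide)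
    fun _ _ _ => Nat.zero_le _
  -- A filler of this horn Λ[2,2] exhibits a right inverse of `f`; it exists over a cover `u` of
  -- `Z`.
  obtain ⟨z, hz⟩ := joinPresheaf_horn bot_le ![f, (W.obj (op Z)).σ 0 ((W.obj (op Z)).δ 0 f),
    (W.obj (op Z)).σ 0 ((W.obj (op Z)).δ 0 f)] y (facesAgree_triangle _ _
      ((W.obj (op Z)).δ_comp_σ_self_apply (0 : Fin 1) _)) (fun i hi => Subsingleton.elim _ _)
  obtain ⟨Z', u, x, hu, hx, -⟩ := hcov Z z
  obtain ⟨hx', -⟩ := (hz Z' u x).1 hx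
  have hx₀ : (W.obj (op Z')).δ 0 x = pull W u f := hx' 0 (by decide)
  have hx₁ : (W.obj (op Z')).δ 1 x = pull W u ((W.obj (op Z)).σ 0 ((W.obj (op Z)).δ 0 f)) :=
    hx' 1 (by decide)
  have := hepi u hu
  refine hrep.map_injective u ?_
  change pull (joinPresheaf X a (⊤ : LowerSet (Finset (Fin t)))) (n := 1) u e =
    pull (joinPresheaf X a (⊤ : LowerSet (Finset (Fin t)))) (n := 1) u e'
  -- Only the full set of tail vertices lies outside the boundary. With `t ≥ 2` the horns of
  -- dimension `1 + t` here and `2 + t` in `c₂` are in the range of unique fillers.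
  have c₁ := isCovering_joinHorn (a := a) isSingletonPretopology_isomorphisms hX' ⦋0 + 1⦌ ⊤
    (properSubsets t) h₁ 1 (by decide) fun S _ hS => by
      rw [hcard S hS]; change 3 ≤ 1 + t; omega
  have c₂ := isCovering_joinHorn (a := a) isSingletonPretopology_isomorphisms hX' ⦋1 + 1⦌ ⊤
    (properSubsets t) h₁ 1 (by decide) fun S _ hS => by
      rw [hcard S hS]; change 3 ≤ 2 + t; omega
  have hi₁ : ∀ i : Fin 2, i ≠ 1 → i = 0 := by decide
  have hi₂ : ∀ i : Fin 3, i ≠ 1 → i = 0 ∨ i = 2 := by decide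
  refine lifts_eq_of_source_eq (q.app (op Z')) ?_ ?_ ?_ (pull W u f) x hx₀ ?_ _ _ ?_ ?_ ?_
  · intro x₀ y hxy
    obtain ⟨s, hs, hs'⟩ := joinPresheaf_lift_of_surjective le_top (c₁.bijective Z').2
      ![x₀, x₀] y (facesAgree_edge _) (fun i hi => by
        obtain rfl := hi₁ i hi
        exact hxy)
    exact ⟨s, hs 0 (by decide), hs'⟩
  · intro s s' h h'
    refine joinPresheaf_eq_of_injective le_top (c₁.bijective Z').1 s s' (fun i hi => ?_) h'
    obtain rfl := hi₁ i hi
    exact h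
  · intro x₀ x₂ y h hy₀ hy₂
    obtain ⟨s, hs, hs'⟩ := joinPresheaf_lift_of_surjective le_top (c₂.bijective Z').2
      ![x₀, x₀, x₂] y (facesAgree_inner_triangle _ _ h) (fun i hi => by
        rcases hi₂ i hi with rfl | rfl
        · exact hy₀
        · exact hy₂)
    exact ⟨s, hs 0 (by decide), hs 2 (by decide), hs'⟩
  · rw [hx₁, δ_pull, σ_pull]
  · exact mapSimplex_pull q u e
  · exact (mapSimplex_pull q u e').trans (congrArg (pull W u) hq.symm)
  · exact (δ_pull u 1 e).trans ((congrArg (pull _ u) hδ).trans (δ_pull u 1 e').symm)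

/-- Uniqueness of fillers of outer horns with at least two vertices of color `0`. -/
theorem representedBy_outerHorn_isomorphisms (hQ : IsSingletonPretopology Q)
    (hQ' : DetectsCovers Q) (hepi : ∀ {A B : C} (f : A ⟶ B), Q f → Epi f)
    (hiso : ∀ {A B : C} (f : A ⟶ B), Q f → Mono f → IsIso f)
    (hrep : ∀ d : ColoredSimplex, IsRep (families X (⊤ : Sieve d)))
    (hX : HasHornCoverings Q X 0) (hX' : HasHornCoverings (MorphismProperty.isomorphisms C) X 3)
    (hE : ∀ d : ColoredSimplex, 0 < d.left.len → (∀ b, d.color b = 0) → HornCovering Q X d 0)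
    (hE' : ∀ d : ColoredSimplex, 3 ≤ d.left.len → (∀ b, d.color b = 0) →
      HornCovering (MorphismProperty.isomorphisms C) X d 0)
    (d : ColoredSimplex) (hd : ∃ b : d.Vertex, b ≠ 0 ∧ d.color b = 0) (hd' : 3 ≤ d.left.len) :
    RepresentedBy (MorphismProperty.isomorphisms C)
      (familiesRestrict X (le_top : sieve (hornSet (0 : d.Vertex)) ≤ ⊤)) := by
  have h := representedBy_outerHorn hQ hQ' hrep hX hE d hd
  refine h.isomorphisms_of_injective hiso ?_
  by_cases hc : ∀ b, d.color b = 0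
  · exact fun Z => ((hE' d hd' hc).bijective Z).1
  obtain ⟨t, a, ht, rfl⟩ := exists_eq_joinObj d hd hc
  have htop : sieve (joinSet a ⦋1⦌ (⊤ : LowerSet (Finset (Fin t)))) = ⊤ :=
    top_unique fun _ _ _ => trivial
  have ht' : 2 ≤ t := by
    change 3 ≤ 1 + t at hd'
    omega
  have key : ∀ S : Sieve (joinObj t a ⦋1⦌), S = ⊤ →
      ∀ hS : sieve (hornSet (joinHead t a ⦋1⦌ 0)) ≤ S,
        (∀ Z, Function.Injective ((familiesRestrict X hS).app (op Z))) →
        ∀ Z, Function.Injective ((familiesRestrict X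
          (le_top : sieve (hornSet (joinHead t a ⦋1⦌ 0)) ≤ ⊤)).app (op Z)) := by
    rintro S rfl hS h
    exact h
  exact key _ htop outerHorn_le (outerHorn_injective hQ hepi hX hX' ht' (htop ▸ hrep _))

end Uniqueness

end HigherGpd

namespace HigherGpd

/-! ### Reversing the orientation -/

section Reindex

variable {D : Type} [Category.{0} D]

/-- The families on the preimage of a sieve under a functor. -/
def Family.reindex {A : Dᵒᵖ ⥤ Type v} (F : D ⥤ D) {d : D} {S : Sieve (F.obj d)} {S' : Sieve d}
    (h : ∀ {e : D} (s : e ⟶ d), S' s ↔ S (F.map s)) (x : Family A S) :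
    Family (F.op ⋙ A) S' where
  val s _ := x.val (F.map s) ((h s).1 ‹_›)
  val_comp t s hs := (x.val_congr (F.map_comp t s) _).trans (x.val_comp (F.map t) (F.map s) _)

/-- Up to isomorphism of its source, each simplex of `F.obj d` is the image of a simplex of `d`, so
values of a family can be transported along that isomorphism. -/
lemma Family.bijective_reindex {A : Dᵒᵖ ⥤ Type v} (F : D ⥤ D) [F.IsEquivalence] {d : D}
    {S : Sieve (F.obj d)} {S' : Sieve d} (h : ∀ {e : D} (s : e ⟶ d), S' s ↔ S (F.map s)) :
    Function.Bijective (Family.reindex (A := A) F h) := by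
  obtain ⟨o, i, -⟩ : ∃ (o : D → D) (_ : ∀ e, F.obj (o e) ≅ e), True :=
    ⟨F.objPreimage, F.objObjPreimageIso, trivial⟩
  obtain ⟨p, hp⟩ : ∃ p : ∀ {a b : D}, (F.obj a ⟶ F.obj b) → (a ⟶ b),
      ∀ {a b : D} (f : F.obj a ⟶ F.obj b), F.map (p f) = f := ⟨F.preimage, F.map_preimage⟩
  have h₂ : ∀ {e : D} (s : e ⟶ F.obj d), S s → S' (p ((i e).hom ≫ s)) := fun s hs => by
    rw [h, hp]
    exact S.downward_closed hs _
  constructor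
  · intro x y hxy
    ext e s hs
    have h₃ := congrArg (fun z : Family (F.op ⋙ A) S' => z.val _ (h₂ s hs)) hxy
    have h₄ : ∀ z : Family A S, z.val s hs = A.map (i e).inv.op
        ((Family.reindex F h z).val _ (h₂ s hs)) := by
      intro z
      refine Eq.trans ?_ (z.val_comp _ _ _)
      exact z.val_congr (by rw [hp]; simp) _
    rw [h₄, h₄]
    exact congrArg _ h₃
  · intro y
    refine ⟨⟨fun {e} s hs => A.map (i e).inv.op (y.val _ (h₂ s hs)), ?_⟩, ?_⟩
    · intro e e' t s hs
      have h₅ : y.val _ (h₂ (t ≫ s) (S.downward_closed hs t)) =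
          A.map (F.map (p ((i e').hom ≫ t ≫ (i e).inv))).op (y.val _ (h₂ s hs)) := by
        refine Eq.trans ?_ (y.val_comp _ _ (h₂ s hs))
        refine y.val_congr (F.map_injective ?_) _
        rw [F.map_comp, hp, hp, hp]
        simp
      rw [h₅, hp, map_op_comp A, map_op_comp A, Iso.inv_hom_id_assoc]
    · ext e s hs
      change A.map (i (F.obj e)).inv.op (y.val _ _) = y.val s hs
      have h₆ : y.val _ (h₂ (F.map s) ((h s).1 hs)) =
          A.map (F.map (p (i (F.obj e)).hom)).op (y.val s hs) := by
        refine Eq.trans ?_ (y.val_comp _ _ hs)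
        refine y.val_congr (F.map_injective ?_) _
        rw [hp, F.map_comp, hp]
      rw [h₆, hp, map_op_comp A]
      simp

variable {C : Type u} [Category.{v} C] (X : Cᵒᵖ ⥤ Dᵒᵖ ⥤ Type v)

/-- Reindexing of families along an equivalence. -/
noncomputable def familiesReindex (F : D ⥤ D) [F.IsEquivalence] {d : D} {S : Sieve (F.obj d)}
    {S' : Sieve d} (h : ∀ {e : D} (s : e ⟶ d), S' s ↔ S (F.map s)) :
    families X S ≅ families (X ⋙ (Functor.whiskeringLeft _ _ _).obj F.op) S' :=
  NatIso.ofComponents (fun Z => (Equiv.ofBijective _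
    (Family.bijective_reindex (A := X.obj Z) F h)).toIso) (fun g => by
      ext x
      rfl)

lemma familiesReindex_restrict (F : D ⥤ D) [F.IsEquivalence] {d : D} {S T : Sieve (F.obj d)}
    {S' T' : Sieve d} (h : ∀ {e : D} (s : e ⟶ d), S' s ↔ S (F.map s))
    (h' : ∀ {e : D} (s : e ⟶ d), T' s ↔ T (F.map s)) (hT : T ≤ S) (hT' : T' ≤ S') :
    familiesRestrict X hT ≫ (familiesReindex X F h').hom =
      (familiesReindex X F h).hom ≫
        familiesRestrict (X ⋙ (Functor.whiskeringLeft _ _ _).obj F.op) hT' := by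
  ext Z x
  refine Family.ext (funext fun e => funext fun s => funext fun hs => ?_)
  exact (x : Family (X.obj Z) S).val_congr (by simp) _

end Reindex

namespace ColoredSimplex

/-- The colored simplex with the reversed order of vertices. -/
def revObj (d : ColoredSimplex) : ColoredSimplex :=
  Over.mk (Y := d.left) (SimplexCategory.Hom.mk
    { toFun := fun b => Fin.rev (d.color b.rev)
      monotone' := fun _ _ h => Fin.rev_le_rev.2 (d.color_monotone (Fin.rev_le_rev.2 h)) })

lemma revObj_revObj (d : ColoredSimplex) : revObj (revObj d) = d := by
  have h : (revObj (revObj d)).hom = d.hom := by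
    ext b : 3
    change Fin.rev (Fin.rev (d.color b.rev.rev)) = _
    rw [Fin.rev_rev, Fin.rev_rev]
    rfl
  calc revObj (revObj d) = Over.mk (revObj (revObj d)).hom := rfl
    _ = Over.mk d.hom := congrArg _ h
    _ = d := rfl

/-- Reversing the order of vertices. -/
def rev : ColoredSimplex ⥤ ColoredSimplex where
  obj := revObj
  map {d e} s := homMk ⟨fun b => Fin.rev (vmap s (Fin.rev b)), fun _ _ h =>
      Fin.rev_le_rev.2 ((vmap s).monotone (Fin.rev_le_rev.2 h))⟩ fun b => by
    change Fin.rev (e.color (Fin.rev (Fin.rev (vmap s (Fin.rev b))))) = _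
    rw [Fin.rev_rev, color_vmap]
    rfl
  map_id d := hom_ext fun b => Fin.rev_rev b
  map_comp s t := hom_ext fun b => by
    change Fin.rev (vmap t (vmap s (Fin.rev b))) =
      Fin.rev (vmap t (Fin.rev (Fin.rev (vmap s (Fin.rev b)))))
    rw [Fin.rev_rev]

instance : rev.IsEquivalence where
  faithful := ⟨fun {d e s t} h => hom_ext fun b => by
    have := congrArg (fun r : rev.obj d ⟶ rev.obj e => vmap r (Fin.rev b : d.Vertex)) h
    change Fin.rev (vmap s (Fin.rev (Fin.rev b))) = Fin.rev (vmap t (Fin.rev (Fin.rev b))) at this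
    rw [Fin.rev_rev] at this
    exact Fin.rev_injective this⟩
  full := ⟨fun {d e} s => ⟨homMk ⟨fun b => Fin.rev (vmap s (Fin.rev b)), fun _ _ h =>
      Fin.rev_le_rev.2 ((vmap s).monotone (Fin.rev_le_rev.2 h))⟩ fun b => by
        have h₁ := color_vmap s (Fin.rev b)
        have h₂ : Fin.rev (e.color (Fin.rev (vmap s (Fin.rev b)))) =
          Fin.rev (d.color (Fin.rev (Fin.rev b))) := h₁
        rw [Fin.rev_rev] at h₂
        exact Fin.rev_injective h₂, hom_ext fun b => by
        change Fin.rev (Fin.rev (vmap s (Fin.rev (Fin.rev b)))) = vmap s b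
        rw [Fin.rev_rev, Fin.rev_rev]⟩⟩
  essSurj := ⟨fun d => ⟨revObj d, ⟨eqToIso (revObj_revObj d)⟩⟩⟩

/-- The vertex of the reversed simplex that corresponds to a vertex. -/
def revVertex {d : ColoredSimplex} (b : d.Vertex) : (rev.obj d).Vertex := Fin.rev b

lemma revVertex_surjective {d : ColoredSimplex} (b : (rev.obj d).Vertex) :
    ∃ b' : d.Vertex, revVertex b' = b := ⟨Fin.rev b, Fin.rev_rev b⟩

lemma color_revVertex {d : ColoredSimplex} (b : d.Vertex) :
    (rev.obj d).color (revVertex b) = Fin.rev (d.color b) :=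
  congrArg (fun c => Fin.rev (d.color c)) (Fin.rev_rev b)

lemma revVertex_zero {d : ColoredSimplex} : revVertex (0 : d.Vertex) = Fin.last _ := Fin.rev_zero _

lemma revVertex_injective {d : ColoredSimplex} :
    Function.Injective (revVertex : d.Vertex → (rev.obj d).Vertex) := Fin.rev_injective

lemma mem_supp_rev {d e : ColoredSimplex} (s : d ⟶ e) (b : e.Vertex) :
    revVertex b ∈ supp (rev.map s) ↔ b ∈ supp s := by
  rw [mem_supp, mem_supp]
  constructor
  · rintro ⟨a, ha⟩
    exact ⟨Fin.rev a, Fin.rev_injective ha⟩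
  · rintro ⟨a, rfl⟩
    refine ⟨Fin.rev a, ?_⟩
    change Fin.rev (vmap s (Fin.rev (Fin.rev a))) = _
    rw [Fin.rev_rev]
    rfl

lemma horn_rev {d : ColoredSimplex} (k : d.Vertex) {e : ColoredSimplex} (s : e ⟶ d) :
    sieve (hornSet k) s ↔ sieve (hornSet (revVertex k)) (rev.map s) := by
  constructor
  · rintro ⟨j, hj, hjs⟩
    exact ⟨revVertex j, fun h => hj (revVertex_injective h),
      fun h => hjs ((mem_supp_rev s j).1 h)⟩
  · rintro ⟨j, hj, hjs⟩
    obtain ⟨j, rfl⟩ := revVertex_surjective j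
    exact ⟨j, fun h => hj (h ▸ rfl), fun h => hjs ((mem_supp_rev s j).2 h)⟩

end ColoredSimplex

open ColoredSimplex

/-! ### Horns at the first and at the last vertex -/

section Reverse

variable {C : Type u} [Category.{v} C] {Q : MorphismProperty C}
  {X : Cᵒᵖ ⥤ ColoredSimplexᵒᵖ ⥤ Type v}

lemma comp_inv_eq_inv_comp {D : Type*} [Category* D] {A B A' B' : D} {f : A ⟶ B} {g : A' ⟶ B'}
    {i : A ≅ A'} {j : B ≅ B'} (h : f ≫ j.hom = i.hom ≫ g) : g ≫ j.inv = i.inv ≫ f := by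
  rw [Iso.comp_inv_eq, Category.assoc, h, Iso.inv_hom_id_assoc]

/-- The colored simplicial presheaf with the reversed orientation. -/
abbrev revPresheaf (X : Cᵒᵖ ⥤ ColoredSimplexᵒᵖ ⥤ Type v) : Cᵒᵖ ⥤ ColoredSimplexᵒᵖ ⥤ Type v :=
  X ⋙ (Functor.whiskeringLeft _ _ _).obj rev.op

lemma HornCovering.rev {d : ColoredSimplex} {k : d.Vertex}
    (h : HornCovering Q X (ColoredSimplex.rev.obj d) (revVertex k)) :
    HornCovering Q (revPresheaf X) d k := by
  refine IsCovering.of_iso h (familiesReindex X ColoredSimplex.rev fun _ => Iff.rfl).symm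
    (familiesReindex X ColoredSimplex.rev (horn_rev k)).symm ?_
  exact comp_inv_eq_inv_comp (familiesReindex_restrict X ColoredSimplex.rev (d := d) (S := ⊤)
    (S' := ⊤) (fun _ => Iff.rfl) (horn_rev k) le_top le_top)

lemma RepresentedBy.of_rev {d : ColoredSimplex} {k : d.Vertex}
    (h : RepresentedBy Q (familiesRestrict (revPresheaf X) (le_top : sieve (hornSet k) ≤ ⊤))) :
    RepresentedBy Q (familiesRestrict X
      (le_top : sieve (hornSet (revVertex k)) ≤ ⊤)) := by
  refine RepresentedBy.of_iso h (familiesReindex X ColoredSimplex.rev fun _ => Iff.rfl).symm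
    (familiesReindex X ColoredSimplex.rev (horn_rev k)).symm ?_
  exact comp_inv_eq_inv_comp (familiesReindex_restrict X ColoredSimplex.rev (d := d) (S := ⊤)
    (S' := ⊤) (fun _ => Iff.rfl) (horn_rev k) le_top le_top)

/-- Restrictions to inner horns, and to all horns in the two ends, are coverings in dimensions at
least `N`. -/
structure HasInnerAndEndCoverings (Q : MorphismProperty C)
    (X : Cᵒᵖ ⥤ ColoredSimplexᵒᵖ ⥤ Type v) (N : ℕ) : Prop where
  inner : ∀ (d : ColoredSimplex) (k : d.Vertex), N ≤ d.left.len → 0 < k → k < Fin.last _ →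
    HornCovering Q X d k
  ends : ∀ (d : ColoredSimplex) (k : d.Vertex) (c : Fin 2), N ≤ d.left.len → 0 < d.left.len →
    (∀ b, d.color b = c) → HornCovering Q X d k

lemma HasInnerAndEndCoverings.hasHornCoverings {N : ℕ} (h : HasInnerAndEndCoverings Q X N) :
    HasHornCoverings Q X N := by
  rintro d k hN hk (hk' | hd)
  · exact h.inner d k hN hk hk'
  · refine h.ends d k 0 hN ?_ hd
    have h₁ := k.isLt
    have h₂ := Fin.val_ne_zero_iff.2 hk.ne'
    omega

lemma HasInnerAndEndCoverings.rev {N : ℕ} (h : HasInnerAndEndCoverings Q X N) :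
    HasInnerAndEndCoverings Q (revPresheaf X) N where
  inner d k hN hk hk' := by
    refine HornCovering.rev (h.inner (ColoredSimplex.rev.obj d) (revVertex k) hN ?_ ?_)
    · have := Fin.rev_lt_rev.2 hk'
      rwa [Fin.rev_last] at this
    · have := Fin.rev_lt_rev.2 hk
      rwa [Fin.rev_zero] at this
  ends d k c hN h0 hd := by
    refine HornCovering.rev (h.ends (ColoredSimplex.rev.obj d) (revVertex k) (Fin.rev c) hN h0
      fun b => ?_)
    obtain ⟨b, rfl⟩ := revVertex_surjective b
    rw [color_revVertex, hd]

lemma isRep_revPresheaf (hrep : ∀ d : ColoredSimplex, IsRep (families X (⊤ : Sieve d)))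
    (d : ColoredSimplex) : IsRep (families (revPresheaf X) (⊤ : Sieve d)) :=
  (hrep (revObj d)).of_iso (familiesReindex X ColoredSimplex.rev fun _ => Iff.rfl)

theorem representedBy_horn_zero (hQ : IsSingletonPretopology Q) (hQ' : DetectsCovers Q)
    (hrep : ∀ d : ColoredSimplex, IsRep (families X (⊤ : Sieve d)))
    (hX : HasInnerAndEndCoverings Q X 0) (d : ColoredSimplex)
    (hd : ∃ b : d.Vertex, b ≠ 0 ∧ d.color b = 0) :
    RepresentedBy Q (familiesRestrict X (le_top : sieve (hornSet (0 : d.Vertex)) ≤ ⊤)) :=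
  representedBy_outerHorn hQ hQ' hrep hX.hasHornCoverings
    (fun d hd hc => hX.ends d 0 0 (Nat.zero_le _) hd hc) d hd

theorem representedBy_horn_zero_isomorphisms (hQ : IsSingletonPretopology Q)
    (hQ' : DetectsCovers Q) (hepi : ∀ {A B : C} (f : A ⟶ B), Q f → Epi f)
    (hiso : ∀ {A B : C} (f : A ⟶ B), Q f → Mono f → IsIso f)
    (hrep : ∀ d : ColoredSimplex, IsRep (families X (⊤ : Sieve d)))
    (hX : HasInnerAndEndCoverings Q X 0)
    (hX' : HasInnerAndEndCoverings (MorphismProperty.isomorphisms C) X 3) (d : ColoredSimplex)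
    (hd : ∃ b : d.Vertex, b ≠ 0 ∧ d.color b = 0) (hd' : 3 ≤ d.left.len) :
    RepresentedBy (MorphismProperty.isomorphisms C)
      (familiesRestrict X (le_top : sieve (hornSet (0 : d.Vertex)) ≤ ⊤)) :=
  representedBy_outerHorn_isomorphisms hQ hQ' hepi hiso hrep hX.hasHornCoverings
    hX'.hasHornCoverings (fun d hd hc => hX.ends d 0 0 (Nat.zero_le _) hd hc)
    (fun d hd hc => hX'.ends d 0 0 hd (by omega) hc) d hd hd'

/-- Reversal exchanges the two colors and takes the last vertex to the first. -/
lemma representedBy_horn_last_of_zero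
    {d : ColoredSimplex} (hd : ∃ b : d.Vertex, b ≠ Fin.last _ ∧ d.color b = 1)
    (h : ∀ e : ColoredSimplex, e.left.len = d.left.len →
      (∃ b : e.Vertex, b ≠ 0 ∧ e.color b = 0) → RepresentedBy Q
        (familiesRestrict (revPresheaf X) (le_top : sieve (hornSet (0 : e.Vertex)) ≤ ⊤))) :
    RepresentedBy Q
      (familiesRestrict X (le_top : sieve (hornSet (Fin.last _ : d.Vertex)) ≤ ⊤)) := by
  obtain ⟨d, rfl⟩ : ∃ e, d = rev.obj e := ⟨revObj d, (revObj_revObj d).symm⟩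
  rw [← revVertex_zero]
  obtain ⟨b, hb, hb'⟩ := hd
  obtain ⟨b, rfl⟩ := revVertex_surjective b
  refine (h d rfl ⟨b, fun h => hb (h ▸ revVertex_zero), ?_⟩).of_rev
  have : ∀ c : Fin 2, c.rev = 1 → c = 0 := by decide
  exact this _ ((color_revVertex b).symm.trans hb')

theorem representedBy_horn_last (hQ : IsSingletonPretopology Q) (hQ' : DetectsCovers Q)
    (hrep : ∀ d : ColoredSimplex, IsRep (families X (⊤ : Sieve d)))
    (hX : HasInnerAndEndCoverings Q X 0) (d : ColoredSimplex)
    (hd : ∃ b : d.Vertex, b ≠ Fin.last _ ∧ d.color b = 1) :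
    RepresentedBy Q
      (familiesRestrict X (le_top : sieve (hornSet (Fin.last _ : d.Vertex)) ≤ ⊤)) :=
  representedBy_horn_last_of_zero hd fun e _ he =>
    representedBy_horn_zero hQ hQ' (isRep_revPresheaf hrep) hX.rev e he

theorem representedBy_horn_last_isomorphisms (hQ : IsSingletonPretopology Q)
    (hQ' : DetectsCovers Q) (hepi : ∀ {A B : C} (f : A ⟶ B), Q f → Epi f)
    (hiso : ∀ {A B : C} (f : A ⟶ B), Q f → Mono f → IsIso f)
    (hrep : ∀ d : ColoredSimplex, IsRep (families X (⊤ : Sieve d)))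
    (hX : HasInnerAndEndCoverings Q X 0)
    (hX' : HasInnerAndEndCoverings (MorphismProperty.isomorphisms C) X 3) (d : ColoredSimplex)
    (hd : ∃ b : d.Vertex, b ≠ Fin.last _ ∧ d.color b = 1) (hd' : 3 ≤ d.left.len) :
    RepresentedBy (MorphismProperty.isomorphisms C)
      (familiesRestrict X (le_top : sieve (hornSet (Fin.last _ : d.Vertex)) ≤ ⊤)) :=
  representedBy_horn_last_of_zero hd fun e he' he =>
    representedBy_horn_zero_isomorphisms hQ hQ' hepi hiso (isRep_revPresheaf hrep) hX.rev hX'.rev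
      e he (he' ▸ hd')

end Reverse

end HigherGpd

namespace HigherGpd

open ColoredSimplex

/-! ### The colored simplices of a simplicial object over `j(Δ¹)` -/

section ColoredPoints

variable {C : Type u} [Category.{v} C] [HasTerminal C] [HasFiniteCoproducts C]

lemma comp_colorPoint {n : SimplexCategory} (f : n ⟶ ⦋1⦌) {Z W : C} (g : W ⟶ Z) :
    g ≫ colorPoint f Z = colorPoint f W :=
  (Category.assoc g (terminal.from Z)
    (Sigma.ι (fun _ : (op n).unop ⟶ ⦋1⦌ => ⊤_ C) f)).symm.trans
      (congrArg (· ≫ Sigma.ι (fun _ : (op n).unop ⟶ ⦋1⦌ => ⊤_ C) f) (terminal.hom_ext _ _))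

lemma colorPoint_map {n n' : SimplexCategory} (θ : n' ⟶ n) (f : n ⟶ ⦋1⦌) (Z : C) :
    colorPoint f Z ≫ (jInterval C).map θ.op = colorPoint (θ ≫ f) Z :=
  (Category.assoc (terminal.from Z) (Sigma.ι (fun _ : (op n).unop ⟶ ⦋1⦌ => ⊤_ C) f)
    ((jInterval C).map θ.op)).trans (congrArg (terminal.from Z ≫ ·) (Sigma.ι_desc _ _))

variable {Y : SimplicialObject C} (π : Y ⟶ jInterval C)

/-- The colored simplices of a simplicial object over `j(Δ¹)`. -/
noncomputable def coloredPoints : Cᵒᵖ ⥤ ColoredSimplexᵒᵖ ⥤ Type v where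
  obj Z :=
    { obj d := { y : Z.unop ⟶ Y.obj (op d.unop.left) //
        y ≫ π.app (op d.unop.left) = colorPoint (n := d.unop.left) d.unop.hom Z.unop }
      map {d e} s := ↾ fun y => ⟨y.1 ≫ Y.map s.unop.left.op, by
        have h := Over.w s.unop
        rw [Category.assoc, π.naturality, ← Category.assoc, y.2]
        refine (colorPoint_map s.unop.left _ _).trans ?_
        exact congrArg (fun f : e.unop.left ⟶ ⦋1⦌ => colorPoint f Z.unop) h⟩
      map_id d := by
        refine ConcreteCategory.hom_ext _ _ fun y => Subtype.ext ?_
        change y.1 ≫ Y.map (𝟙 (op d.unop.left)) = y.1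
        simp
      map_comp s t := by
        refine ConcreteCategory.hom_ext _ _ fun y => Subtype.ext ?_
        change y.1 ≫ Y.map (s.unop.left.op ≫ t.unop.left.op) =
          (y.1 ≫ Y.map s.unop.left.op) ≫ Y.map t.unop.left.op
        simp }
  map g :=
    { app d := ↾ fun y => ⟨g.unop ≫ y.1, by rw [Category.assoc, y.2, comp_colorPoint]⟩
      naturality d e s := by
        refine ConcreteCategory.hom_ext _ _ fun y => Subtype.ext ?_
        exact (Category.assoc _ _ _).symm }
  map_id Z := by
    refine NatTrans.ext (funext fun d => ConcreteCategory.hom_ext _ _ fun y => Subtype.ext ?_)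
    exact Category.id_comp y.1
  map_comp g h := by
    refine NatTrans.ext (funext fun d => ConcreteCategory.hom_ext _ _ fun y => Subtype.ext ?_)
    exact Category.assoc h.unop g.unop y.1

variable {π} {m : ℕ} {χ : (⦋m⦌ : SimplexCategory) ⟶ ⦋1⦌}

variable (χ) in
/-- A morphism of `Δ`, viewed as a morphism of colored simplices. -/
def colorLift {n : SimplexCategory} (θ : n ⟶ ⦋m⦌) :
    (Over.mk (θ ≫ χ) : ColoredSimplex) ⟶ Over.mk χ := Over.homMk θ

/-- The values of a family, without the condition on the colors. -/
def Family.value {Z : Cᵒᵖ} {S : Sieve (Over.mk χ : ColoredSimplex)}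
    (x : Family ((coloredPoints π).obj Z) S) {n : SimplexCategory} (θ : n ⟶ ⦋m⦌)
    (h : S (colorLift χ θ)) : Z.unop ⟶ Y.obj (op n) := (x.val (colorLift χ θ) h).1

lemma Family.value_comp_π {Z : Cᵒᵖ} {S : Sieve (Over.mk χ : ColoredSimplex)}
    (x : Family ((coloredPoints π).obj Z) S) {n : SimplexCategory} (θ : n ⟶ ⦋m⦌)
    (h : S (colorLift χ θ)) : x.value θ h ≫ π.app (op n) = colorPoint (θ ≫ χ) Z.unop :=
  (x.val (colorLift χ θ) h).2

lemma Family.value_comp {Z : Cᵒᵖ} {S : Sieve (Over.mk χ : ColoredSimplex)}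
    (x : Family ((coloredPoints π).obj Z) S) {n n' : SimplexCategory} (f : n' ⟶ n) (θ : n ⟶ ⦋m⦌)
    (h : S (colorLift χ θ)) (h' : S (colorLift χ (f ≫ θ))) :
    x.value (f ≫ θ) h' = x.value θ h ≫ Y.map f.op := by
  let t : (Over.mk ((f ≫ θ) ≫ χ) : ColoredSimplex) ⟶ Over.mk (θ ≫ χ) :=
    Over.homMk f (Category.assoc _ _ _).symm
  have ht : colorLift χ (f ≫ θ) = t ≫ colorLift χ θ := rfl
  exact congrArg Subtype.val ((x.val_congr ht h').trans (x.val_comp t (colorLift χ θ) h))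

/-- The coloring of `e` equals the one induced by `χ` only by the proposition `Over.w`. Families are
compared with diagrams through a morphism that is the identity on underlying simplices. -/
lemma exists_comp_colorLift {e : ColoredSimplex} (s : e ⟶ Over.mk χ) :
    ∃ t : e ⟶ Over.mk ((s.left : e.left ⟶ ⦋m⦌) ≫ χ),
      t.left = 𝟙 e.left ∧ t ≫ colorLift χ (n := e.left) s.left = s := by
  have hw : (s.left : e.left ⟶ ⦋m⦌) ≫ χ = e.hom := Over.w s
  exact ⟨Over.homMk (𝟙 e.left) ((Category.id_comp _).trans hw), rfl,
    Over.OverMorphism.ext (Category.id_comp _)⟩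

lemma sieve_iff_colorLift {S : Sieve (Over.mk χ : ColoredSimplex)} {e : ColoredSimplex}
    (s : e ⟶ Over.mk χ) : S s ↔ S (colorLift χ (n := e.left) s.left) := by
  have hw : (s.left : e.left ⟶ ⦋m⦌) ≫ χ = e.hom := Over.w s
  constructor
  · intro h
    let t : Over.mk ((s.left : e.left ⟶ ⦋m⦌) ≫ χ) ⟶ e :=
      Over.homMk (𝟙 e.left) ((Category.id_comp _).trans hw.symm)
    have ht : t ≫ s = colorLift χ (n := e.left) s.left :=
      Over.OverMorphism.ext (Category.id_comp _)
    exact ht ▸ S.downward_closed h t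
  · intro h
    obtain ⟨t, -, ht⟩ := exists_comp_colorLift s
    exact ht ▸ S.downward_closed h t

lemma Family.val_eq_value {Z : Cᵒᵖ} {S : Sieve (Over.mk χ : ColoredSimplex)}
    (x : Family ((coloredPoints π).obj Z) S) {e : ColoredSimplex} (s : e ⟶ Over.mk χ)
    (hs : S s) : (x.val s hs).1 = x.value (n := e.left) s.left ((sieve_iff_colorLift s).1 hs) := by
  obtain ⟨t, ht, hts⟩ := exists_comp_colorLift s
  have h := congrArg Subtype.val ((x.val_congr hts.symm hs).trans
    (x.val_comp t (colorLift χ (n := e.left) s.left) ((sieve_iff_colorLift s).1 hs)))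
  refine h.trans ((congrArg (fun f : e.left ⟶ e.left => x.value (n := e.left) s.left
    ((sieve_iff_colorLift s).1 hs) ≫ Y.map f.op) ht).trans ?_)
  exact (congrArg (_ ≫ ·) (Y.map_id _)).trans (Category.comp_id _)

/-- A sieve on a colored simplex corresponds to a subobject of the standard simplex. -/
structure IsRealizedBy (S : Sieve (Over.mk χ : ColoredSimplex)) {A : SSet.{v}}
    (a : A ⟶ Δ[m]) : Prop where
  injective : ∀ n, Function.Injective (a.app n)
  mem_iff : ∀ {n : SimplexCategory} (θ : n ⟶ ⦋m⦌), S (colorLift χ θ) ↔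
    ∃ z, a.app (op n) z = SSet.stdSimplex.objEquiv.symm θ

lemma IsRealizedBy.mem {S : Sieve (Over.mk χ : ColoredSimplex)} {A : SSet.{v}} {a : A ⟶ Δ[m]}
    (h : IsRealizedBy S a) {n : SimplexCategoryᵒᵖ} (z : A.obj n) :
    S (colorLift χ (n := n.unop) (SSet.stdSimplex.objEquiv (a.app n z))) :=
  (h.mem_iff _).2 ⟨z, (Equiv.symm_apply_apply _ _).symm⟩

lemma isRealizedBy_top : IsRealizedBy (⊤ : Sieve (Over.mk χ : ColoredSimplex))
    (𝟙 (Δ[m] : SSet.{v})) where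
  injective _ _ _ h := h
  mem_iff _ := iff_of_true trivial ⟨_, rfl⟩

lemma isRealizedBy_horn (k : Fin (m + 1)) :
    IsRealizedBy (sieve (hornSet (d := Over.mk χ) k)) (SSet.horn.{v} m k).ι where
  injective n x y h := Subtype.ext h
  mem_iff {n} θ := by
    constructor
    · rintro ⟨j, hj, hjs⟩
      refine ⟨⟨SSet.stdSimplex.objEquiv.symm θ, (SSet.mem_horn_iff k _).2 fun h => ?_⟩, rfl⟩
      rcases h.ge (Set.mem_univ j) with ⟨b, hb⟩ | h
      · exact hjs (mem_supp.2 ⟨b, hb⟩)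
      · exact hj h
    · rintro ⟨⟨z, hz⟩, hzθ⟩
      obtain rfl : z = SSet.stdSimplex.objEquiv.symm θ := hzθ
      obtain ⟨j, hj⟩ := (Set.ne_univ_iff_exists_notMem _).1 ((SSet.mem_horn_iff k _).1 hz)
      refine ⟨j, fun h => hj (Or.inr h), fun h => hj (Or.inl ?_)⟩
      obtain ⟨b, hb⟩ := mem_supp.1 h
      exact ⟨b, hb⟩

lemma colorPointMap_app (Z : Cᵒᵖ) {n : SimplexCategoryᵒᵖ} (z : (Δ[m] : SSet.{v}).obj n) :
    (colorPointMap χ Z).app n z =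
      colorPoint (n := n.unop) (SSet.stdSimplex.objEquiv z ≫ χ) Z.unop :=
  colorPoint_map (SSet.stdSimplex.objEquiv z) χ Z.unop

variable {S : Sieve (Over.mk χ : ColoredSimplex)} {A : SSet.{v}} {a : A ⟶ Δ[m]}

/-- The colored diagram that corresponds to a family. -/
def Family.toDiagram (h : IsRealizedBy S a) {Z : Cᵒᵖ}
    (x : Family ((coloredPoints π).obj Z) S) : (coloredDiagrams π χ a).obj Z :=
  ⟨{ app n := ↾ fun z => (x.value (n := n.unop) (SSet.stdSimplex.objEquiv (a.app n z)) (h.mem z) :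
        Z.unop ⟶ Y.obj n)
     naturality n n' f := by
      ext z
      have e : SSet.stdSimplex.objEquiv (a.app n' (A.map f z)) =
          f.unop ≫ SSet.stdSimplex.objEquiv (a.app n z) :=
        congrArg SSet.stdSimplex.objEquiv (ConcreteCategory.congr_hom (a.naturality f) z)
      have e' := x.value_comp f.unop (SSet.stdSimplex.objEquiv (a.app n z)) (h.mem z)
        (e ▸ h.mem (A.map f z))
      refine Eq.trans ?_ e'
      change x.value _ _ = x.value _ _
      congr 1 },
    by
      ext n z
      exact (x.value_comp_π _ (h.mem z)).trans (colorPointMap_app Z (a.app n z)).symm⟩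

lemma Family.toDiagram_injective (h : IsRealizedBy S a) (Z : Cᵒᵖ) :
    Function.Injective (Family.toDiagram (π := π) h (Z := Z)) := by
  intro x y hxy
  ext e s hs
  refine Subtype.ext ?_
  rw [x.val_eq_value, y.val_eq_value]
  obtain ⟨z, hz⟩ := (h.mem_iff (n := e.left) s.left).1 ((sieve_iff_colorLift s).1 hs)
  have hz' := (SSet.stdSimplex.objEquiv (n := ⦋m⦌)).eq_symm_apply.1 hz
  have := congrArg (fun σ : (coloredDiagrams π χ a).obj Z => σ.1.app (op e.left) z) hxy
  change x.value _ (h.mem z) = y.value _ (h.mem z) at this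
  have hx : ∀ x : Family ((coloredPoints π).obj Z) S,
      x.value (n := e.left) s.left ((sieve_iff_colorLift s).1 hs) = x.value _ (h.mem z) := by
    intro x
    congr 1
    exact hz'.symm
  rw [hx, hx, this]

lemma Family.toDiagram_surjective (h : IsRealizedBy S a) (Z : Cᵒᵖ) :
    Function.Surjective (Family.toDiagram (π := π) h (Z := Z)) := by
  rintro ⟨σ, hσ⟩
  have hmem : ∀ {e : ColoredSimplex} (s : e ⟶ Over.mk χ), S s →
      ∃ z, a.app (op e.left) z = SSet.stdSimplex.objEquiv.symm (s.left : e.left ⟶ ⦋m⦌) :=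
    fun s hs => (h.mem_iff _).1 ((sieve_iff_colorLift s).1 hs)
  choose z hz using @hmem
  have hcol : ∀ {e : ColoredSimplex} (s : e ⟶ Over.mk χ) (hs : S s),
      (σ.app (op e.left) (z s hs) : Z.unop ⟶ Y.obj (op e.left)) ≫ π.app (op e.left) =
        colorPoint (n := e.left) e.hom Z.unop := by
    intro e s hs
    have h₁ := ConcreteCategory.congr_hom (NatTrans.congr_app hσ (op e.left)) (z s hs)
    refine h₁.trans ((colorPointMap_app Z (a.app (op e.left) (z s hs))).trans ?_)
    rw [hz, Equiv.apply_symm_apply]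
    exact congrArg (fun f => colorPoint (n := e.left) f Z.unop) (Over.w s)
  refine ⟨⟨fun {e} s hs => ⟨σ.app (op e.left) (z s hs), hcol s hs⟩, ?_⟩, ?_⟩
  · intro e e' t s hs
    refine Subtype.ext ?_
    -- Since `a` is injective, chosen preimages are unique, and so the choices are compatible with
    -- restriction.
    have h₁ : z (t ≫ s) (S.downward_closed hs t) = A.map t.left.op (z s hs) := by
      refine h.injective _ ?_
      rw [hz]
      refine Eq.trans ?_ (ConcreteCategory.congr_hom (a.naturality t.left.op) (z s hs)).symm
      change _ = Δ[m].map t.left.op (a.app _ (z s hs))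
      rw [hz]
      rfl
    change σ.app (op e'.left) (z (t ≫ s) _) = _
    rw [h₁]
    exact ConcreteCategory.congr_hom (σ.naturality t.left.op) (z s hs)
  · refine Subtype.ext (NatTrans.ext (funext fun n => ConcreteCategory.hom_ext _ _ fun b => ?_))
    change σ.app n (z (colorLift χ (n := n.unop) _) (h.mem b)) = σ.app n b
    congr 1
    refine h.injective _ ?_
    exact (hz _ (h.mem b)).trans (Equiv.symm_apply_apply _ _)

/-- Families on a sieve and colored diagrams are the same. -/
noncomputable def familiesIsoDiagrams (h : IsRealizedBy S a) :
    families (coloredPoints π) S ≅ coloredDiagrams π χ a :=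
  NatIso.ofComponents (fun Z => (Equiv.ofBijective _
    ⟨Family.toDiagram_injective h Z, Family.toDiagram_surjective h Z⟩).toIso) (fun g => by
      refine ConcreteCategory.hom_ext _ _ fun x => ?_
      rfl)

lemma familiesIsoDiagrams_restrict (h : IsRealizedBy S a) :
    familiesRestrict (coloredPoints π) (le_top : S ≤ ⊤) ≫ (familiesIsoDiagrams h).hom =
      (familiesIsoDiagrams isRealizedBy_top).hom ≫ coloredRestrict π χ a := by
  refine NatTrans.ext (funext fun Z => ConcreteCategory.hom_ext _ _ fun x => ?_)
  refine Subtype.ext (NatTrans.ext (funext fun n => ConcreteCategory.hom_ext _ _ fun b => ?_))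
  have := (x : Family ((coloredPoints π).obj Z) ⊤).val_congr (Category.comp_id
    (colorLift χ (n := n.unop) (SSet.stdSimplex.objEquiv (a.app n b)))) trivial
  exact congrArg Subtype.val this

lemma HornCovering.of_coloredRestrict {P : MorphismProperty C} {k : Fin (m + 1)}
    (h : IsCovering P (coloredRestrict π χ (SSet.horn.{v} m k).ι)) :
    HornCovering P (coloredPoints π) (Over.mk χ) k :=
  h.of_iso (familiesIsoDiagrams isRealizedBy_top) (familiesIsoDiagrams (isRealizedBy_horn k))
    (familiesIsoDiagrams_restrict (isRealizedBy_horn k))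

lemma RepresentedBy.coloredRestrict {P : MorphismProperty C} {k : Fin (m + 1)}
    (h : RepresentedBy P (familiesRestrict (coloredPoints π)
      (le_top : sieve (hornSet (d := Over.mk χ) k) ≤ ⊤))) :
    RepresentedBy P (coloredRestrict π χ (SSet.horn.{v} m k).ι) :=
  h.of_iso (familiesIsoDiagrams isRealizedBy_top) (familiesIsoDiagrams (isRealizedBy_horn k))
    (familiesIsoDiagrams_restrict (isRealizedBy_horn k))

/-- A colored diagram on a simplicial subset, as a square. -/
noncomputable def coloredDiagramsToSquares (a : A ⟶ Δ[m]) :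
    coloredDiagrams π χ a ⟶ homSquares a π where
  app Z := ↾ fun σ => (Arrow.homMk σ.1 (colorPointMap χ Z) σ.2 :
    Arrow.mk a ⟶ Arrow.mk (((points C).map π).app Z))
  naturality Z W g := by
    refine ConcreteCategory.hom_ext _ _ fun σ => ?_
    refine Arrow.hom_ext _ _ ?_ ?_
    · rfl
    · exact (colorPointMap_naturality χ g).symm

/-- A colored simplex, as a simplex. -/
noncomputable def coloredDiagramsToHom (a : A ⟶ Δ[m]) :
    coloredDiagrams π χ a ⟶ homDiagrams A Y where
  app Z := ↾ fun σ => σ.1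

/-- A colored diagram is a square whose part over `j(Δ¹)` is fixed by `χ`. So restriction of colored
diagrams is a base change of the map in the relative Kan condition. -/
lemma IsCovering.coloredRestrict {P : MorphismProperty C}
    (h : IsCovering P (toHomSquares a π)) : IsCovering P (coloredRestrict π χ a) := by
  refine h.baseChange _ (coloredDiagramsToHom (𝟙 _)) (coloredDiagramsToSquares a) ?_ ?_
  · refine NatTrans.ext (funext fun Z => ConcreteCategory.hom_ext _ _ fun σ => ?_)
    exact Arrow.hom_ext _ _ rfl (σ.2.trans (Category.id_comp _)).symm
  · intro Z y x hxy
    have h₁ := congrArg CommaMorphism.left hxy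
    have h₂ := congrArg CommaMorphism.right hxy
    refine ⟨⟨x, h₂.trans (Category.id_comp _).symm⟩, ⟨rfl, Subtype.ext h₁⟩, ?_⟩
    rintro x' ⟨rfl, -⟩
    rfl

variable {E : SimplicialObject C} {e : E ⟶ Y} {c : Fin 2}

lemma IsEnd.exists_lift (he : IsEnd π c e) {n : SimplexCategory} {Z : C} (y : Z ⟶ Y.obj (op n))
    (hy : y ≫ π.app (op n) = colorPoint (SimplexCategory.const n ⦋1⦌ c) Z) :
    ∃ x : Z ⟶ E.obj (op n), x ≫ e.app (op n) = y :=
  ⟨(he n).lift y (terminal.from Z) hy, (he n).lift_fst _ _ _⟩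

lemma IsEnd.cancel (he : IsEnd π c e) {n : SimplexCategory} {Z : C} {x x' : Z ⟶ E.obj (op n)}
    (h : x ≫ e.app (op n) = x' ≫ e.app (op n)) : x = x' :=
  (he n).hom_ext h (terminal.hom_ext _ _)

lemma IsEnd.comp_π (he : IsEnd π c e) {n : SimplexCategory} {Z : C} (x : Z ⟶ E.obj (op n)) :
    (x ≫ e.app (op n)) ≫ π.app (op n) = colorPoint (SimplexCategory.const n ⦋1⦌ c) Z :=
  (Category.assoc _ _ _).trans ((congrArg (x ≫ ·) (he n).w).trans
    (comp_colorPoint (SimplexCategory.const n ⦋1⦌ c) x))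

/-- The diagram in a colored simplicial object that is given by a diagram in an end. -/
def IsEnd.toDiagram (he : IsEnd π c e) (hχ : χ = SimplexCategory.const _ _ c) (a : A ⟶ Δ[m])
    (Z : Cᵒᵖ) (σ : A ⟶ ((points C).obj E).obj Z) : (coloredDiagrams π χ a).obj Z :=
  ⟨σ ≫ ((points C).map e).app Z, by
    refine NatTrans.ext (funext fun n => ConcreteCategory.hom_ext _ _ fun z => ?_)
    refine (he.comp_π (σ.app n z)).trans ((colorPointMap_app Z (a.app n z)).trans ?_).symm
    rw [hχ]
    rfl⟩

lemma IsEnd.bijective_toDiagram (he : IsEnd π c e) (hχ : χ = SimplexCategory.const _ _ c)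
    (a : A ⟶ Δ[m]) (Z : Cᵒᵖ) : Function.Bijective (he.toDiagram hχ a Z) := by
  constructor
  · intro σ τ h
    refine NatTrans.ext (funext fun n => ConcreteCategory.hom_ext _ _ fun z => ?_)
    exact he.cancel (congrArg (fun σ : (coloredDiagrams π χ a).obj Z => σ.1.app n z) h)
  · rintro ⟨σ, hσ⟩
    have h₁ : ∀ (n : SimplexCategoryᵒᵖ) (z : A.obj n), ∃ x : Z.unop ⟶ E.obj n,
        x ≫ e.app n = σ.app n z := by
      intro n z
      refine he.exists_lift (n := n.unop) (σ.app n z) ?_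
      refine (ConcreteCategory.congr_hom (NatTrans.congr_app hσ n) z).trans
        ((colorPointMap_app Z (a.app n z)).trans ?_)
      rw [hχ]
      rfl
    choose x hx using h₁
    refine ⟨{ app n := ↾ fun z => (x n z : Z.unop ⟶ E.obj n), naturality n n' f := ?_ }, ?_⟩
    · refine ConcreteCategory.hom_ext _ _ fun z => he.cancel (n := n'.unop) ?_
      refine (hx n' (A.map f z)).trans ?_
      refine (ConcreteCategory.congr_hom (σ.naturality f) z).trans ?_
      change σ.app n z ≫ Y.map f = (x n z ≫ E.map f) ≫ e.app n'
      rw [← hx, Category.assoc, Category.assoc, e.naturality]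
    · exact Subtype.ext (NatTrans.ext (funext fun n =>
        ConcreteCategory.hom_ext _ _ fun z => hx n z))

/-- Diagrams in an end are colored diagrams with constant color. -/
noncomputable def IsEnd.diagramsIso (he : IsEnd π c e) (hχ : χ = SimplexCategory.const _ _ c)
    (a : A ⟶ Δ[m]) : homDiagrams A E ≅ coloredDiagrams π χ a :=
  NatIso.ofComponents (fun Z => (Equiv.ofBijective _ (he.bijective_toDiagram hχ a Z)).toIso)
    (fun {Z W} g => by
      refine ConcreteCategory.hom_ext _ _ fun σ => Subtype.ext ?_
      refine NatTrans.ext (funext fun n => ConcreteCategory.hom_ext _ _ fun z => ?_)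
      exact Category.assoc _ _ _)

/-- Diagrams of constant color are diagrams in the corresponding end, compatibly with restriction.
-/
lemma IsCovering.coloredRestrict_of_isEnd {P : MorphismProperty C} (he : IsEnd π c e)
    (hχ : χ = SimplexCategory.const _ _ c) (h : IsCovering P (homDiagramsRestrict a E)) :
    IsCovering P (HigherGpd.coloredRestrict π χ a) := by
  refine h.of_iso (he.diagramsIso hχ (𝟙 _)).symm (he.diagramsIso hχ a).symm
    (comp_inv_eq_inv_comp ?_)
  refine NatTrans.ext (funext fun Z => ConcreteCategory.hom_ext _ _ fun σ => Subtype.ext ?_)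
  exact Category.assoc _ _ _

variable (π) in
-- Simplices with coloring `d.hom` are represented by the pullback of `π` along the coproduct
-- injection with index `d.hom`.
lemma isRep_coloredPoints
    (hπ : ∀ (n : SimplexCategory) (f : n ⟶ ⦋1⦌), HasPullback (π.app (op n))
      (Sigma.ι (fun _ : (op n).unop ⟶ ⦋1⦌ => ⊤_ C) f)) (d : ColoredSimplex) :
    IsRep (families (coloredPoints π) (⊤ : Sieve d)) := by
  have hp := hπ d.left d.hom
  let p := pullback.fst (π.app (op d.left))
    (Sigma.ι (fun _ : (op d.left).unop ⟶ ⦋1⦌ => ⊤_ C) d.hom)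
  have sq : IsPullback p (terminal.from _) (π.app (op d.left))
      (Sigma.ι (fun _ : (op d.left).unop ⟶ ⦋1⦌ => ⊤_ C) d.hom) := by
    have h := IsPullback.of_hasPullback (π.app (op d.left))
      (Sigma.ι (fun _ : (op d.left).unop ⟶ ⦋1⦌ => ⊤_ C) d.hom)
    have e : pullback.snd (π.app (op d.left))
      (Sigma.ι (fun _ : (op d.left).unop ⟶ ⦋1⦌ => ⊤_ C) d.hom) = terminal.from _ :=
        terminal.hom_ext _ _
    exact e ▸ h
  have hw : ∀ {Z : C} (s : Z ⟶ pullback (π.app (op d.left))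
      (Sigma.ι (fun _ : (op d.left).unop ⟶ ⦋1⦌ => ⊤_ C) d.hom)),
      (s ≫ p) ≫ π.app (op d.left) = colorPoint (n := d.left) d.hom Z := fun s =>
    (Category.assoc _ _ _).trans ((congrArg (s ≫ ·) sq.w).trans
      (comp_colorPoint (n := d.left) d.hom s))
  let F : ∀ Z : Cᵒᵖ, (Z.unop ⟶ pullback (π.app (op d.left))
      (Sigma.ι (fun _ : (op d.left).unop ⟶ ⦋1⦌ => ⊤_ C) d.hom)) →
        Family ((coloredPoints π).obj Z) (⊤ : Sieve d) := fun Z s =>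
    Family.topEquiv.symm ⟨s ≫ p, hw s⟩
  have hF : ∀ Z, Function.Bijective (F Z) := by
    intro Z
    refine Family.topEquiv.symm.bijective.comp ⟨fun s s' h => ?_, fun y => ?_⟩
    · exact sq.hom_ext (congrArg Subtype.val h) (terminal.hom_ext _ _)
    · exact ⟨sq.lift y.1 (terminal.from _) y.2, Subtype.ext (sq.lift_fst _ _ _)⟩
  refine ⟨_, ⟨NatIso.ofComponents (fun Z => (Equiv.ofBijective _ (hF Z)).toIso) fun g => ?_⟩⟩
  refine ConcreteCategory.hom_ext _ _ fun s => ?_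
  refine Family.ext (funext fun e => funext fun r => funext fun hr => Subtype.ext ?_)
  change ((g.unop ≫ s) ≫ p) ≫ _ = g.unop ≫ (s ≫ p) ≫ _
  simp only [Category.assoc]

end ColoredPoints

/-! ### Colored Kan conditions for outer horns -/

section Main

variable {C : Type u} [Category.{v} C] [HasTerminal C] [HasFiniteCoproducts C]
  {J : MorphismProperty C} {n : ℕ∞} {Y : SimplicialObject C} {π : Y ⟶ jInterval C}

lemma exists_eq_mk (d : ColoredSimplex) :
    ∃ (m : ℕ) (χ : (⦋m⦌ : SimplexCategory) ⟶ ⦋1⦌), d = Over.mk χ :=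
  ⟨d.left.len, d.hom, rfl⟩

lemma hasInnerAndEndCoverings {P : MorphismProperty C} (hP : IsSingletonPretopology P) {N : ℕ}
    (h₁ : ∀ (m : ℕ) (k : Fin (m + 1)), N ≤ m → 0 < k → k < Fin.last m → RelativeKan P m k π)
    (h₂ : ∀ c : Fin 2, ∃ (E : SimplicialObject C) (e : E ⟶ Y), IsEnd π c e ∧
      ∀ (m : ℕ) (k : Fin (m + 1)), N ≤ m → 1 ≤ m → Kan P m k E) :
    HasInnerAndEndCoverings P (coloredPoints π) N where
  inner d k hN hk hk' := by
    obtain ⟨m, χ, rfl⟩ := exists_eq_mk d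
    exact HornCovering.of_coloredRestrict
      (IsCovering.of_representedBy hP (h₁ m k hN hk hk')).coloredRestrict
  ends d k c hN h0 hd := by
    obtain ⟨m, χ, rfl⟩ := exists_eq_mk d
    obtain ⟨E, e, he, hE⟩ := h₂ c
    refine HornCovering.of_coloredRestrict (IsCovering.coloredRestrict_of_isEnd he ?_
      (IsCovering.of_representedBy hP (hE m k hN h0)))
    ext b : 3
    exact hd b

lemma hasInnerAndEndCoverings_covers (hJ : IsSingletonPretopology J)
    (hE : EndsAreNGroupoids J n π) (hπ : SatisfiesInnerKan J n π) :
    HasInnerAndEndCoverings J (coloredPoints π) 0 := by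
  refine hasInnerAndEndCoverings hJ (fun m k _ hk hk' => (hπ m k hk hk').1) fun c => ?_
  obtain ⟨E, e, he, h⟩ := hE c
  exact ⟨E, e, he, fun m k _ hm => (h m k hm).1⟩

lemma hasInnerAndEndCoverings_isomorphisms
    (hE : EndsAreNGroupoids J n π) (hπ : SatisfiesInnerKan J n π) {N : ℕ}
    (hN : ∀ m : ℕ, N ≤ m → n < (m : ℕ∞)) :
    HasInnerAndEndCoverings (MorphismProperty.isomorphisms C) (coloredPoints π) N := by
  refine hasInnerAndEndCoverings isSingletonPretopology_isomorphisms
    (fun m k hm hk hk' => (hπ m k hk hk').2 (hN m hm)) fun c => ?_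
  obtain ⟨E, e, he, h⟩ := hE c
  exact ⟨E, e, he, fun m k hm hm' => (h m k hm').2 (hN m hm)⟩

lemma exists_vertex_zero {m i : ℕ} (hi : 2 ≤ i) (hm : 1 ≤ m) :
    ∃ b : Vertex (Over.mk (colorMap m i)), b ≠ 0 ∧ color (Over.mk (colorMap m i)) b = 0 := by
  refine ⟨(⟨1, by omega⟩ : Fin (m + 1)), fun h => ?_, ?_⟩
  · exact absurd (congrArg Fin.val h) one_ne_zero
  · exact if_pos (by change 1 < i; omega)

lemma exists_vertex_one {m i : ℕ} (hi : i + 1 ≤ m) :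
    ∃ b : Vertex (Over.mk (colorMap m i)), b ≠ Fin.last _ ∧
      color (Over.mk (colorMap m i)) b = 1 := by
  refine ⟨(⟨m - 1, by omega⟩ : Fin (m + 1)), fun h => ?_, ?_⟩
  · have : m - 1 = m := congrArg Fin.val h
    omega
  · exact if_neg (by change ¬ m - 1 < i; omega)

/-- Colored Kan conditions for outer horns. -/
theorem coloredKan_outer (hJ : IsSingletonPretopology J) (hJ' : DetectsCovers J)
    (hp : ∀ (n : SimplexCategory) (f : n ⟶ ⦋1⦌), HasPullback (π.app (op n))
      (Sigma.ι (fun _ : (op n).unop ⟶ ⦋1⦌ => ⊤_ C) f))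
    (hE : EndsAreNGroupoids J n π) (hπ : SatisfiesInnerKan J n π) {m i j : ℕ}
    (hij : i + j = m + 1) :
    (2 ≤ i → ColoredKan J π m 0 i) ∧ (2 ≤ j → ColoredKan J π m (Fin.last m) i) := by
  have hX := hasInnerAndEndCoverings_covers hJ hE hπ
  have hrep := isRep_coloredPoints π hp
  refine ⟨fun hi => ?_, fun hj => ?_⟩
  · exact (representedBy_horn_zero hJ hJ' hrep hX _
      (exists_vertex_zero hi (by omega))).coloredRestrict
  · exact (representedBy_horn_last hJ hJ' hrep hX _ (exists_vertex_one (by omega))).coloredRestrict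

/-- Unique colored Kan conditions for outer horns. -/
theorem coloredKan_isomorphisms_outer (hJ : IsSingletonPretopology J) (hJ' : DetectsCovers J)
    (hepi : ∀ {A B : C} (f : A ⟶ B), J f → Epi f)
    (hiso : ∀ {A B : C} (f : A ⟶ B), J f → Mono f → IsIso f)
    (hp : ∀ (n : SimplexCategory) (f : n ⟶ ⦋1⦌), HasPullback (π.app (op n))
      (Sigma.ι (fun _ : (op n).unop ⟶ ⦋1⦌ => ⊤_ C) f))
    (hE : EndsAreNGroupoids J 2 π) (hπ : SatisfiesInnerKan J 2 π) {m i j : ℕ} (hm : 2 < m)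
    (hij : i + j = m + 1) :
    (2 ≤ i → ColoredKan (MorphismProperty.isomorphisms C) π m 0 i) ∧
      (2 ≤ j → ColoredKan (MorphismProperty.isomorphisms C) π m (Fin.last m) i) := by
  have hX := hasInnerAndEndCoverings_covers hJ hE hπ
  have hX' := hasInnerAndEndCoverings_isomorphisms (N := 3) hE hπ fun m hm => by
    exact_mod_cast hm
  have hrep := isRep_coloredPoints π hp
  refine ⟨fun hi => ?_, fun hj => ?_⟩
  · exact (representedBy_horn_zero_isomorphisms hJ hJ' hepi hiso hrep hX hX' _
      (exists_vertex_zero hi (by omega)) hm).coloredRestrict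
  · exact (representedBy_horn_last_isomorphisms hJ hJ' hepi hiso hrep hX hX' _
      (exists_vertex_one (by omega)) hm).coloredRestrict

end Main

/-- Covers of the initial object split. Testing with it prescribes nothing, and any section over a
cover suffices by right cancellation. -/
lemma detectsCovers_of_rightCancellative {C : Type u} [Category.{v} C]
    [HasFiniteCoproducts C] {J : MorphismProperty C} (hJ' : RightCancellative J) :
      DetectsCovers J := by
  intro A B g h
  have hbot : IsProjectiveFor J (⊥_ C) := fun Z u _ => ⟨initial.to Z, initial.hom_ext _ _⟩
  obtain ⟨Z, u, w, x, hu, -, hx, -⟩ := h (⊥_ C) hbot (initial.to B) (initial.to A)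
    (initial.hom_ext _ _)
  exact hJ' x g (hx ▸ hu)

end HigherGpd

namespace HigherGpd

/-! ### Sets and surjections -/

section Sets

lemma isSingletonPretopology_surjective :
    IsSingletonPretopology (MorphismProperty.surjective (Type w)) where
  of_isIso f _ := ((isIso_iff_bijective f).1 inferInstance).2
  comp f g hf hg := by
    change Function.Surjective (f ≫ g)
    rw [types_comp]
    exact Function.Surjective.comp hg hf
  hasPullback _ _ _ := inferInstance
  pullback {P X Y Z p q f g} sq hf := by
    intro z
    obtain ⟨y, hy⟩ := hf (g z)
    obtain ⟨x, -, hx⟩ := Types.exists_of_isPullback sq y z hy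
    exact ⟨x, hx⟩

lemma rightCancellative_surjective : RightCancellative (MorphismProperty.surjective (Type w)) := by
  intro X Y Z g₁ g₂ h z
  obtain ⟨x, hx⟩ := h z
  exact ⟨g₁ x, hx⟩

end Sets

end HigherGpd

namespace Mfd

/-! ### Plots of manifolds -/

open Filter Topology

/-- A map from a Euclidean space to a manifold is smooth at a point. -/
def IsPlotAt (M : Mfd.{u}) {q : ℕ} (h : EuclideanSpace ℝ (Fin q) → M.carrier)
    (a : EuclideanSpace ℝ (Fin q)) : Prop :=
  ContinuousAt h a ∧ ∀ {n : ℕ}, ∀ e ∈ M.atlas n, h a ∈ e.source → ContDiffAt ℝ ∞ (e ∘ h) a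

section Plots

variable {M N L : Mfd.{u}} {q n p : ℕ} {h h' : EuclideanSpace ℝ (Fin q) → M.carrier}
  {a : EuclideanSpace ℝ (Fin q)}

lemma contDiffAt_transition {e : OpenPartialHomeomorph M.carrier (EuclideanSpace ℝ (Fin n))}
    {e' : OpenPartialHomeomorph M.carrier (EuclideanSpace ℝ (Fin p))} (he : e ∈ M.atlas n)
    (he' : e' ∈ M.atlas p) {x : M.carrier} (hx : x ∈ e.source) (hx' : x ∈ e'.source) :
    ContDiffAt ℝ ∞ (e' ∘ e.symm) (e x) := by
  refine (M.compatible e he e' he').contDiffAt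
    ((e.isOpen_inter_preimage_symm e'.open_source).mem_nhds ⟨e.map_source hx, ?_⟩)
  rw [Set.mem_preimage, e.left_inv hx]
  exact hx'

lemma IsPlotAt.of_chart {e : OpenPartialHomeomorph M.carrier (EuclideanSpace ℝ (Fin n))}
    (he : e ∈ M.atlas n) (hc : ContinuousAt h a) (ha : h a ∈ e.source)
    (hh : ContDiffAt ℝ ∞ (e ∘ h) a) : M.IsPlotAt h a := by
  refine ⟨hc, fun e' he' ha' => ?_⟩
  refine ((contDiffAt_transition he he' ha ha').comp a hh).congr_of_eventuallyEq ?_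
  filter_upwards [hc.eventually (e.open_source.mem_nhds ha)] with b hb
  exact congrArg e' (e.left_inv hb).symm

lemma IsPlotAt.congr (hh : M.IsPlotAt h a) (e : h' =ᶠ[𝓝 a] h) : M.IsPlotAt h' a := by
  refine ⟨hh.1.congr e.symm, fun c hc ha => ?_⟩
  rw [e.eq_of_nhds] at ha
  exact (hh.2 c hc ha).congr_of_eventuallyEq (e.fun_comp c)

lemma IsPlotAt.comp {g : EuclideanSpace ℝ (Fin p) → EuclideanSpace ℝ (Fin q)}
    {b : EuclideanSpace ℝ (Fin p)} (hh : M.IsPlotAt h (g b)) (hg : ContDiffAt ℝ ∞ g b) :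
    M.IsPlotAt (h ∘ g) b :=
  ⟨hh.1.comp hg.continuousAt, fun e he ha => (hh.2 e he ha).comp b hg⟩

lemma isPlotAt_const (x : M.carrier) : M.IsPlotAt (fun _ => x) a :=
  ⟨continuousAt_const, fun _ _ _ => contDiffAt_const⟩

lemma isPlotAt_symm {e : OpenPartialHomeomorph M.carrier (EuclideanSpace ℝ (Fin q))}
    (he : e ∈ M.atlas q) (ha : a ∈ e.target) : M.IsPlotAt e.symm a := by
  refine IsPlotAt.of_chart he (e.continuousAt_symm ha) (e.map_target ha) ?_
  refine contDiffAt_id.congr_of_eventuallyEq ?_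
  filter_upwards [e.open_target.mem_nhds ha] with b hb
  exact e.right_inv hb

lemma IsPlotAt.map {f : M.carrier → N.carrier} (hf : IsSmooth f) (hh : M.IsPlotAt h a) :
    N.IsPlotAt (f ∘ h) a := by
  refine ⟨hf.continuous.continuousAt.comp hh.1, fun e he ha => ?_⟩
  obtain ⟨n, c, hc, hx⟩ := M.exists_chart (h a)
  have h₁ : ContDiffAt ℝ ∞ (e ∘ f ∘ c.symm) (c (h a)) := by
    refine (hf.contDiffOn c hc e he).contDiffAt ((c.isOpen_inter_preimage_symm
      (e.open_source.preimage hf.continuous)).mem_nhds ⟨c.map_source hx, ?_⟩)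
    rw [Set.mem_preimage, c.left_inv hx]
    exact ha
  refine (h₁.comp a (hh.2 c hc hx)).congr_of_eventuallyEq ?_
  filter_upwards [hh.1.eventually (c.open_source.mem_nhds hx)] with b hb
  exact congrArg (fun y => e (f y)) (c.left_inv hb).symm

/-- One chart around each point is enough, so maps between manifolds can be handled through plots
without comparing atlases. -/
lemma isSmooth_of_isPlotAt {f : M.carrier → N.carrier}
    (hf : ∀ x, ∃ (n : ℕ), ∃ e ∈ M.atlas n, x ∈ e.source ∧ N.IsPlotAt (f ∘ e.symm) (e x)) :
    IsSmooth f where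
  continuous := by
    rw [continuous_iff_continuousAt]
    intro x
    obtain ⟨n, e, he, hx, h⟩ := hf x
    refine (h.1.comp (e.continuousAt hx)).congr ?_
    filter_upwards [e.open_source.mem_nhds hx] with y hy
    exact congrArg f (e.left_inv hy)
  contDiffOn e he e' he' := by
    intro y hy
    obtain ⟨n, c, hc, hx, h⟩ := hf (e.symm y)
    have h₁ : N.IsPlotAt ((f ∘ c.symm) ∘ (c ∘ e.symm)) y := by
      refine IsPlotAt.comp h ?_
      have := contDiffAt_transition he hc (e.map_target hy.1) hx
      rwa [e.right_inv hy.1] at this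
    have h₂ : N.IsPlotAt (f ∘ e.symm) y := by
      refine h₁.congr ?_
      filter_upwards [(e.continuousAt_symm hy.1).eventually (c.open_source.mem_nhds hx)] with b hb
      exact congrArg f (c.left_inv hb).symm
    exact (h₂.2 e' he' hy.2).contDiffWithinAt

/-! ### Submersions -/

/-- Germs of plots through the image of a point lift to germs of plots through this point. -/
def IsSubmersionAt (f : M.carrier → N.carrier) (x : M.carrier) : Prop :=
  ∀ (q : ℕ) (h : EuclideanSpace ℝ (Fin q) → N.carrier) (a : EuclideanSpace ℝ (Fin q)),
    h a = f x → (∀ᶠ b in 𝓝 a, N.IsPlotAt h b) →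
      ∃ h' : EuclideanSpace ℝ (Fin q) → M.carrier, h' a = x ∧ (∀ᶠ b in 𝓝 a, M.IsPlotAt h' b) ∧
        ∀ᶠ b in 𝓝 a, f (h' b) = h b

lemma IsSubmersionAt.comp {f : M.carrier → N.carrier} {g : N.carrier → L.carrier} {x : M.carrier}
    (hg : IsSubmersionAt g (f x)) (hf : IsSubmersionAt f x) :
    IsSubmersionAt (M := M) (N := L) (fun y => g (f y)) x := by
  intro q h a ha hh
  obtain ⟨h₁, e₁, p₁, k₁⟩ := hg q h a ha hh
  obtain ⟨h₂, e₂, p₂, k₂⟩ := hf q h₁ a e₁ p₁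
  refine ⟨h₂, e₂, p₂, ?_⟩
  filter_upwards [k₁, k₂] with b hb hb'
  rw [hb', hb]

/-- Lifts of germs along the composite are pushed forward by `f`. The conclusion concerns the point
`f x` only, so proving a map to be a submersion requires local sections through each prescribed
point. -/
lemma IsSubmersionAt.of_comp {f : M.carrier → N.carrier} {g : N.carrier → L.carrier}
    {x : M.carrier} (hf : IsSmooth f) (h : IsSubmersionAt (M := M) (N := L) (fun y => g (f y)) x) :
    IsSubmersionAt g (f x) := by
  intro q k a ha hk
  obtain ⟨k', e, p, r⟩ := h q k a ha hk
  exact ⟨f ∘ k', congrArg f e, p.mono fun b hb => hb.map hf, r⟩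

lemma isSubmersionAt_of_rightInverse {f : M.carrier → N.carrier} {g : N.carrier → M.carrier}
    (hg : IsSmooth g) (hfg : ∀ y, f (g y) = y) (hgf : ∀ x, g (f x) = x) (x : M.carrier) :
    IsSubmersionAt f x := by
  intro q h a ha hh
  refine ⟨g ∘ h, ?_, hh.mono fun b hb => hb.map hg, Eventually.of_forall fun b => hfg _⟩
  rw [Function.comp_apply, ha, hgf]

/-- A lift through `x` of the inverse of the chart `e'` is a local section; by the chain rule its
derivative is a right inverse of the derivative of `f`. -/
lemma IsSubmersionAt.surjective_fderiv {f : M.carrier → N.carrier} (hf : IsSmooth f)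
    {x : M.carrier} (h : IsSubmersionAt f x)
    {e : OpenPartialHomeomorph M.carrier (EuclideanSpace ℝ (Fin n))}
    {e' : OpenPartialHomeomorph N.carrier (EuclideanSpace ℝ (Fin p))} (he : e ∈ M.atlas n)
    (he' : e' ∈ N.atlas p) (hx : x ∈ e.source) (hx' : f x ∈ e'.source) :
    Function.Surjective (fderiv ℝ (e' ∘ f ∘ e.symm) (e x)) := by
  obtain ⟨k, hk, hk', hk''⟩ := h p e'.symm (e' (f x)) (e'.left_inv hx') (by
    filter_upwards [e'.open_target.mem_nhds (e'.map_source hx')] with b hb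
    exact isPlotAt_symm he' hb)
  have hkp := hk'.self_of_nhds
  have d₁ : DifferentiableAt ℝ (e ∘ k) (e' (f x)) :=
    (hkp.2 e he (hk.symm ▸ hx)).differentiableAt (by simp)
  have d₂ : DifferentiableAt ℝ (e' ∘ f ∘ e.symm) ((e ∘ k) (e' (f x))) := by
    have h₁ := ((isPlotAt_symm he (e.map_source hx)).map hf).2 e' he' (by
      rw [Function.comp_apply, e.left_inv hx]; exact hx')
    rw [Function.comp_apply, hk]
    exact h₁.differentiableAt (by simp)
  have d₃ : (e' ∘ f ∘ e.symm) ∘ (e ∘ k) =ᶠ[𝓝 (e' (f x))] id := by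
    filter_upwards [hk'', hkp.1.eventually (e.open_source.mem_nhds (hk.symm ▸ hx)),
      e'.open_target.mem_nhds (e'.map_source hx')] with b hb hb' hb''
    change e' (f (e.symm (e (k b)))) = b
    rw [e.left_inv hb', hb, e'.right_inv hb'']
  have d₄ := d₃.fderiv_eq (𝕜 := ℝ)
  rw [fderiv_comp _ d₂ d₁, fderiv_id] at d₄
  intro v
  refine ⟨fderiv ℝ (e ∘ k) (e' (f x)) v, ?_⟩
  have := congrArg (fun T => T v) d₄
  rw [Function.comp_apply, hk] at this
  exact this

/-- The inverse function theorem for smooth maps. -/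
lemma exists_openPartialHomeomorph {E F : Type*} [NormedAddCommGroup E] [NormedSpace ℝ E]
    [NormedAddCommGroup F] [NormedSpace ℝ F] [CompleteSpace E] {G : E → F} {U : Set E}
    (hU : IsOpen U) (hG : ContDiffOn ℝ ∞ G U) {a : E} (ha : a ∈ U) {A : E ≃L[ℝ] F}
    (hA : HasFDerivAt G (A : E →L[ℝ] F) a) :
    ∃ Θ : OpenPartialHomeomorph E F, a ∈ Θ.source ∧ Θ.source ⊆ U ∧ (∀ v, Θ v = G v) ∧
      ∀ b ∈ Θ.target, ContDiffAt ℝ ∞ Θ.symm b := by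
  have hGat : ∀ v ∈ U, ContDiffAt ℝ ∞ G v := fun v hv => hG.contDiffAt (hU.mem_nhds hv)
  have h1 : (1 : WithTop ℕ∞) ≤ ∞ := by exact_mod_cast le_top
  let Θ₀ := (hGat a ha).toOpenPartialHomeomorph G hA (by simp)
  have hcont : ContinuousOn (fderiv ℝ G) U := hG.continuousOn_fderiv_of_isOpen hU h1
  -- Shrinking to the points with invertible derivative makes the local inverse smooth on its whole
  -- domain, not merely at the image of `a`.
  have hV : IsOpen (U ∩ fderiv ℝ G ⁻¹' Set.range ((↑) : (E ≃L[ℝ] F) → E →L[ℝ] F)) :=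
    hcont.isOpen_inter_preimage hU ContinuousLinearEquiv.isOpen
  refine ⟨Θ₀.restrOpen _ hV, ⟨(hGat a ha).mem_toOpenPartialHomeomorph_source hA _, ha, ?_⟩,
    fun v hv => hv.2.1, fun v => rfl, ?_⟩
  · exact ⟨A, hA.fderiv.symm⟩
  · intro b hb
    have hb' := (Θ₀.restrOpen _ hV).map_target hb
    obtain ⟨-, hbU, B, hB⟩ := hb'
    refine OpenPartialHomeomorph.contDiffAt_symm _ hb (f₀' := B) ?_ (hGat _ hbU)
    rw [hB]
    exact ((hGat _ hbU).differentiableAt (by simp)).hasFDerivAt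

/-- `T` is completed to an isomorphism by the projection onto its kernel along a complement. -/
lemma exists_equiv_prod {n p : ℕ}
    {T : EuclideanSpace ℝ (Fin n) →L[ℝ] EuclideanSpace ℝ (Fin p)} (hT : Function.Surjective T) :
    ∃ (k : ℕ) (A : EuclideanSpace ℝ (Fin n) ≃L[ℝ]
      EuclideanSpace ℝ (Fin p) × EuclideanSpace ℝ (Fin k)), ∀ v, (A v).1 = T v := by
  obtain ⟨K, hK⟩ := Submodule.exists_isCompl (LinearMap.ker T.toLinearMap)
  let k := Module.finrank ℝ (LinearMap.ker T.toLinearMap)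
  let ε : LinearMap.ker T.toLinearMap ≃ₗ[ℝ] EuclideanSpace ℝ (Fin k) :=
    LinearEquiv.ofFinrankEq _ _ (by simp [k])
  let g : EuclideanSpace ℝ (Fin n) →ₗ[ℝ] EuclideanSpace ℝ (Fin k) :=
    ε.toLinearMap ∘ₗ Submodule.projectionOnto _ _ hK
  have hg : LinearMap.ker g = K := by
    rw [LinearEquiv.ker_comp, Submodule.ker_projectionOnto]
  let A := LinearMap.equivProdOfSurjectiveOfIsCompl T.toLinearMap g
    (LinearMap.range_eq_top.2 hT) (by
      rw [LinearMap.range_eq_top]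
      exact ε.surjective.comp (Submodule.projectionOnto_surjective hK)) (by rwa [hg])
  exact ⟨k, A.toContinuousLinearEquiv, fun v => rfl⟩

/-- The local normal form of a submersion. -/
lemma exists_normalForm {f : M.carrier → N.carrier} (hf : IsSmooth f) {x : M.carrier}
    {e : OpenPartialHomeomorph M.carrier (EuclideanSpace ℝ (Fin n))}
    {e' : OpenPartialHomeomorph N.carrier (EuclideanSpace ℝ (Fin p))} (he : e ∈ M.atlas n)
    (he' : e' ∈ N.atlas p) (hx : x ∈ e.source) (hx' : f x ∈ e'.source)
    (hs : Function.Surjective (fderiv ℝ (e' ∘ f ∘ e.symm) (e x))) :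
    ∃ (k : ℕ) (r : EuclideanSpace ℝ (Fin n) →L[ℝ] EuclideanSpace ℝ (Fin k))
      (Θ : OpenPartialHomeomorph (EuclideanSpace ℝ (Fin n))
        (EuclideanSpace ℝ (Fin p) × EuclideanSpace ℝ (Fin k))),
      e x ∈ Θ.source ∧ Θ.source ⊆ e.target ∩ e.symm ⁻¹' (f ⁻¹' e'.source) ∧
        (∀ v, Θ v = (e' (f (e.symm v)), r v)) ∧ ∀ b ∈ Θ.target, ContDiffAt ℝ ∞ Θ.symm b := by
  obtain ⟨k, A, hA⟩ := exists_equiv_prod hs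
  let r := (ContinuousLinearMap.snd ℝ _ _).comp A.toContinuousLinearMap
  have hU : IsOpen (e.target ∩ e.symm ⁻¹' (f ⁻¹' e'.source)) :=
    e.isOpen_inter_preimage_symm (e'.open_source.preimage hf.continuous)
  have hxU : e x ∈ e.target ∩ e.symm ⁻¹' (f ⁻¹' e'.source) := by
    refine ⟨e.map_source hx, ?_⟩
    rw [Set.mem_preimage, e.left_inv hx]
    exact hx'
  have hF := hf.contDiffOn e he e' he'
  have hd := ((hF.contDiffAt (hU.mem_nhds hxU)).differentiableAt (by simp)).hasFDerivAt
  have hG : HasFDerivAt (fun v => ((e' ∘ f ∘ e.symm) v, r v)) (A : _ →L[ℝ] _) (e x) := by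
    have hAr : A.toContinuousLinearMap = (fderiv ℝ (e' ∘ f ∘ e.symm) (e x)).prod r :=
      ContinuousLinearMap.ext fun v => Prod.ext (hA v) rfl
    rw [hAr]
    exact hd.prodMk (r.hasFDerivAt (x := e x))
  obtain ⟨Θ, h₁, h₂, h₃, h₄⟩ := exists_openPartialHomeomorph hU
    (hF.prodMk r.contDiff.contDiffOn) hxU hG
  exact ⟨k, r, Θ, h₁, h₂, h₃, h₄⟩

/-- In the normal form `f` is a projection, and a germ is lifted by keeping the remaining
coordinates `r` constant. -/
lemma isSubmersionAt_of_surjective_fderiv {f : M.carrier → N.carrier} (hf : IsSmooth f)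
    {x : M.carrier} {e : OpenPartialHomeomorph M.carrier (EuclideanSpace ℝ (Fin n))}
    {e' : OpenPartialHomeomorph N.carrier (EuclideanSpace ℝ (Fin p))} (he : e ∈ M.atlas n)
    (he' : e' ∈ N.atlas p) (hx : x ∈ e.source) (hx' : f x ∈ e'.source)
    (hs : Function.Surjective (fderiv ℝ (e' ∘ f ∘ e.symm) (e x))) : IsSubmersionAt f x := by
  obtain ⟨k, r, Θ, h₁, h₂, h₃, h₄⟩ := exists_normalForm hf he he' hx hx' hs
  intro q h a ha hh
  have hΘ : Θ (e x) = (e' (h a), r (e x)) := by rw [h₃, e.left_inv hx, ha]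
  let y : EuclideanSpace ℝ (Fin q) → EuclideanSpace ℝ (Fin p) × EuclideanSpace ℝ (Fin k) :=
    fun b => (e' (h b), r (e x))
  have hya : y a ∈ Θ.target := by
    have := Θ.map_source h₁
    rwa [hΘ] at this
  have hsrc : h a ∈ e'.source := ha ▸ hx'
  have hplot := hh.self_of_nhds
  have hyc : ContinuousAt y a := ((e'.continuousAt hsrc).comp hplot.1).prodMk continuousAt_const
  have hev : ∀ᶠ b in 𝓝 a, h b ∈ e'.source ∧ y b ∈ Θ.target ∧ N.IsPlotAt h b :=
    (hplot.1.eventually (e'.open_source.mem_nhds hsrc)).and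
      ((hyc.eventually (Θ.open_target.mem_nhds hya)).and hh)
  refine ⟨fun b => e.symm (Θ.symm (y b)), ?_, ?_, ?_⟩
  · change e.symm (Θ.symm (e' (h a), r (e x))) = x
    rw [← hΘ, Θ.left_inv h₁, e.left_inv hx]
  · filter_upwards [hev] with b hb
    have hyb : ContDiffAt ℝ ∞ y b := (hb.2.2.2 e' he' hb.1).prodMk contDiffAt_const
    exact (isPlotAt_symm he (h₂ (Θ.map_target hb.2.1)).1).comp ((h₄ _ hb.2.1).comp b hyb)
  · filter_upwards [hev] with b hb
    have h₅ := Θ.map_target hb.2.1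
    have h₆ : Θ (Θ.symm (y b)) = y b := Θ.right_inv hb.2.1
    rw [h₃] at h₆
    exact e'.injOn (h₂ h₅).2 hb.1 (congrArg Prod.fst h₆)

end Plots

end Mfd

namespace Mfd

/-! ### Fibre products along submersions -/

open Filter Topology

section FibreProducts

variable {M N L K : Mfd.{u}}

/-- The underlying space of the fibre product of two maps. -/
abbrev FibreProduct (f : M.carrier → N.carrier) (g : L.carrier → N.carrier) : Type u :=
  { p : M.carrier × L.carrier // f p.1 = g p.2 }

/-- Charts of the fibre product are those for which the plots are the pairs of plots. -/
def IsFibreChart (f : M.carrier → N.carrier) (g : L.carrier → N.carrier) {n : ℕ}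
    (e : OpenPartialHomeomorph (FibreProduct f g) (EuclideanSpace ℝ (Fin n))) : Prop :=
  (∀ a ∈ e.target, M.IsPlotAt (fun b => (e.symm b).1.1) a ∧
    L.IsPlotAt (fun b => (e.symm b).1.2) a) ∧
  ∀ {q : ℕ} (h : EuclideanSpace ℝ (Fin q) → FibreProduct f g) (a : EuclideanSpace ℝ (Fin q)),
    M.IsPlotAt (fun b => (h b).1.1) a → L.IsPlotAt (fun b => (h b).1.2) a → h a ∈ e.source →
      ContDiffAt ℝ ∞ (e ∘ h) a

/-- In the normal form of `f` a point of `M` near `x₀.1.1` is given by its image in `N` and the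
coordinates `r`. On the fibre product the image is determined by the point of `L`. Hence a chart `χ`
of `L` together with `r` gives coordinates, with `d` identifying the product of Euclidean spaces
with one. -/
lemma exists_isFibreChart {f : M.carrier → N.carrier} {g : L.carrier → N.carrier}
    (hf : IsSmooth f) (hg : IsSmooth g) (x₀ : FibreProduct f g) (hs : IsSubmersionAt f x₀.1.1) :
    ∃ (n : ℕ) (e : OpenPartialHomeomorph (FibreProduct f g) (EuclideanSpace ℝ (Fin n))),
      IsFibreChart f g e ∧ x₀ ∈ e.source := by
  obtain ⟨n, φ, hφ, hx⟩ := M.exists_chart x₀.1.1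
  obtain ⟨m, ψ, hψ, hy⟩ := N.exists_chart (f x₀.1.1)
  obtain ⟨l, χ, hχ, hz⟩ := L.exists_chart x₀.1.2
  obtain ⟨k, r, Θ, h₁, h₂, h₃, h₄⟩ :=
    exists_normalForm hf hφ hψ hx hy (hs.surjective_fderiv hf hφ hψ hx hy)
  let d : (EuclideanSpace ℝ (Fin l) × EuclideanSpace ℝ (Fin k)) ≃L[ℝ]
      EuclideanSpace ℝ (Fin (l + k)) := ContinuousLinearEquiv.ofFinrankEq (by simp)
  let W : Set (EuclideanSpace ℝ (Fin l)) := χ.target ∩ χ.symm ⁻¹' (g ⁻¹' ψ.source)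
  have hW : IsOpen W := χ.isOpen_inter_preimage_symm (ψ.open_source.preimage hg.continuous)
  let κ : EuclideanSpace ℝ (Fin l) × EuclideanSpace ℝ (Fin k) →
      EuclideanSpace ℝ (Fin m) × EuclideanSpace ℝ (Fin k) := fun w => (ψ (g (χ.symm w.1)), w.2)
  have hκ : ContDiffOn ℝ ∞ κ (Prod.fst ⁻¹' W) :=
    ((hg.contDiffOn χ hχ ψ hψ).comp contDiffOn_fst fun w hw => hw).prodMk contDiffOn_snd
  let V : Set (EuclideanSpace ℝ (Fin l) × EuclideanSpace ℝ (Fin k)) :=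
    Prod.fst ⁻¹' W ∩ κ ⁻¹' Θ.target
  have hV : IsOpen V :=
    hκ.continuousOn.isOpen_inter_preimage (hW.preimage continuous_fst) Θ.open_target
  have hVκ : ∀ w ∈ V, ContDiffAt ℝ ∞ κ w := fun w hw =>
    hκ.contDiffAt ((hW.preimage continuous_fst).mem_nhds hw.1)
  let σ : EuclideanSpace ℝ (Fin l) × EuclideanSpace ℝ (Fin k) → M.carrier :=
    fun w => φ.symm (Θ.symm (κ w))
  have hσ : ∀ w ∈ V, f (σ w) = g (χ.symm w.1) := by
    intro w hw
    have h₅ := Θ.map_target hw.2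
    have h₆ : Θ (Θ.symm (κ w)) = κ w := Θ.right_inv hw.2
    rw [h₃] at h₆
    exact ψ.injOn (h₂ h₅).2 hw.1.2 (congrArg Prod.fst h₆)
  classical
  -- The value `x₀` where the equation fails is a dummy; on `V` the equation holds.
  let τ : EuclideanSpace ℝ (Fin l) × EuclideanSpace ℝ (Fin k) → FibreProduct f g :=
    fun w => if H : f (σ w) = g (χ.symm w.1) then ⟨(σ w, χ.symm w.1), H⟩ else x₀
  have hτ : ∀ w ∈ V, (τ w).1 = (σ w, χ.symm w.1) := fun w hw =>
    congrArg Subtype.val (dif_pos (hσ w hw))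
  let ρ : FibreProduct f g → EuclideanSpace ℝ (Fin l) × EuclideanSpace ℝ (Fin k) :=
    fun p => (χ p.1.2, r (φ p.1.1))
  let S : Set (FibreProduct f g) :=
    { p | p.1.2 ∈ χ.source ∧ p.1.1 ∈ φ.source ∩ φ ⁻¹' Θ.source }
  have hS : IsOpen S :=
    (χ.open_source.preimage (continuous_snd.comp continuous_subtype_val)).inter
      ((φ.isOpen_inter_preimage Θ.open_source).preimage
        (continuous_fst.comp continuous_subtype_val))
  have hκρ : ∀ p ∈ S, κ (ρ p) = Θ (φ p.1.1) := by
    intro p hp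
    rw [h₃, φ.left_inv hp.2.1, p.2]
    change (ψ (g (χ.symm (χ p.1.2))), _) = _
    rw [χ.left_inv hp.1]
  have hρV : ∀ p ∈ S, ρ p ∈ V := by
    intro p hp
    refine ⟨⟨χ.map_source hp.1, ?_⟩, ?_⟩
    · change g (χ.symm (χ p.1.2)) ∈ ψ.source
      rw [χ.left_inv hp.1, ← p.2]
      have := (h₂ hp.2.2).2
      rwa [Set.mem_preimage, φ.left_inv hp.2.1] at this
    · rw [Set.mem_preimage, hκρ p hp]
      exact Θ.map_source hp.2.2
  have hτσ : ∀ w ∈ V, (τ w).1.1 = σ w := fun w hw => congrArg Prod.fst (hτ w hw)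
  have hτχ : ∀ w ∈ V, (τ w).1.2 = χ.symm w.1 := fun w hw => congrArg Prod.snd (hτ w hw)
  have hφσ : ∀ w ∈ V, φ (σ w) = Θ.symm (κ w) := fun w hw =>
    φ.right_inv (h₂ (Θ.map_target hw.2)).1
  have hτS : ∀ w ∈ V, τ w ∈ S := by
    intro w hw
    refine ⟨?_, ?_, ?_⟩
    · rw [hτχ w hw]
      exact χ.map_target hw.1.1
    · rw [hτσ w hw]
      exact φ.map_target (h₂ (Θ.map_target hw.2)).1
    · rw [Set.mem_preimage, hτσ w hw, hφσ w hw]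
      exact Θ.map_target hw.2
  have hτρ : ∀ p ∈ S, τ (ρ p) = p := by
    intro p hp
    refine Subtype.ext ((hτ _ (hρV p hp)).trans (Prod.ext ?_ (χ.left_inv hp.1)))
    change φ.symm (Θ.symm (κ (ρ p))) = _
    rw [hκρ p hp, Θ.left_inv hp.2.2, φ.left_inv hp.2.1]
  have hρτ : ∀ w ∈ V, ρ (τ w) = w := by
    intro w hw
    change (χ (τ w).1.2, r (φ (τ w).1.1)) = w
    rw [hτχ w hw, hτσ w hw, hφσ w hw, χ.right_inv hw.1.1]
    have h₆ : Θ (Θ.symm (κ w)) = κ w := Θ.right_inv hw.2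
    rw [h₃] at h₆
    exact Prod.ext rfl (congrArg (fun y => y.2) h₆ :)
  have hσc : ∀ w ∈ V, ContinuousAt σ w := fun w hw =>
    ContinuousAt.comp (f := fun w => Θ.symm (κ w))
      (φ.continuousAt_symm (h₂ (Θ.map_target hw.2)).1)
      (ContinuousAt.comp (Θ.continuousAt_symm hw.2) (hVκ w hw).continuousAt)
  let e : OpenPartialHomeomorph (FibreProduct f g) (EuclideanSpace ℝ (Fin (l + k))) :=
    { toFun := fun p => d (ρ p)
      invFun := fun v => τ (d.symm v)
      source := S
      target := d.symm ⁻¹' V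
      map_source' := fun p hp => by
        rw [Set.mem_preimage, d.symm_apply_apply]
        exact hρV p hp
      map_target' := fun v hv => hτS _ hv
      left_inv' := fun p hp => by rw [d.symm_apply_apply, hτρ p hp]
      right_inv' := fun v hv => by rw [hρτ _ hv, d.apply_symm_apply]
      open_source := hS
      open_target := hV.preimage d.symm.continuous
      continuousOn_toFun := by
        refine d.continuous.comp_continuousOn (ContinuousOn.prodMk ?_ ?_)
        · exact χ.continuousOn.comp (continuous_snd.comp continuous_subtype_val).continuousOn
            fun p hp => hp.1
        · exact r.continuous.comp_continuousOn (φ.continuousOn.comp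
            (continuous_fst.comp continuous_subtype_val).continuousOn fun p hp => hp.2.1)
      continuousOn_invFun := by
        refine Topology.IsInducing.subtypeVal.continuousOn_iff.2 ?_
        refine ContinuousOn.congr (f := fun v => (σ (d.symm v), χ.symm (d.symm v).1)) ?_
          fun v hv => hτ _ hv
        refine ContinuousOn.prodMk (fun v hv => ?_) ?_
        · exact (ContinuousAt.comp (hσc _ hv) d.symm.continuous.continuousAt).continuousWithinAt
        · exact χ.continuousOn_symm.comp (continuous_fst.comp d.symm.continuous).continuousOn
            fun v hv => hv.1.1 }
  refine ⟨l + k, e, ⟨fun v hv => ?_, fun h a ha ha' has => ?_⟩, ⟨hz, hx, h₁⟩⟩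
  · have hv' : d.symm v ∈ V := hv
    have hev : ∀ᶠ b in 𝓝 v, d.symm b ∈ V := e.open_target.mem_nhds hv
    constructor
    · refine IsPlotAt.congr (h := φ.symm ∘ fun b => Θ.symm (κ (d.symm b))) ?_
        (hev.mono fun b hb => hτσ _ hb)
      refine (isPlotAt_symm hφ (h₂ (Θ.map_target hv'.2)).1).comp ?_
      exact ContDiffAt.comp v (g := fun w => Θ.symm (κ w))
        (ContDiffAt.comp _ (h₄ _ hv'.2) (hVκ _ hv')) d.symm.contDiff.contDiffAt
    · refine IsPlotAt.congr (h := χ.symm ∘ fun b => (d.symm b).1) ?_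
        (hev.mono fun b hb => hτχ _ hb)
      exact (isPlotAt_symm hχ hv'.1.1).comp (contDiff_fst.comp d.symm.contDiff).contDiffAt
  · have h₅ : ContDiffAt ℝ ∞ (fun b => φ (h b).1.1) a := ha.2 φ hφ has.2.1
    have h₆ : ContDiffAt ℝ ∞ (fun b => χ (h b).1.2) a := ha'.2 χ hχ has.1
    exact d.contDiff.contDiffAt.comp a (h₆.prodMk (r.contDiff.contDiffAt.comp a h₅))

/-- The fibre product along a submersion. -/
abbrev fibreProduct (f : M ⟶ N) (g : L ⟶ N) (hf : ∀ x, IsSubmersionAt (Hom.toFun f) x) :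
    Mfd.{u} where
  carrier := FibreProduct (Hom.toFun f) (Hom.toFun g)
  top := instTopologicalSpaceSubtype
  secondCountable := Topology.IsInducing.subtypeVal.secondCountableTopology
  atlas _ := { e | IsFibreChart (Hom.toFun f) (Hom.toFun g) e }
  exists_chart x := exists_isFibreChart (Hom.smooth f) (Hom.smooth g) x (hf _)
  -- The inverse of one chart is a pair of plots, and composing it with another chart is smooth by
  -- the second clause of `IsFibreChart`.
  compatible e he _ he' y hy := ContDiffAt.contDiffWithinAt
    (he'.2 (fun b => e.symm b) y (he.1 y hy.1).1 (he.1 y hy.1).2 hy.2)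

variable (f : M ⟶ N) (g : L ⟶ N) (hf : ∀ x, IsSubmersionAt (Hom.toFun f) x)

lemma isPlotAt_fibreProduct {q : ℕ}
    {h : EuclideanSpace ℝ (Fin q) → (fibreProduct f g hf).carrier} {a : EuclideanSpace ℝ (Fin q)}
    (h₁ : M.IsPlotAt (fun b => (h b).1.1) a) (h₂ : L.IsPlotAt (fun b => (h b).1.2) a) :
    (fibreProduct f g hf).IsPlotAt h a :=
  ⟨Topology.IsInducing.subtypeVal.continuousAt_iff.2 (h₁.1.prodMk h₂.1),
    fun _ he ha => he.2 h a h₁ h₂ ha⟩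

/-- The first projection of the fibre product. -/
def fibreProductFst : fibreProduct f g hf ⟶ M where
  toFun p := p.1.1
  smooth := isSmooth_of_isPlotAt fun x => by
    obtain ⟨n, e, he, hx⟩ := (fibreProduct f g hf).exists_chart x
    exact ⟨n, e, he, hx, (he.1 _ (e.map_source hx)).1⟩

/-- The second projection of the fibre product. -/
def fibreProductSnd : fibreProduct f g hf ⟶ L where
  toFun p := p.1.2
  smooth := isSmooth_of_isPlotAt fun x => by
    obtain ⟨n, e, he, hx⟩ := (fibreProduct f g hf).exists_chart x
    exact ⟨n, e, he, hx, (he.1 _ (e.map_source hx)).2⟩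

/-- The map to the fibre product given by a compatible pair of maps. -/
def fibreProductLift (s : K ⟶ M) (t : K ⟶ L) (w : s ≫ f = t ≫ g) : K ⟶ fibreProduct f g hf where
  toFun x := ⟨(Hom.toFun s x, Hom.toFun t x), congrArg (fun h => Hom.toFun h x) w⟩
  smooth := isSmooth_of_isPlotAt fun x => by
    obtain ⟨n, e, he, hx⟩ := K.exists_chart x
    have h := isPlotAt_symm he (e.map_source hx)
    exact ⟨n, e, he, hx,
      isPlotAt_fibreProduct f g hf (h.map (Hom.smooth s)) (h.map (Hom.smooth t))⟩

lemma isPullback_fibreProduct :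
    IsPullback (fibreProductFst f g hf) (fibreProductSnd f g hf) f g :=
  ⟨⟨Hom.ext (funext fun p => p.2)⟩, ⟨PullbackCone.IsLimit.mk _
    (fun s => fibreProductLift f g hf s.fst s.snd s.condition) (fun _ => rfl) (fun _ => rfl)
    fun _ _ h₁ h₂ => Hom.ext (funext fun x => Subtype.ext (Prod.ext
      (congrArg (fun h => Hom.toFun h x) h₁) (congrArg (fun h => Hom.toFun h x) h₂)))⟩⟩

/-- Given a germ `h` in `L`, a lift of `g ∘ h` along `f` through the first component of `x`, paired
with `h`, is a lift to the fibre product. -/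
lemma isSubmersionAt_fibreProductSnd (x : (fibreProduct f g hf).carrier) :
    IsSubmersionAt (Hom.toFun (fibreProductSnd f g hf)) x := by
  intro q h a ha hh
  obtain ⟨k, hk, hk', hk''⟩ := hf x.1.1 q (Hom.toFun g ∘ h) a
    ((congrArg (Hom.toFun g) ha).trans x.2.symm) (hh.mono fun b hb => hb.map (Hom.smooth g))
  classical
  let h' : EuclideanSpace ℝ (Fin q) → (fibreProduct f g hf).carrier := fun b =>
    if H : Hom.toFun f (k b) = Hom.toFun g (h b) then ⟨(k b, h b), H⟩ else x
  have hh' : ∀ᶠ b in 𝓝 a, (h' b).1 = (k b, h b) :=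
    hk''.mono fun b hb => congrArg Subtype.val (dif_pos hb)
  refine ⟨h', ?_, ?_, hh'.mono fun b hb => congrArg Prod.snd hb⟩
  · refine Subtype.ext (hh'.self_of_nhds.trans ?_)
    rw [hk, ha]
    rfl
  · filter_upwards [hk', hh, eventually_eventually_nhds.2 hh'] with b h₁ h₂ h₃
    exact isPlotAt_fibreProduct f g hf (h₁.congr (h₃.mono fun c hc => congrArg Prod.fst hc))
      (h₂.congr (h₃.mono fun c hc => congrArg Prod.snd hc))

end FibreProducts

end Mfd

namespace Mfd

/-! ### The pretopology of surjective submersions -/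

open Filter Topology HigherGpd

variable {M N : Mfd.{u}}

/-- Passing to lifts of germs removes the charts; in this form stability under composition and base
change is immediate. -/
lemma surjectiveSubmersions_iff {f : M ⟶ N} : surjectiveSubmersions f ↔
    Function.Surjective (Hom.toFun f) ∧ ∀ x, IsSubmersionAt (Hom.toFun f) x := by
  refine ⟨fun h => ⟨h.1, fun x => ?_⟩, fun h => ⟨h.1, fun e he e' he' x hx hx' => ?_⟩⟩
  · obtain ⟨n, e, he, hx⟩ := M.exists_chart x
    obtain ⟨p, e', he', hx'⟩ := N.exists_chart (Hom.toFun f x)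
    exact isSubmersionAt_of_surjective_fderiv (Hom.smooth f) he he' hx hx'
      (h.2 e he e' he' x hx hx')
  · exact (h.2 x).surjective_fderiv (Hom.smooth f) he he' hx hx'

lemma isSmooth_const (y : N.carrier) : IsSmooth (M := M) (N := N) fun _ => y :=
  isSmooth_of_isPlotAt fun x => by
    obtain ⟨n, e, he, hx⟩ := M.exists_chart x
    exact ⟨n, e, he, hx, isPlotAt_const y⟩

/-- A constant map. -/
def const (M : Mfd.{u}) (y : N.carrier) : M ⟶ N where
  toFun _ := y
  smooth := isSmooth_const y

lemma toFun_inv_toFun (f : M ⟶ N) [IsIso f] (x : M.carrier) :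
    Hom.toFun (inv f) (Hom.toFun f x) = x :=
  congrArg (fun h => Hom.toFun h x) (IsIso.hom_inv_id f)

lemma toFun_toFun_inv (f : M ⟶ N) [IsIso f] (y : N.carrier) :
    Hom.toFun f (Hom.toFun (inv f) y) = y :=
  congrArg (fun h => Hom.toFun h y) (IsIso.inv_hom_id f)

lemma isSubmersionAt_of_isIso (f : M ⟶ N) [IsIso f] (x : M.carrier) :
    IsSubmersionAt (Hom.toFun f) x :=
  isSubmersionAt_of_rightInverse (Hom.smooth (inv f)) (toFun_toFun_inv f) (toFun_inv_toFun f) x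

lemma isSingletonPretopology_surjectiveSubmersions :
    IsSingletonPretopology surjectiveSubmersions.{u} where
  of_isIso f _ := surjectiveSubmersions_iff.2
    ⟨fun y => ⟨_, toFun_toFun_inv f y⟩, isSubmersionAt_of_isIso f⟩
  comp f g hf hg := by
    rw [surjectiveSubmersions_iff] at hf hg ⊢
    exact ⟨hg.1.comp hf.1, fun x => (hg.2 _).comp (hf.2 x)⟩
  hasPullback f g hf :=
    (isPullback_fibreProduct f g (surjectiveSubmersions_iff.1 hf).2).hasPullback
  pullback {P X Y Z p q f g} sq hf := by
    obtain ⟨hf₁, hf₂⟩ := surjectiveSubmersions_iff.1 hf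
    have sq' := isPullback_fibreProduct f g hf₂
    -- Any pullback is isomorphic to the explicit fibre product, so it is enough to treat the latter
    -- and precompose with an isomorphism.
    rw [← sq.isoIsPullback_hom_snd _ _ sq', surjectiveSubmersions_iff]
    refine ⟨fun z => ?_, fun x =>
      (isSubmersionAt_fibreProductSnd f g hf₂ _).comp (isSubmersionAt_of_isIso _ x)⟩
    obtain ⟨y, hy⟩ := hf₁ (Hom.toFun g z)
    exact ⟨_, congrArg (Hom.toFun (fibreProductSnd f g hf₂))
      (toFun_toFun_inv (sq.isoIsPullback _ _ sq').hom ⟨(y, z), hy⟩)⟩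

lemma epi_of_surjectiveSubmersions {f : M ⟶ N} (hf : surjectiveSubmersions f) : Epi f where
  left_cancellation g h w := by
    refine Hom.ext (funext fun y => ?_)
    obtain ⟨x, rfl⟩ := hf.1 y
    exact congrArg (fun k => Hom.toFun k x) w

lemma toFun_injective_of_mono (f : M ⟶ N) [Mono f] : Function.Injective (Hom.toFun f) := by
  intro x y h
  have : const point.{u} x = const point.{u} y := by
    rw [← cancel_mono f]
    exact Hom.ext (funext fun _ => h)
  exact congrArg (fun k => Hom.toFun k PUnit.unit) this

/-- A monomorphism is injective on points, so the set-theoretic inverse agrees near each point with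
a local lift of the inverse of a chart, which is smooth. -/
lemma isIso_of_surjectiveSubmersions {f : M ⟶ N} (hf : surjectiveSubmersions f) (_ : Mono f) :
    IsIso f := by
  obtain ⟨hf₁, hf₂⟩ := surjectiveSubmersions_iff.1 hf
  have hinv := Function.surjInv_eq hf₁
  have hsmooth : IsSmooth (Function.surjInv hf₁) := by
    refine isSmooth_of_isPlotAt fun y => ?_
    obtain ⟨n, e, he, hy⟩ := N.exists_chart y
    obtain ⟨k, -, hk', hk''⟩ := hf₂ (Function.surjInv hf₁ y) n e.symm (e y)
      ((e.left_inv hy).trans (hinv y).symm)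
      (Filter.mem_of_superset (e.open_target.mem_nhds (e.map_source hy))
        fun b hb => isPlotAt_symm he hb)
    refine ⟨n, e, he, hy, hk'.self_of_nhds.congr ?_⟩
    filter_upwards [hk''] with b hb
    exact toFun_injective_of_mono f ((hinv _).trans hb.symm)
  exact ⟨⟨_, hsmooth⟩, Hom.ext (funext fun x => toFun_injective_of_mono f (hinv _)),
    Hom.ext (funext hinv)⟩

/-- Testing with the initial object gives surjectivity. Testing with the point, mapped to `a`, gives
a submersion `u = x ≫ g` with `a` in the image of `x`; so `g` is a submersion at `a`. -/
lemma detectsCovers_surjectiveSubmersions : DetectsCovers surjectiveSubmersions.{u} := by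
  intro A B g h
  rw [surjectiveSubmersions_iff]
  constructor
  · obtain ⟨Z, u, w, x, hu, -, hx, -⟩ := h (⊥_ _) (fun Z u _ => ⟨initial.to Z, initial.hom_ext _ _⟩)
      (initial.to B) (initial.to A) (initial.hom_ext _ _)
    intro b
    obtain ⟨z, rfl⟩ := hu.1 b
    exact ⟨Hom.toFun x z, congrArg (fun k => Hom.toFun k z) hx⟩
  · intro a
    have hpoint : IsProjectiveFor surjectiveSubmersions point.{u} := by
      intro Z u hu
      obtain ⟨z, -⟩ := hu.1 PUnit.unit
      exact ⟨const _ z, rfl⟩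
    obtain ⟨Z, u, w, x, hu, -, rfl, hx⟩ := h point hpoint (const _ (Hom.toFun g a)) (const _ a) rfl
    have hx' : Hom.toFun x (Hom.toFun w PUnit.unit) = a :=
      congrArg (fun k => Hom.toFun k PUnit.unit) hx
    rw [← hx']
    exact IsSubmersionAt.of_comp (Hom.smooth x)
      ((surjectiveSubmersions_iff.1 hu).2 (Hom.toFun w PUnit.unit))

/-! ### Coproducts of points -/

section Discrete

variable (ι : Type) [Countable ι]

/-- A countable set as a manifold of dimension zero. -/
def discrete : Mfd.{u} where
  carrier := ULift.{u} ι
  top := ⊥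
  t2 := @DiscreteTopology.toT2Space _ ⊥ (@DiscreteTopology.mk _ ⊥ rfl)
  secondCountable := @DiscreteTopology.secondCountableTopology_of_countable _ ⊥
    (@DiscreteTopology.mk _ ⊥ rfl) _
  atlas n := { _e | n = 0 }
  exists_chart x := by
    let : TopologicalSpace (ULift.{u} ι) := ⊥
    have : DiscreteTopology (ULift.{u} ι) := ⟨rfl⟩
    have h : IsOpenEmbedding fun _ : EuclideanSpace ℝ (Fin 0) => x :=
      .of_continuous_injective_isOpenMap continuous_const (Function.injective_of_subsingleton _)
        fun _ _ => isOpen_discrete _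
    exact ⟨0, (h.toOpenPartialHomeomorph _).symm, rfl, ⟨0, trivial, rfl⟩⟩
  compatible := by
    intro n p e hn e' hp
    obtain rfl : n = 0 := hn
    obtain rfl : p = 0 := hp
    exact contDiff_of_subsingleton.contDiffOn

lemma isSmooth_of_discrete (f : (discrete.{u} ι).carrier → N.carrier) : IsSmooth f :=
  isSmooth_of_isPlotAt fun x => by
    obtain ⟨n, e, hn, hx⟩ := (discrete.{u} ι).exists_chart x
    obtain rfl : n = 0 := hn
    refine ⟨0, e, rfl, hx, (isPlotAt_const (f (e.symm (e x)))).congr (Eventually.of_forall ?_)⟩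
    intro b
    exact congrArg (fun b => f (e.symm b)) (Subsingleton.elim _ _)

instance : Subsingleton (⊤_ Mfd.{u}).carrier where
  allEq x y := by
    have h : 𝟙 (⊤_ Mfd.{u}) = const _ y := terminal.hom_ext _ _
    exact congrArg (fun k => Hom.toFun k x) h

/-- The cofan of points in a discrete manifold. -/
noncomputable def discreteCofan : Cofan fun _ : ι => ⊤_ Mfd.{u} :=
  Cofan.mk (discrete.{u} ι) fun i => const _ (ULift.up i)

/-- A countable set is the coproduct of its points. -/
noncomputable def isColimitDiscreteCofan : IsColimit (discreteCofan.{u} ι) :=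
  Cofan.IsColimit.mk _
    (fun s => ⟨fun x => Hom.toFun (s.inj (ULift.down x))
      (Hom.toFun (terminal.from point.{u}) PUnit.unit), isSmooth_of_discrete ι _⟩)
    (fun s i => Hom.ext (funext fun _ =>
      congrArg (Hom.toFun (s.inj i)) (Subsingleton.elim _ _)))
    (fun _ _ hm => Hom.ext (funext fun x => congrArg (fun k => Hom.toFun k
      (Hom.toFun (terminal.from point.{u}) PUnit.unit)) (hm (ULift.down x))))

/-- A continuous germ into a discrete space is constant, so the constant germ at `x` lifts it. -/
lemma isSubmersionAt_const_discrete (i : ι) (x : M.carrier) :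
    IsSubmersionAt (Hom.toFun (const (N := discrete.{u} ι) M (ULift.up i))) x := by
  intro q h a ha hh
  have : DiscreteTopology (discrete.{u} ι).carrier := ⟨rfl⟩
  refine ⟨fun _ => x, rfl, Eventually.of_forall fun b => isPlotAt_const x, ?_⟩
  filter_upwards [hh.self_of_nhds.1.eventually ((isOpen_discrete {h a}).mem_nhds rfl)] with b hb
  exact ha.symm.trans hb.symm

lemma isSubmersionAt_sigma_ι [HasCoproduct fun _ : ι => ⊤_ Mfd.{u}] (i : ι)
    (x : (⊤_ Mfd.{u}).carrier) :
    IsSubmersionAt (Hom.toFun (Sigma.ι (fun _ : ι => ⊤_ Mfd.{u}) i)) x := by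
  let φ := (isColimitDiscreteCofan.{u} ι).coconePointUniqueUpToIso
    (coproductIsCoproduct fun _ : ι => ⊤_ Mfd.{u})
  have h : const _ (ULift.up i) ≫ φ.hom = Sigma.ι (fun _ : ι => ⊤_ Mfd.{u}) i :=
    IsColimit.comp_coconePointUniqueUpToIso_hom (isColimitDiscreteCofan.{u} ι)
      (coproductIsCoproduct fun _ : ι => ⊤_ Mfd.{u}) ⟨i⟩
  rw [← h]
  exact (isSubmersionAt_of_isIso φ.hom _).comp (isSubmersionAt_const_discrete ι i x)

/-- Inclusions of points of a discrete manifold are submersions, though not surjective in general,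
and fibre products along submersions exist. -/
lemma hasPullback_sigma_ι [HasCoproduct fun _ : ι => ⊤_ Mfd.{u}] (i : ι)
    (f : M ⟶ ∐ fun _ : ι => ⊤_ Mfd.{u}) :
    HasPullback f (Sigma.ι (fun _ : ι => ⊤_ Mfd.{u}) i) :=
  (isPullback_fibreProduct _ f (isSubmersionAt_sigma_ι ι i)).flip.hasPullback

end Discrete

end Mfd

theorem mainTheorem11 :
    -- general pretopologies
    (∀ (C : Type u) [Category.{v} C] [HasTerminal C] [FinitaryExtensive C]
        (J : MorphismProperty C), HigherGpd.IsSingletonPretopology J →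
        HigherGpd.CompatibleWithCoproducts J → HigherGpd.RightCancellative J →
      ∀ (n : ℕ∞) (Y : SimplicialObject C) (π : Y ⟶ HigherGpd.jInterval C),
        HigherGpd.EndsAreNGroupoids J n π → HigherGpd.SatisfiesInnerKan J n π →
      ∀ m i j : ℕ, i + j = m + 1 →
        (2 ≤ i → HigherGpd.ColoredKan J π m 0 i) ∧
        (2 ≤ j → HigherGpd.ColoredKan J π m (Fin.last m) i)) ∧
    -- sets and surjections, uniqueness for 2-groupoids
    (∀ (Y : SimplicialObject (Type w)) (π : Y ⟶ HigherGpd.jInterval (Type w)),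
        HigherGpd.EndsAreNGroupoids (MorphismProperty.surjective (Type w)) 2 π →
        HigherGpd.SatisfiesInnerKan (MorphismProperty.surjective (Type w)) 2 π →
      ∀ m i j : ℕ, 2 < m → i + j = m + 1 →
        (2 ≤ i → HigherGpd.ColoredKan (MorphismProperty.isomorphisms (Type w)) π m 0 i) ∧
        (2 ≤ j →
          HigherGpd.ColoredKan (MorphismProperty.isomorphisms (Type w)) π m (Fin.last m) i)) ∧
    -- manifolds and surjective submersions
    (∀ (n : ℕ∞) (Y : SimplicialObject Mfd.{w}) (π : Y ⟶ HigherGpd.jInterval Mfd.{w}),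
        HigherGpd.EndsAreNGroupoids Mfd.surjectiveSubmersions n π →
        HigherGpd.SatisfiesInnerKan Mfd.surjectiveSubmersions n π →
      ∀ m i j : ℕ, i + j = m + 1 →
        (2 ≤ i → HigherGpd.ColoredKan Mfd.surjectiveSubmersions π m 0 i) ∧
        (2 ≤ j → HigherGpd.ColoredKan Mfd.surjectiveSubmersions π m (Fin.last m) i)) ∧
    -- manifolds and surjective submersions, uniqueness for 2-groupoids
    (∀ (Y : SimplicialObject Mfd.{w}) (π : Y ⟶ HigherGpd.jInterval Mfd.{w}),
        HigherGpd.EndsAreNGroupoids Mfd.surjectiveSubmersions 2 π →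
        HigherGpd.SatisfiesInnerKan Mfd.surjectiveSubmersions 2 π →
      ∀ m i j : ℕ, 2 < m → i + j = m + 1 →
        (2 ≤ i → HigherGpd.ColoredKan (MorphismProperty.isomorphisms Mfd.{w}) π m 0 i) ∧
        (2 ≤ j →
          HigherGpd.ColoredKan (MorphismProperty.isomorphisms Mfd.{w}) π m (Fin.last m) i)) := by
  refine ⟨fun C _ _ _ J hJ _ hJ' n Y π hE hπ m i j hij => ?_,
    fun Y π hE hπ m i j hm hij => ?_, fun n Y π hE hπ m i j hij => ?_,
    fun Y π hE hπ m i j hm hij => ?_⟩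
  -- Extensivity supplies the pullbacks of `π` along coproduct injections that represent the colored
  -- simplices.
  · exact HigherGpd.coloredKan_outer hJ (HigherGpd.detectsCovers_of_rightCancellative hJ')
      (fun n f => FinitaryPreExtensive.hasPullbacks_of_is_coproduct (colimit.isColimit _) ⟨f⟩ _)
      hE hπ hij
  · exact HigherGpd.coloredKan_isomorphisms_outer HigherGpd.isSingletonPretopology_surjective
      (HigherGpd.detectsCovers_of_rightCancellative HigherGpd.rightCancellative_surjective)
      (fun f hf => (epi_iff_surjective f).2 hf)
      (fun f hf hf' => (isIso_iff_bijective f).2 ⟨(mono_iff_injective f).1 hf', hf⟩)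
      (fun n f => inferInstance) hE hπ hm hij
  · exact HigherGpd.coloredKan_outer Mfd.isSingletonPretopology_surjectiveSubmersions
      Mfd.detectsCovers_surjectiveSubmersions (fun n f => Mfd.hasPullback_sigma_ι _ f _) hE hπ hij
  · exact HigherGpd.coloredKan_isomorphisms_outer
      Mfd.isSingletonPretopology_surjectiveSubmersions Mfd.detectsCovers_surjectiveSubmersions
      (fun f hf => Mfd.epi_of_surjectiveSubmersions hf)
      (fun f hf hf' => Mfd.isIso_of_surjectiveSubmersions hf hf')
      (fun n f => Mfd.hasPullback_sigma_ι _ f _) hE hπ hm hij
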